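/- **Setting.** Let $V$ be a vertex operator algebra over $\mathbb{C}$, let $\mathcal{W}$ be the category of weak $V$-modules, and let $\mathcal{C}\subseteq\mathcal{W}$ be a full subcategory of grading-restricted generalized $V$-modules which contains $0$, is closed under submodules, quotients and finite direct sums, and whose objects are all finitely generated. An intertwining operator of type $\binom{W_3}{W_1\,W_2}$ is a (logarithmic) intertwining operator $\mathcal{Y}(w_1,x)w_2=\sum_{h\in\mathbb{C}}\sum_{k\in\mathbb{N}}(w_1)_{h,k}w_2\,x^{-h-1}(\log x)^k\in W_3[\log x]\{x\}$; its image $\operatorname{im}\mathcal{Y}$ is the span of all $(w_1)_{h,k}w_2$. For a generalized module $X=\bigoplus_{h\in\mathbb{C}}X_{[h]}$ write $\pi_h$ for the projection to the generalized $L(0)$-eigenspace $X_{[h]}$, $\overline{X}=\prod_h X_{[h]}$, $X'=\bigoplus_h X_{[h]}^*$, and $\overline{f}:\overline{X}\to\overline{Y}$ for the extension of a homomorphism $f:X\to Y$. A series of elements of $\overline{X}$ converges absolutely to $s\in\overline{X}$ if, after pairing with any $x'\in X'$, it converges absolutely to $\langle x',s\rangle$. Substituting $e^{\ell}$ for $x$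 means $x^{-h-1}\mapsto e^{(-h-1)\ell}$, $\log x\mapsto\ell$. For a full subcategory $\mathcal{D}\subseteq\mathcal{W}$ of generalized $V$-modules with $V\in\mathcal{D}$, a $\mathbb{C}$-linear braided tensor category structure with twist $(\boxtimes,V,l,r,\mathcal{A},\mathcal{R},\theta)$ on $\mathcal{D}$ (where $\mathcal{A}_{X_1,X_2,X_3}:X_1\boxtimes(X_2\boxtimes X_3)\to(X_1\boxtimes X_2)\boxtimes X_3$, $\theta_V=\mathrm{Id}_V$ and $\theta_{X_1\boxtimes X_2}=\mathcal{R}_{X_2,X_1}\circ\mathcal{R}_{X_1,X_2}\circ(\theta_{X_1}\boxtimes\theta_{X_2})$) is called *vertex algebraic*, with tensor product intertwining operators $\mathcal{Y}_{X_1,X_2}$ of type $\binom{X_1\boxtimes X_2}{X_1\,X_2}$, if for all objects of $\mathcal{D}$ and all vectors $b,b_1,b_2,b_3$ in them: 0. for every intertwining operator $\mathcal{Y}$ of type $\binom{X_3}{X_1\,X_2}$ there is a unique homomorphism $f:X_1\boxtimes X_2\to X_3$ with $\mathcal{Y}=f\circ\mathcal{Y}_{X_1,X_2}$; 1. for morphisms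 $F_1:X_1\to\widetilde X_1$, $F_2:X_2\to\widetilde X_2$, the morphism $F_1\boxtimes F_2$ is characterized by $(F_1\boxtimes F_2)(\mathcal{Y}_{X_1,X_2}(b_1,x)b_2)=\mathcal{Y}_{\widetilde X_1,\widetilde X_2}(F_1(b_1),x)F_2(b_2)$; 2. $l_X$ and $r_X$ are characterized by $l_X(\mathcal{Y}_{V,X}(v,x)b)=Y_X(v,x)b$ and $r_X(\mathcal{Y}_{X,V}(b,x)v)=e^{xL(-1)}Y_X(v,-x)b$ for $v\in V$; 3. for all intertwining operators $\mathcal{Y}_1$ of type $\binom{W_4}{W_1\,M}$ and $\mathcal{Y}_2$ of type $\binom{M}{W_2\,W_3}$ among objects of $\mathcal{D}$, the product $\sum_{h}\mathcal{Y}_1(w_1,z_1)\pi_h(\mathcal{Y}_2(w_2,z_2)w_3)$ converges absolutely to an element of $\overline{W_4}$ for $|z_1|>|z_2|>0$ and, for all $\mathcal{Y}^1$ of type $\binom{W_4}{M\,W_3}$ and $\mathcal{Y}^2$ of type $\binom{M}{W_1\,W_2}$, the iterate $\sum_h\mathcal{Y}^1(\pi_h(\mathcal{Y}^2(w_1,z_0)w_2),z_2)w_3$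 converges absolutely to an element of $\overline{W_4}$ for $|z_2|>|z_0|>0$, for all choices of branches of logarithm; and for real $r_1>r_2>r_1-r_2>0$ the series $$\sum_{h\in\mathbb{C}}\mathcal{Y}_{X_1,X_2\boxtimes X_3}(b_1,e^{\ln r_1})\pi_h\big(\mathcal{Y}_{X_2,X_3}(b_2,e^{\ln r_2})b_3\big),\qquad \sum_{h\in\mathbb{C}}\mathcal{Y}_{X_1\boxtimes X_2,X_3}\big(\pi_h(\mathcal{Y}_{X_1,X_2}(b_1,e^{\ln(r_1-r_2)})b_2),e^{\ln r_2}\big)b_3$$ converge absolutely to elements $p\in\overline{X_1\boxtimes(X_2\boxtimes X_3)}$ and $q\in\overline{(X_1\boxtimes X_2)\boxtimes X_3}$, and $\overline{\mathcal{A}_{X_1,X_2,X_3}}(p)=q$; 4. $\mathcal{R}_{X_1,X_2}$ is characterized by $\mathcal{R}_{X_1,X_2}(\mathcal{Y}_{X_1,X_2}(b_1,x)b_2)=e^{xL(-1)}\mathcal{Y}_{X_2,X_1}(b_2,e^{\pi i}x)b_1$; 5. $\theta_X=e^{2\pi iL(0)}$. Let $\mathrm{Ind}(\mathcal{C})\subseteq\mathcal{W}$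 be the full subcategory of objects isomorphic to direct limits in $\mathcal{W}$ of direct systems in $\mathcal{C}$ (indexed by directed sets). Assume that $\mathcal{C}$ contains $V$ and has a vertex algebraic braided tensor category structure with twist $(\boxtimes,V,l,r,\mathcal{A},\mathcal{R},\theta)$, with tensor product intertwining operators $\mathcal{Y}_{W_1,W_2}$, and that $\operatorname{im}\mathcal{Y}\in\mathcal{C}$ for every intertwining operator $\mathcal{Y}$ of type $\binom{X}{W_1\,W_2}$ with $W_1,W_2\in\mathcal{C}$ and $X\in\mathrm{Ind}(\mathcal{C})$. For a weak module $X$ let $I_X$ be the directed set of submodules $W\subseteq X$ that are objects of $\mathcal{C}$, with inclusions $i_W:W\to X$. A braided tensor category structure with twist $(\widehat\boxtimes,V,\mathfrak{l},\mathfrak{r},\mathfrak{A},\widehat{\mathcal{R}},\Theta)$ on $\mathrm{Ind}(\mathcal{C})$ is a *direct limit extension* of that on $\mathcal{C}$ if there are morphisms $\phi_{W_1,W_2}:W_1\boxtimes W_2\to X_1\widehat\boxtimes X_2$ ($W_j\in I_{X_j}$) that make $X_1\widehat\boxtimes X_2$ a direct limit in $\mathcal{W}$ of the system $(W_1\boxtimes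 W_2)_{(W_1,W_2)\in I_{X_1}\times I_{X_2}}$ and such that (with $U\in I_V$) $$(F_1\widehat\boxtimes F_2)\circ\phi_{W_1,W_2}=\phi_{F_1(W_1),F_2(W_2)}\circ(F_1|_{W_1}\boxtimes F_2|_{W_2}),\qquad \widehat{\mathcal{R}}_{X_1,X_2}\circ\phi_{W_1,W_2}=\phi_{W_2,W_1}\circ\mathcal{R}_{W_1,W_2},\qquad \Theta_X\circ i_W=i_W\circ\theta_W,$$ $$\mathfrak{l}_X\circ\phi_{U,W}=i_W\circ l_W\circ(i_U\boxtimes\mathrm{Id}_W),\qquad \mathfrak{r}_X\circ\phi_{W,U}=i_W\circ r_W\circ(\mathrm{Id}_W\boxtimes i_U),$$ $$\mathfrak{A}_{X_1,X_2,X_3}\circ\phi_{W_1,\operatorname{im}\phi_{W_2,W_3}}\circ(\mathrm{Id}_{W_1}\boxtimes\phi'_{W_2,W_3})=\phi_{\operatorname{im}\phi_{W_1,W_2},W_3}\circ(\phi'_{W_1,W_2}\boxtimes\mathrm{Id}_{W_3})\circ\mathcal{A}_{W_1,W_2,W_3},$$ where $\phi'_{W_1,W_2}:W_1\boxtimes W_2\to\operatorname{im}\phi_{W_1,W_2}$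 is the corestriction of $\phi_{W_1,W_2}$. **Theorem 6.2.** Such a direct limit extension exists. Moreover every direct limit extension $(\widehat\boxtimes,V,\mathfrak{l},\mathfrak{r},\mathfrak{A},\widehat{\mathcal{R}},\Theta)$, with morphisms $\phi_{W_1,W_2}$, is vertex algebraic, with the tensor product intertwining operators $\mathcal{Y}_{X_1,X_2}$ of type $\binom{X_1\widehat\boxtimes X_2}{X_1\,X_2}$ determined by $$\mathcal{Y}_{X_1,X_2}\circ(i_{W_1}\otimes i_{W_2})=\phi_{W_1,W_2}\circ\mathcal{Y}_{W_1,W_2}\qquad(W_1\in I_{X_1},\ W_2\in I_{X_2}).$$ That is, $\mathrm{Ind}(\mathcal{C})$ consists of generalized modules, and (0)–(5) hold for $\mathcal{D}=\mathrm{Ind}(\mathcal{C})$ with these $\mathcal{Y}_{X_1,X_2}$. -/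

import Mathlib

open CategoryTheory MonoidalCategory Limits

universe u

noncomputable section

namespace VTC

/-! ### Vertex operator algebras and weak modules -/

/-- The integer binomial coefficient `l (l - 1) ⋯ (l - i + 1) / i!`, as a complex number. -/
def bin (l : ℤ) (i : ℕ) : ℂ := ((Ring.choose l i : ℤ) : ℂ)

/-- A vertex operator algebra `(V, Y, 𝟏, ω)` over `ℂ`. Here `Y v n` is the mode `vₙ`, that is,
`Y(v, x) = ∑ₙ vₙ x ^ (- n - 1)`, and `L(n) = ω_{n + 1}`. The Jacobi identity is
written in components: it is the coefficient of `x₀ ^ (- l - 1) x₁ ^ (- m - 1) x₂ ^ (- n - 1)` of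
the identity of formal series (all sums are finite, by lower truncation). The `ℤ`-grading by
conformal weights is the grading by `L(0)`-eigenspaces. -/
class VertexOperatorAlgebra (V : Type u) [AddCommGroup V] [Module ℂ V] where
  Y : V →ₗ[ℂ] (ℤ → Module.End ℂ V)
  /-- the vacuum vector -/
  vac : V
  /-- the conformal vector -/
  ω : V
  /-- the central charge -/
  c : ℂ
  lower_truncation : ∀ u v : V, ∃ N : ℤ, ∀ n ≥ N, Y u n v = 0
  vacuum : ∀ n : ℤ, Y vac n = if n = -1 then 1 else 0
  creation : ∀ v : V, Y v (-1) vac = v ∧ ∀ n : ℕ, Y v n vac = 0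
  jacobi : ∀ (u v w : V) (l m n : ℤ),
    (∑ᶠ i : ℕ, ((-1 : ℂ) ^ i * bin l i) • Y u (l + m - i) (Y v (n + i) w))
      - (-1 : ℂ) ^ l • ∑ᶠ i : ℕ, ((-1 : ℂ) ^ i * bin l i) • Y v (l + n - i) (Y u (m + i) w)
      = ∑ᶠ i : ℕ, bin m i • Y (Y u (l + i) v) (m + n - i) w
  virasoro : ∀ m n : ℤ,
    Y ω (m + 1) * Y ω (n + 1) - Y ω (n + 1) * Y ω (m + 1)
      = ((m : ℂ) - n) • Y ω (m + n + 1)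
        + if m + n = 0 then ((((m : ℂ) ^ 3 - m) / 12) * c) • (1 : Module.End ℂ V) else 0
  graded : DirectSum.IsInternal fun n : ℤ => Module.End.eigenspace (Y ω 1) (n : ℂ)
  finite_weight_spaces :
    ∀ n : ℤ, FiniteDimensional ℂ (Module.End.eigenspace (Y ω 1) (n : ℂ))
  weights_bounded_below :
    ∃ N : ℤ, ∀ n < N, Module.End.eigenspace (Y ω 1) (n : ℂ) = ⊥
  vac_weight : Y ω 1 vac = 0
  conformal_weight : Y ω 1 ω = (2 : ℂ) • ω
  derivative : ∀ (v : V) (n : ℤ), Y (Y ω 0 v) n = (-(n : ℂ)) • Y v (n - 1)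

variable (V : Type u) [AddCommGroup V] [Module ℂ V] [VertexOperatorAlgebra V]

/-- A weak `V`-module, with vertex operator `Y_W(v, x) = ∑ₙ vₙ x ^ (- n - 1)`, where `vₙ` is
`mode v n`. -/
structure WeakModule where
  carrier : Type u
  [addCommGroup : AddCommGroup carrier]
  [module : Module ℂ carrier]
  mode : V →ₗ[ℂ] (ℤ → Module.End ℂ carrier)
  lower_truncation : ∀ (v : V) (w : carrier), ∃ N : ℤ, ∀ n ≥ N, mode v n w = 0
  vacuum : ∀ n : ℤ, mode (VertexOperatorAlgebra.vac : V) n = if n = -1 then 1 else 0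
  jacobi : ∀ (v₁ v₂ : V) (w : carrier) (l m n : ℤ),
    (∑ᶠ i : ℕ, ((-1 : ℂ) ^ i * bin l i) • mode v₁ (l + m - i) (mode v₂ (n + i) w))
      - (-1 : ℂ) ^ l •
        ∑ᶠ i : ℕ, ((-1 : ℂ) ^ i * bin l i) • mode v₂ (l + n - i) (mode v₁ (m + i) w)
      = ∑ᶠ i : ℕ, bin m i • mode (VertexOperatorAlgebra.Y v₁ (l + i) v₂) (m + n - i) w
  derivative : ∀ (v : V) (n : ℤ),
    mode (VertexOperatorAlgebra.Y (VertexOperatorAlgebra.ω : V) 0 v) n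
      = (-(n : ℂ)) • mode v (n - 1)

variable {V}

namespace WeakModule

instance : CoeSort (WeakModule V) (Type u) := ⟨WeakModule.carrier⟩

instance (X : WeakModule V) : AddCommGroup X := X.addCommGroup

instance (X : WeakModule V) : Module ℂ X := X.module

variable (V) in
/-- `V` as a module for itself. -/
def self : WeakModule V where
  carrier := V
  mode := VertexOperatorAlgebra.Y
  lower_truncation := VertexOperatorAlgebra.lower_truncation
  vacuum := VertexOperatorAlgebra.vacuum
  jacobi := VertexOperatorAlgebra.jacobi
  derivative := VertexOperatorAlgebra.derivative

/-- The Virasoro operator `L(n)` on a weak module. -/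
def L (X : WeakModule V) (n : ℤ) : Module.End ℂ X :=
  X.mode (VertexOperatorAlgebra.ω : V) (n + 1)

/-- A homomorphism of weak modules. -/
@[ext]
structure Hom (X Y : WeakModule V) where
  lin : X →ₗ[ℂ] Y
  map_mode : ∀ (v : V) (n : ℤ) (w : X), lin (X.mode v n w) = Y.mode v n (lin w)

instance : Category (WeakModule V) where
  Hom := Hom
  id X := ⟨LinearMap.id, fun _ _ _ => rfl⟩
  comp f g := ⟨g.lin ∘ₗ f.lin, fun v n w => by simp [f.map_mode, g.map_mode]⟩

@[ext]
theorem hom_ext {X Y : WeakModule V} {f g : X ⟶ Y} (h : Hom.lin f = Hom.lin g) : f = g :=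
  Hom.ext h

/-- The linear map underlying a morphism of weak modules. -/
abbrev lin {X Y : WeakModule V} (f : X ⟶ Y) : X →ₗ[ℂ] Y := Hom.lin f

@[simp] theorem lin_id (X : WeakModule V) : lin (𝟙 X) = LinearMap.id := rfl

@[simp] theorem lin_comp {X Y Z : WeakModule V} (f : X ⟶ Y) (g : Y ⟶ Z) :
    lin (f ≫ g) = lin g ∘ₗ lin f := rfl

instance (X Y : WeakModule V) : Zero (X ⟶ Y) := ⟨⟨0, fun _ _ _ => by simp⟩⟩

instance (X Y : WeakModule V) : Add (X ⟶ Y) :=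
  ⟨fun f g => ⟨lin f + lin g, fun v n w => by simp [f.map_mode, g.map_mode]⟩⟩

instance (X Y : WeakModule V) : Neg (X ⟶ Y) :=
  ⟨fun f => ⟨-lin f, fun v n w => by simp [f.map_mode]⟩⟩

instance (X Y : WeakModule V) : AddCommGroup (X ⟶ Y) where
  nsmul := nsmulRec
  zsmul := zsmulRec
  add_assoc _ _ _ := hom_ext (add_assoc _ _ _)
  zero_add _ := hom_ext (zero_add _)
  add_zero _ := hom_ext (add_zero _)
  add_comm _ _ := hom_ext (add_comm _ _)
  neg_add_cancel _ := hom_ext (neg_add_cancel _)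

instance (X Y : WeakModule V) : Module ℂ (X ⟶ Y) where
  smul r f := ⟨r • lin f, fun v n w => by simp [f.map_mode]⟩
  one_smul _ := hom_ext (one_smul _ _)
  mul_smul _ _ _ := hom_ext (mul_smul _ _ _)
  smul_zero _ := hom_ext (smul_zero _)
  smul_add _ _ _ := hom_ext (smul_add _ _ _)
  add_smul _ _ _ := hom_ext (add_smul _ _ _)
  zero_smul _ := hom_ext (zero_smul _ _)

/-- The `ℂ`-linear structure on the category of weak modules is given by addition and scalar
multiplication of linear maps. -/
instance : Preadditive (WeakModule V) where
  add_comp _ _ _ _ _ _ := hom_ext (LinearMap.comp_add _ _ _)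
  comp_add _ _ _ _ _ _ := hom_ext (LinearMap.add_comp _ _ _)

instance : Linear ℂ (WeakModule V) where
  smul_comp _ _ _ _ _ _ := hom_ext (LinearMap.comp_smul _ _ _)
  comp_smul _ _ _ _ _ _ := hom_ext (LinearMap.smul_comp _ _ _)

/-! ### Generalized modules, graded duals and algebraic completions -/

/-- The generalized `L(0)`-eigenspace `X_[h]`. -/
def wt (X : WeakModule V) (h : ℂ) : Submodule ℂ X := (X.L 0).maxGenEigenspace h

/-- A generalized module: a weak module graded by generalized `L(0)`-eigenspaces. -/
def IsGeneralized (X : WeakModule V) : Prop := DirectSum.IsInternal X.wt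

/-- A grading-restricted generalized module. -/
structure IsGradingRestricted (X : WeakModule V) : Prop where
  generalized : X.IsGeneralized
  finiteDimensional : ∀ h : ℂ, FiniteDimensional ℂ (X.wt h)
  bounded_below : ∀ h : ℂ, ∃ N : ℤ, ∀ n < N, X.wt (h + n) = ⊥

open Classical in
/-- The projection `π_h : X → X_[h]` of a generalized module (it is only used for those). -/
def proj (X : WeakModule V) (h : ℂ) : X →ₗ[ℂ] X.wt h :=
  if hX : X.IsGeneralized then
    DirectSum.component ℂ ℂ (fun h => X.wt h) h ∘ₗ
      (LinearEquiv.ofBijective (DirectSum.coeLinearMap X.wt) hX).symm.toLinearMap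
  else 0

/-- The algebraic completion `∏_h X_[h]`. -/
abbrev Completion (X : WeakModule V) : Type u := ∀ h : ℂ, X.wt h

/-- The graded dual `X' = ⨁_h X_[h]^*`. -/
abbrev GradedDual (X : WeakModule V) : Type u :=
  DirectSum ℂ fun h : ℂ => Module.Dual ℂ (X.wt h)

/-- The pairing of the graded dual with the algebraic completion. -/
def pairing {X : WeakModule V} (x' : X.GradedDual) (x : X.Completion) : ℂ :=
  DirectSum.toModule ℂ ℂ ℂ (fun h => Module.Dual.eval ℂ (X.wt h) (x h)) x'

/-- The series `∑_{h ∈ ℂ} u_h` of elements of the completion, viewed as a series of linear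
functionals on the graded dual, converges absolutely to the element `s` of the completion. -/
def ConvergesAbsolutelyTo {X : WeakModule V} (u : ℂ → X.Completion) (s : X.Completion) : Prop :=
  ∀ x' : X.GradedDual, (Summable fun h : ℂ => ‖pairing x' (u h)‖) ∧
    HasSum (fun h : ℂ => pairing x' (u h)) (pairing x' s)

theorem map_wt {X Y : WeakModule V} (f : X ⟶ Y) (h : ℂ) : ∀ x ∈ X.wt h, lin f x ∈ Y.wt h := by
  intro x hx
  rw [wt, Module.End.mem_maxGenEigenspace] at hx ⊢
  obtain ⟨k, hk⟩ := hx
  refine ⟨k, ?_⟩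
  have key : ∀ (k : ℕ) (x : X), ((Y.L 0 - h • 1) ^ k) (lin f x)
      = lin f (((X.L 0 - h • 1) ^ k) x) := by
    intro k
    induction k with
    | zero => intro x; simp
    | succ k ih =>
      intro x
      rw [pow_succ, pow_succ, Module.End.mul_apply, Module.End.mul_apply, ← ih]
      congr 1
      simp [L, f.map_mode]
  rw [key, hk, map_zero]

/-- The extension of a homomorphism to algebraic completions. -/
def completionMap {X Y : WeakModule V} (f : X ⟶ Y) (x : X.Completion) : Y.Completion :=
  fun h => ⟨lin f (x h), map_wt f h _ (x h).2⟩

/-! ### Submodules -/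

variable (V) in
/-- A `V`-submodule of `X`: a subspace preserved by all modes `vₙ`. -/
structure Sub (X : WeakModule V) extends Submodule ℂ X where
  mode_mem : ∀ (v : V) (n : ℤ) {w : X}, w ∈ toSubmodule → X.mode v n w ∈ toSubmodule

/-- `V`-submodules are ordered by inclusion. -/
instance (X : WeakModule V) : Preorder (Sub V X) := Preorder.lift Sub.toSubmodule

namespace Sub

variable {X : WeakModule V}

theorem coe_finsum (S : Submodule ℂ X) (f : ℕ → S) :
    ((∑ᶠ i, f i : S) : X) = ∑ᶠ i, (f i : X) :=
  AddMonoidHom.map_finsum_of_injective S.subtype.toAddMonoidHom S.injective_subtype f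

/-- A submodule as a weak module. -/
def toWeakModule (S : Sub V X) : WeakModule V where
  carrier := S.toSubmodule
  mode :=
    { toFun := fun v n => (X.mode v n).restrict fun _ hw => S.mode_mem v n hw
      map_add' := fun _ _ => by ext; simp
      map_smul' := fun _ _ => by ext; simp }
  lower_truncation v w := by
    obtain ⟨N, hN⟩ := X.lower_truncation v w
    exact ⟨N, fun n hn => Subtype.ext (hN n hn)⟩
  vacuum n := by
    ext w
    have := X.vacuum n
    by_cases h : n = -1 <;> simp_all
  jacobi v₁ v₂ w l m n := by
    apply Subtype.ext
    simpa [coe_finsum] using X.jacobi v₁ v₂ w l m n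
  derivative v n := by
    ext w
    simpa using congrArg (fun A : Module.End ℂ X => A w) (X.derivative v n)

/-- The inclusion of a submodule. -/
def incl (S : Sub V X) : S.toWeakModule ⟶ X where
  lin := S.toSubmodule.subtype
  map_mode _ _ _ := rfl

/-- The inclusion of a submodule into a larger one. -/
def inclOfLE {S T : Sub V X} (h : S ≤ T) : S.toWeakModule ⟶ T.toWeakModule where
  lin := Submodule.inclusion h
  map_mode _ _ _ := rfl

end Sub

/-- `X` is finitely generated: some finite subset lies in no proper submodule. -/
def IsFinitelyGenerated (X : WeakModule V) : Prop :=
  ∃ s : Finset X, ∀ S : Sub V X, (∀ x ∈ s, x ∈ S.toSubmodule) → ∀ x : X, x ∈ S.toSubmodule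

end WeakModule

/-! ### Logarithmic formal series and intertwining operators -/

/-- A formal series `∑_{h ∈ ℂ, k ∈ ℕ} s h k x ^ (- h - 1) (log x) ^ k`. -/
abbrev LogSeries (X : WeakModule V) : Type u := ℂ → ℕ → X

namespace LogSeries

variable {X : WeakModule V}

open Classical in
/-- The series `∑_{n ∈ ℤ} a n x ^ (- n - 1)`. -/
def ofModes (a : ℤ → X) : LogSeries X := fun h k =>
  if hn : k = 0 ∧ ∃ n : ℤ, (n : ℂ) = h then a hn.2.choose else 0

theorem ofModes_intCast (a : ℤ → X) (n : ℤ) : ofModes a n 0 = a n := by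
  have hn : (0 : ℕ) = 0 ∧ ∃ m : ℤ, (m : ℂ) = (n : ℂ) := ⟨rfl, n, rfl⟩
  rw [ofModes, dif_pos hn, Int.cast_injective hn.2.choose_spec]

/-- The series `e ^ {x L(-1)} s(x)` (for lower-truncated `s`). -/
def expL (s : LogSeries X) : LogSeries X := fun h k =>
  ∑ᶠ j : ℕ, ((j.factorial : ℂ)⁻¹) • ((X.L (-1)) ^ j) (s (h + j) k)

/-- The series `s(e ^ {π i} x)`: `x ^ (- h - 1)` is replaced by
`e ^ {π i (- h - 1)} x ^ (- h - 1)`, and `log x` is replaced by `log x + π i`. -/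
def rotate (s : LogSeries X) : LogSeries X := fun h k =>
  Complex.exp (Real.pi * Complex.I * (-h - 1)) •
    ∑ᶠ j : ℕ, (((k + j).choose k : ℂ) * (Real.pi * Complex.I) ^ j) • s h (k + j)

/-- The element `s(e ^ ℓ)` of the algebraic completion: `x ^ (- h - 1)` is replaced by
`e ^ {ℓ (- h - 1)}`, and `log x` is replaced by `ℓ`. In each weight space only finitely many
terms survive, for the series given by intertwining operators among generalized modules. -/
def eval (s : LogSeries X) (ℓ : ℂ) : X.Completion := fun n =>
  ∑ᶠ p : ℂ × ℕ, (Complex.exp (ℓ * (-p.1 - 1)) * ℓ ^ p.2) • X.proj n (s p.1 p.2)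

end LogSeries

/-- A (logarithmic) intertwining operator `𝒴` of type `W₃` over `W₁, W₂`:
`𝒴(w₁, x) w₂ = ∑_{h, k} coeff w₁ w₂ h k x ^ (- h - 1) (log x) ^ k`, where for each `h` only
finitely many `k` occur. The Jacobi identity is written in components, as the coefficient of
`x₀ ^ (- l - 1) x₁ ^ (- m - 1) x₂ ^ (- h - 1) (log x₂) ^ k`. -/
structure IntertwiningOperator (W₁ W₂ W₃ : WeakModule V) where
  coeff : W₁ →ₗ[ℂ] W₂ →ₗ[ℂ] (ℂ → ℕ → W₃)
  polynomial_in_log : ∀ (w₁ : W₁) (w₂ : W₂) (h : ℂ), {k : ℕ | coeff w₁ w₂ h k ≠ 0}.Finite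
  lower_truncation : ∀ (w₁ : W₁) (w₂ : W₂) (h : ℂ),
    ∃ N : ℕ, ∀ n ≥ N, ∀ k : ℕ, coeff w₁ w₂ (h + n) k = 0
  jacobi : ∀ (v : V) (w₁ : W₁) (w₂ : W₂) (l m : ℤ) (h : ℂ) (k : ℕ),
    (∑ᶠ i : ℕ, ((-1 : ℂ) ^ i * bin l i) • W₃.mode v (l + m - i) (coeff w₁ w₂ (h + i) k))
      - (-1 : ℂ) ^ l •
        ∑ᶠ i : ℕ, ((-1 : ℂ) ^ i * bin l i) • coeff w₁ (W₂.mode v (m + i) w₂) (h + l - i) k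
      = ∑ᶠ i : ℕ, bin m i • coeff (W₁.mode v (l + i) w₁) w₂ (h + m - i) k
  derivative : ∀ (w₁ : W₁) (w₂ : W₂) (h : ℂ) (k : ℕ),
    coeff (W₁.L (-1) w₁) w₂ h k
      = (-h) • coeff w₁ w₂ (h - 1) k + ((k : ℂ) + 1) • coeff w₁ w₂ (h - 1) (k + 1)

namespace IntertwiningOperator

variable {W₁ W₂ W₃ : WeakModule V}

/-- The formal series `𝒴(w₁, x) w₂`. -/
def series (𝒴 : IntertwiningOperator W₁ W₂ W₃) (w₁ : W₁) (w₂ : W₂) : LogSeries W₃ :=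
  𝒴.coeff w₁ w₂

/-- The image `im 𝒴`, the span of all coefficients of all series `𝒴(w₁, x) w₂`. -/
def im (𝒴 : IntertwiningOperator W₁ W₂ W₃) : WeakModule.Sub V W₃ where
  toSubmodule := Submodule.span ℂ {w | ∃ w₁ w₂ h k, 𝒴.series w₁ w₂ h k = w}
  mode_mem v n w hw := by
    set S := Submodule.span ℂ {w | ∃ w₁ w₂ h k, 𝒴.series w₁ w₂ h k = w} with hS
    have mem : ∀ w₁ w₂ h k, 𝒴.coeff w₁ w₂ h k ∈ S := fun w₁ w₂ h k =>
      Submodule.subset_span ⟨w₁, w₂, h, k, rfl⟩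
    have fs : ∀ f : ℕ → W₃, (∀ i, f i ∈ S) → (∑ᶠ i, f i) ∈ S := fun f hf =>
      finsum_induction (· ∈ S) S.zero_mem (fun _ _ => S.add_mem) hf
    induction hw using Submodule.span_induction with
    | zero => rw [map_zero]; exact S.zero_mem
    | add x y _ _ hx hy => rw [map_add]; exact S.add_mem hx hy
    | smul a x _ hx => rw [map_smul]; exact S.smul_mem _ hx
    | mem x hx =>
      obtain ⟨w₁, w₂, h, k, rfl⟩ := hx
      have J := 𝒴.jacobi v w₁ w₂ 0 n h k
      have h1 : (∑ᶠ i : ℕ, ((-1 : ℂ) ^ i * bin 0 i) •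
          W₃.mode v (0 + n - i) (𝒴.coeff w₁ w₂ (h + i) k))
          = W₃.mode v n (𝒴.coeff w₁ w₂ h k) := by
        rw [finsum_eq_single _ 0]
        · simp [bin]
        · intro i hi
          simp [bin, Ring.choose_zero_pos _ (Nat.pos_of_ne_zero hi)]
      rw [h1, sub_eq_iff_eq_add] at J
      change W₃.mode v n (𝒴.coeff w₁ w₂ h k) ∈ S
      rw [J]
      exact S.add_mem (fs _ fun i => S.smul_mem _ (mem _ _ _ _))
        (S.smul_mem _ (fs _ fun i => S.smul_mem _ (mem _ _ _ _)))

end IntertwiningOperator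

/-- The series `∑_h 𝒴₁(w₁, e^ℓ₁) π_h(𝒴₂(w₂, e^ℓ₂) w₃)` of elements of the completion of `W₄`. -/
def productTerm {W₁ W₂ W₃ W₄ M : WeakModule V} (𝒴₁ : IntertwiningOperator W₁ M W₄)
    (𝒴₂ : IntertwiningOperator W₂ W₃ M) (w₁ : W₁) (w₂ : W₂) (w₃ : W₃) (ℓ₁ ℓ₂ : ℂ) (h : ℂ) :
    W₄.Completion :=
  (𝒴₁.series w₁ ((𝒴₂.series w₂ w₃).eval ℓ₂ h : M)).eval ℓ₁

/-- The series `∑_h 𝒴₁(π_h(𝒴₂(w₁, e^ℓ₀) w₂), e^ℓ₂) w₃` of elements of the completion of `W₄`. -/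
def iterateTerm {W₁ W₂ W₃ W₄ M : WeakModule V} (𝒴₁ : IntertwiningOperator M W₃ W₄)
    (𝒴₂ : IntertwiningOperator W₁ W₂ M) (w₁ : W₁) (w₂ : W₂) (w₃ : W₃) (ℓ₀ ℓ₂ : ℂ) (h : ℂ) :
    W₄.Completion :=
  (𝒴₁.series ((𝒴₂.series w₁ w₂).eval ℓ₀ h : M) w₃).eval ℓ₂

/-! ### Braided tensor categories with twist, and the vertex algebraic ones -/

/-- A (`ℂ`-linear) braided tensor category structure with unit object `V` and with a twist, on the
full subcategory of weak modules given by `P`. -/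
class BraidedTensorCategoryWithTwist (P : ObjectProperty (WeakModule V)) extends
    MonoidalCategory P.FullSubcategory, BraidedCategory P.FullSubcategory,
    MonoidalPreadditive P.FullSubcategory, MonoidalLinear ℂ P.FullSubcategory where
  self_mem : P (WeakModule.self V)
  unit_eq : 𝟙_ P.FullSubcategory = ⟨WeakModule.self V, self_mem⟩
  twist : 𝟭 P.FullSubcategory ≅ 𝟭 P.FullSubcategory
  twist_unit : twist.hom.app (𝟙_ P.FullSubcategory) = 𝟙 _
  balancing : ∀ X Y : P.FullSubcategory,
    twist.hom.app (X ⊗ Y)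
      = (twist.hom.app X ⊗ₘ twist.hom.app Y) ≫ (β_ X Y).hom ≫ (β_ Y X).hom

/-- The identity map of `V`, as a morphism from `V` to the unit object. -/
def toUnit (P : ObjectProperty (WeakModule V)) [BraidedTensorCategoryWithTwist P] :
    WeakModule.self V ⟶ (𝟙_ P.FullSubcategory).obj :=
  eqToHom (congrArg ObjectProperty.FullSubcategory.obj
    (BraidedTensorCategoryWithTwist.unit_eq (P := P))).symm

/-- The identity map of `V`, as a morphism from the unit object to `V`. -/
def ofUnit (P : ObjectProperty (WeakModule V)) [BraidedTensorCategoryWithTwist P] :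
    (𝟙_ P.FullSubcategory).obj ⟶ WeakModule.self V :=
  eqToHom (congrArg ObjectProperty.FullSubcategory.obj
    (BraidedTensorCategoryWithTwist.unit_eq (P := P)))

/-- The vertex algebraic description of a braided tensor category with twist whose objects are
generalized `V`-modules: tensor product intertwining operators `𝒴_{X₁, X₂}` with their universal
property, and the description of all of the structure in terms of these. The associativity
isomorphism `X₁ ⊗ (X₂ ⊗ X₃) ⟶ (X₁ ⊗ X₂) ⊗ X₃` is the inverse of Mathlib's associator. -/
structure VertexTensorStructure (P : ObjectProperty (WeakModule V))
    [BraidedTensorCategoryWithTwist P] where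
  generalized : ∀ X : WeakModule V, P X → X.IsGeneralized
  /-- the tensor product intertwining operators -/
  𝒴 : ∀ X₁ X₂ : P.FullSubcategory, IntertwiningOperator X₁.obj X₂.obj (X₁ ⊗ X₂).obj
  /-- `f ↦ f ∘ 𝒴_{X₁, X₂}` is a bijection from homomorphisms to intertwining operators -/
  universal : ∀ (X₁ X₂ X₃ : P.FullSubcategory)
    (I : IntertwiningOperator X₁.obj X₂.obj X₃.obj),
    ∃! f : X₁ ⊗ X₂ ⟶ X₃, ∀ b₁ b₂ h k,
      WeakModule.lin f.hom ((𝒴 X₁ X₂).series b₁ b₂ h k) = I.series b₁ b₂ h k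
  /-- `(F₁ ⊗ F₂)(𝒴(b₁, x) b₂) = 𝒴(F₁ b₁, x) F₂ b₂` characterizes `F₁ ⊗ F₂` -/
  tensorHom_iff : ∀ {X₁ X₂ Z₁ Z₂ : P.FullSubcategory} (F₁ : X₁ ⟶ Z₁) (F₂ : X₂ ⟶ Z₂)
    (G : X₁ ⊗ X₂ ⟶ Z₁ ⊗ Z₂),
    G = (F₁ ⊗ₘ F₂) ↔ ∀ b₁ b₂ h k, WeakModule.lin G.hom ((𝒴 X₁ X₂).series b₁ b₂ h k)
      = (𝒴 Z₁ Z₂).series (WeakModule.lin F₁.hom b₁) (WeakModule.lin F₂.hom b₂) h k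
  /-- `l(𝒴(v, x) b) = Y(v, x) b` characterizes the left unit isomorphism -/
  leftUnitor_iff : ∀ (X : P.FullSubcategory) (G : 𝟙_ P.FullSubcategory ⊗ X ⟶ X),
    G = (λ_ X).hom ↔ ∀ (v : V) b h k,
      WeakModule.lin G.hom ((𝒴 (𝟙_ _) X).series (WeakModule.lin (toUnit P) v) b h k)
        = LogSeries.ofModes (fun n => X.obj.mode v n b) h k
  /-- `r(𝒴(b, x) v) = e ^ {x L(-1)} Y(v, -x) b` characterizes the right unit isomorphism -/
  rightUnitor_iff : ∀ (X : P.FullSubcategory) (G : X ⊗ 𝟙_ P.FullSubcategory ⟶ X),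
    G = (ρ_ X).hom ↔ ∀ (v : V) b h k,
      WeakModule.lin G.hom ((𝒴 X (𝟙_ _)).series b (WeakModule.lin (toUnit P) v) h k)
        = (LogSeries.ofModes
            (fun n => (-1 : ℂ) ^ (-n - 1) • X.obj.mode v n b)).expL h k
  /-- `R(𝒴(b₁, x) b₂) = e ^ {x L(-1)} 𝒴(b₂, e ^ {π i} x) b₁` characterizes the braiding -/
  braiding_iff : ∀ (X₁ X₂ : P.FullSubcategory) (G : X₁ ⊗ X₂ ⟶ X₂ ⊗ X₁),
    G = (β_ X₁ X₂).hom ↔ ∀ b₁ b₂ h k,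
      WeakModule.lin G.hom ((𝒴 X₁ X₂).series b₁ b₂ h k)
        = ((𝒴 X₂ X₁).series b₂ b₁).rotate.expL h k
  /-- the twist is `e ^ {2 π i L(0)}`, which acts on the generalized eigenspace `X_[h]` as
  `e ^ {2 π i h}` times the exponential of the locally nilpotent operator `2 π i (L(0) - h)` -/
  twist_eq : ∀ (X : P.FullSubcategory) (h : ℂ), ∀ b ∈ X.obj.wt h,
    WeakModule.lin ((BraidedTensorCategoryWithTwist.twist (P := P)).hom.app X).hom b
      = Complex.exp (2 * Real.pi * Complex.I * h) •
        ∑ᶠ j : ℕ, ((2 * Real.pi * Complex.I) ^ j / (j.factorial : ℂ)) •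
          ((X.obj.L 0 - h • (1 : Module.End ℂ X.obj)) ^ j) b
  /-- products of intertwining operators converge for `|z₁| > |z₂| > 0`, where `z₁ = e ^ ℓ₁` and
  `z₂ = e ^ ℓ₂`, for all choices of branches of logarithm -/
  product_converges : ∀ (W₁ W₂ W₃ W₄ M : P.FullSubcategory)
    (I₁ : IntertwiningOperator W₁.obj M.obj W₄.obj)
    (I₂ : IntertwiningOperator W₂.obj W₃.obj M.obj) w₁ w₂ w₃ (ℓ₁ ℓ₂ : ℂ),
    ‖Complex.exp ℓ₂‖ < ‖Complex.exp ℓ₁‖ →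
    ∃ s, WeakModule.ConvergesAbsolutelyTo (productTerm I₁ I₂ w₁ w₂ w₃ ℓ₁ ℓ₂) s
  /-- iterates of intertwining operators converge for `|z₂| > |z₀| > 0`, where `z₀ = e ^ ℓ₀` and
  `z₂ = e ^ ℓ₂`, for all choices of branches of logarithm -/
  iterate_converges : ∀ (W₁ W₂ W₃ W₄ M : P.FullSubcategory)
    (I₁ : IntertwiningOperator M.obj W₃.obj W₄.obj)
    (I₂ : IntertwiningOperator W₁.obj W₂.obj M.obj) w₁ w₂ w₃ (ℓ₀ ℓ₂ : ℂ),
    ‖Complex.exp ℓ₀‖ < ‖Complex.exp ℓ₂‖ →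
    ∃ s, WeakModule.ConvergesAbsolutelyTo (iterateTerm I₁ I₂ w₁ w₂ w₃ ℓ₀ ℓ₂) s
  /-- the associativity isomorphism maps the product to the iterate -/
  associativity : ∀ (X₁ X₂ X₃ : P.FullSubcategory) b₁ b₂ b₃ (r₁ r₂ : ℝ),
    r₁ > r₂ → r₂ > r₁ - r₂ → r₁ - r₂ > 0 →
    ∃ (p : (X₁ ⊗ (X₂ ⊗ X₃)).obj.Completion) (q : ((X₁ ⊗ X₂) ⊗ X₃).obj.Completion),
      WeakModule.ConvergesAbsolutelyTo
        (productTerm (𝒴 X₁ (X₂ ⊗ X₃)) (𝒴 X₂ X₃) b₁ b₂ b₃ (Real.log r₁) (Real.log r₂)) p ∧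
      WeakModule.ConvergesAbsolutelyTo
        (iterateTerm (𝒴 (X₁ ⊗ X₂) X₃) (𝒴 X₁ X₂) b₁ b₂ b₃
          (Real.log (r₁ - r₂)) (Real.log r₂)) q ∧
      WeakModule.completionMap (α_ X₁ X₂ X₃).inv.hom p = q

/-! ### The direct limit completion -/

/-- The direct limit completion `Ind(C)` of `C` in the category of weak modules: the weak modules
that are isomorphic to direct limits of direct systems in `C`. -/
def Ind (C : ObjectProperty (WeakModule.{u} V)) : ObjectProperty (WeakModule.{u} V) := fun X =>
  ∃ (I : Type u) (_ : Preorder I) (_ : IsDirectedOrder I) (_ : Nonempty I)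
    (α : I ⥤ C.FullSubcategory) (c : Cocone (α ⋙ C.ι)),
    Nonempty (IsColimit c) ∧ Nonempty (c.pt ≅ X)

/-- The set of submodules of `X` that are objects of `C`, ordered by inclusion. -/
abbrev CSub (C : ObjectProperty (WeakModule V)) (X : WeakModule V) : Type u :=
  {S : WeakModule.Sub V X // C S.toWeakModule}

namespace CSub

variable {C : ObjectProperty (WeakModule V)} {X : WeakModule V}

/-- A `C`-submodule as an object of `C`. -/
abbrev toC (W : CSub C X) : C.FullSubcategory := ⟨W.1.toWeakModule, W.2⟩

/-- The inclusion of a `C`-submodule. -/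
abbrev incl (W : CSub C X) : W.toC.obj ⟶ X := W.1.incl

variable (C X) in
/-- The direct system of the `C`-submodules of `X`. -/
def system : CSub C X ⥤ C.FullSubcategory where
  obj W := W.toC
  map f := C.homMk (WeakModule.Sub.inclOfLE (leOfHom f))

end CSub

/-- The direct system `(W₁, W₂) ↦ W₁ ⊗ W₂` indexed by pairs of `C`-submodules of `X₁`, `X₂`. -/
def tensorSystem (C : ObjectProperty (WeakModule V)) [MonoidalCategory C.FullSubcategory]
    (X₁ X₂ : WeakModule V) : CSub C X₁ × CSub C X₂ ⥤ WeakModule V :=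
  (CSub.system C X₁).prod (CSub.system C X₂) ⋙ tensor C.FullSubcategory ⋙ C.ι

/-- The data and properties saying that a braided tensor category structure with twist on `Ind(C)`
is the direct limit extension of the one on `C`: `X₁ ⊗ X₂` is a direct limit (in the category of
weak modules) of the system of the `W₁ ⊗ W₂`, and the structure morphisms of `Ind(C)` are induced by
those of `C`. In `tensorHom`, `gᵢ : Wᵢ ⟶ Uᵢ` is the restriction of `Fᵢ` to `Wᵢ`, with values in any
`C`-submodule `Uᵢ` that contains `Fᵢ(Wᵢ)`. In `associator`, similarly, `g₁₂` and `g₂₃` are the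
canonical morphisms `φ`, with values in any `C`-submodule that contains their image. -/
structure DirectLimitExtension (C : ObjectProperty (WeakModule.{u} V))
    [BraidedTensorCategoryWithTwist C] [BraidedTensorCategoryWithTwist (Ind C)] where
  /-- the canonical morphisms `W₁ ⊗ W₂ ⟶ X₁ ⊗ X₂`, compatible with inclusions -/
  φ : ∀ X₁ X₂ : (Ind C).FullSubcategory,
    tensorSystem C X₁.obj X₂.obj ⟶ (Functor.const _).obj (X₁ ⊗ X₂).obj
  isColimit : ∀ X₁ X₂ : (Ind C).FullSubcategory,
    Nonempty (IsColimit (Cocone.mk (X₁ ⊗ X₂).obj (φ X₁ X₂)))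
  tensorHom : ∀ {X₁ X₂ Z₁ Z₂ : (Ind C).FullSubcategory} (F₁ : X₁ ⟶ Z₁) (F₂ : X₂ ⟶ Z₂)
    (W₁ : CSub C X₁.obj) (W₂ : CSub C X₂.obj) (U₁ : CSub C Z₁.obj) (U₂ : CSub C Z₂.obj)
    (g₁ : W₁.toC ⟶ U₁.toC) (g₂ : W₂.toC ⟶ U₂.toC),
    g₁.hom ≫ U₁.incl = W₁.incl ≫ F₁.hom → g₂.hom ≫ U₂.incl = W₂.incl ≫ F₂.hom →
    (φ X₁ X₂).app (W₁, W₂) ≫ (F₁ ⊗ₘ F₂).hom = (g₁ ⊗ₘ g₂).hom ≫ (φ Z₁ Z₂).app (U₁, U₂)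
  leftUnitor : ∀ (X : (Ind C).FullSubcategory) (U : CSub C (𝟙_ (Ind C).FullSubcategory).obj)
    (W : CSub C X.obj),
    (φ (𝟙_ _) X).app (U, W) ≫ (λ_ X).hom.hom
      = (C.homMk (U.incl ≫ ofUnit (Ind C) ≫ toUnit C) ▷ W.toC).hom
        ≫ (λ_ W.toC).hom.hom ≫ W.incl
  rightUnitor : ∀ (X : (Ind C).FullSubcategory) (U : CSub C (𝟙_ (Ind C).FullSubcategory).obj)
    (W : CSub C X.obj),
    (φ X (𝟙_ _)).app (W, U) ≫ (ρ_ X).hom.hom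
      = (W.toC ◁ C.homMk (U.incl ≫ ofUnit (Ind C) ≫ toUnit C)).hom
        ≫ (ρ_ W.toC).hom.hom ≫ W.incl
  associator : ∀ (X₁ X₂ X₃ : (Ind C).FullSubcategory)
    (W₁ : CSub C X₁.obj) (W₂ : CSub C X₂.obj) (W₃ : CSub C X₃.obj)
    (W₁₂ : CSub C (X₁ ⊗ X₂).obj) (W₂₃ : CSub C (X₂ ⊗ X₃).obj)
    (g₁₂ : W₁.toC ⊗ W₂.toC ⟶ W₁₂.toC) (g₂₃ : W₂.toC ⊗ W₃.toC ⟶ W₂₃.toC),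
    g₁₂.hom ≫ W₁₂.incl = (φ X₁ X₂).app (W₁, W₂) →
    g₂₃.hom ≫ W₂₃.incl = (φ X₂ X₃).app (W₂, W₃) →
    (W₁.toC ◁ g₂₃).hom ≫ (φ X₁ (X₂ ⊗ X₃)).app (W₁, W₂₃) ≫ (α_ X₁ X₂ X₃).inv.hom
      = (α_ W₁.toC W₂.toC W₃.toC).inv.hom ≫ (g₁₂ ▷ W₃.toC).hom
        ≫ (φ (X₁ ⊗ X₂) X₃).app (W₁₂, W₃)
  braiding : ∀ (X₁ X₂ : (Ind C).FullSubcategory) (W₁ : CSub C X₁.obj) (W₂ : CSub C X₂.obj),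
    (φ X₁ X₂).app (W₁, W₂) ≫ (β_ X₁ X₂).hom.hom
      = (β_ W₁.toC W₂.toC).hom.hom ≫ (φ X₂ X₁).app (W₂, W₁)
  twist : ∀ (X : (Ind C).FullSubcategory) (W : CSub C X.obj),
    W.incl ≫ ((BraidedTensorCategoryWithTwist.twist (P := Ind C)).hom.app X).hom
      = ((BraidedTensorCategoryWithTwist.twist (P := C)).hom.app W.toC).hom ≫ W.incl

end VTC

end

/-!
The proof rests on one finiteness property. Objects of `C` are finitely generated and `C` is closed
under submodules, so objects of `C` are Noetherian; hence they are compact for directed systems in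
`C`: a morphism from an object of `C` to such a colimit factors through a stage
(`IsFiniteAbelian.exists_comp_colimι`), and two factorizations agree at a later stage
(`WeakModule.exists_comp_map_eq`). Moreover every object of `Ind(C)` is the directed union of its
`C`-submodules (`exists_mem_cSub`, `exists_ind_desc`).

*Existence.* The tensor product `T X₁ X₂` is the colimit of the `W₁ ⊗ W₂` over pairs of
`C`-submodules. Instead of submodules it is convenient to use arbitrary morphisms `a₁ : A₁ ⟶ X₁` and
`a₂ : A₂ ⟶ X₂` from objects of `C`; they induce `pair a₁ a₂ : A₁ ⊗ A₂ ⟶ T X₁ X₂`, naturally in `A₁`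
and `A₂`. Morphisms out of `T X₁ X₂` are the same as natural families of morphisms out of the
`A₁ ⊗ A₂` (`IndTensor.exists_desc`, `IndTensor.T_ext`). For the associator, the difficulty is that a
`C`-submodule of `T X₂ X₃` need not be of the form `W₂ ⊗ W₃`. By compactness every
`s : S ⟶ T X₂ X₃` is of the form `t ≫ pair a₂ a₃`, and any two such presentations have a common
refinement (`IndTensor.exists_factor_pair`, `IndTensor.factor_pair_invariant`). So the associator of
`C` induces one on `Ind(C)`, and morphisms out of iterated tensor products are determined by their
composites with iterated `pair`s. All coherence conditions then follow from those in `C`.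

*Direct limit extensions are vertex algebraic.* The operators `φ ∘ 𝒴_{W₁,W₂}` are compatible with
inclusions of `C`-submodules and glue to intertwining operators on `Ind(C)`
(`IsFiniteAbelian.exists_glue`, `DirectLimitExtension.𝒴`). Given an intertwining operator with values
in an object of `Ind(C)`, its restriction to `C`-submodules takes values in its image, which is in
`C` by hypothesis; so the universal property in `C` provides a cocone, which gives the universal
property in `Ind(C)` (`DirectLimitExtension.𝒴_universal`). The formulas for the structure morphisms
hold on `C`-submodules and so in general, and they characterize these morphisms by the uniqueness in
the universal property (`DirectLimitExtension.eq_iff`).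

Convergence and associativity are transported from `C` along the completed homomorphisms
`completionMap f`. This needs that `completionMap f` commutes with the substitution `x = e^ℓ`. The
coefficients of an intertwining operator are homogeneous for the generalized `L(0)`-grading
(`IntertwiningOperator.coeff_mem_wt`), so only finitely many terms contribute to each weight space
(`IntertwiningOperator.finite_proj_ne_zero`), and a homomorphism may be applied term by term.
Absolute convergence is preserved because pairing with `y'` after `completionMap f` is pairing with
the transpose of `f` at `y'` (`WeakModule.exists_pairing_completionMap`).
-/

noncomputable section

namespace VTC

variable {V : Type u} [AddCommGroup V] [Module ℂ V] [VertexOperatorAlgebra V]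

/-! ### Submodules, products and quotients of weak modules -/

/-- A `finsum` over a family vanishing from some index on is a finite sum, hence is preserved by
linear maps. Without this hypothesis the sum may be the junk value `0` on one side only. -/
theorem map_finsum_of_eventually_zero {M N : Type*} [AddCommGroup M] [Module ℂ M]
    [AddCommGroup N] [Module ℂ N] (f : M →ₗ[ℂ] N) {g : ℕ → M}
    (hg : ∃ n : ℕ, ∀ i ≥ n, g i = 0) : f (∑ᶠ i, g i) = ∑ᶠ i, f (g i) := by
  obtain ⟨n, hn⟩ := hg
  refine f.toAddMonoidHom.map_finsum ((Set.finite_lt_nat n).subset fun i hi => ?_)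
  by_contra h
  exact hi (hn i (not_lt.1 h))

namespace WeakModule

theorem lin_mode {X Y : WeakModule V} (f : X ⟶ Y) (v : V) (n : ℤ) (w : X) :
    lin f (X.mode v n w) = Y.mode v n (lin f w) := Hom.map_mode f v n w

theorem lin_L {X Y : WeakModule V} (f : X ⟶ Y) (n : ℤ) (w : X) :
    lin f (X.L n w) = Y.L n (lin f w) := lin_mode f _ _ _

theorem lin_comp_apply {X Y Z : WeakModule V} (f : X ⟶ Y) (g : Y ⟶ Z) (x : X) :
    lin (f ≫ g) x = lin g (lin f x) := rfl

theorem hom_ext_apply {X Y : WeakModule V} {f g : X ⟶ Y} (h : ∀ x, lin f x = lin g x) : f = g :=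
  hom_ext (LinearMap.ext h)

theorem congr_lin {X Y : WeakModule V} {f g : X ⟶ Y} (h : f = g) (x : X) : lin f x = lin g x := by
  rw [h]

theorem exists_mode_eq_zero (X : WeakModule V) (v : V) (w : X) (b : ℤ) :
    ∃ N : ℕ, ∀ i ≥ N, X.mode v (b + (i : ℕ)) w = 0 := by
  obtain ⟨N, hN⟩ := X.lower_truncation v w
  exact ⟨(N - b).toNat, fun i hi => hN _ (by omega)⟩

theorem exists_Y_eq_zero (v w : V) (b : ℤ) :
    ∃ N : ℕ, ∀ i ≥ N, VertexOperatorAlgebra.Y v (b + (i : ℕ)) w = 0 :=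
  exists_mode_eq_zero (self V) v w b

/-- A map commuting with the modes carries the three sums of the Jacobi identity to the
corresponding sums. -/
theorem map_jacobi (X : WeakModule V) {M : Type*} [AddCommGroup M] [Module ℂ M]
    (f : X →ₗ[ℂ] M) (mode : V → ℤ → M → M) (hf : ∀ v n x, f (X.mode v n x) = mode v n (f x))
    (v₁ v₂ : V) (w : X) (l m n : ℤ) :
    (∑ᶠ i : ℕ, ((-1 : ℂ) ^ i * bin l i) • mode v₁ (l + m - i) (mode v₂ (n + i) (f w)))
      - (-1 : ℂ) ^ l •
        ∑ᶠ i : ℕ, ((-1 : ℂ) ^ i * bin l i) • mode v₂ (l + n - i) (mode v₁ (m + i) (f w))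
      = ∑ᶠ i : ℕ, bin m i • mode (VertexOperatorAlgebra.Y v₁ (l + i) v₂) (m + n - i) (f w) := by
  have J := congrArg f (X.jacobi v₁ v₂ w l m n)
  rw [map_sub, map_smul, map_finsum_of_eventually_zero, map_finsum_of_eventually_zero,
    map_finsum_of_eventually_zero] at J
  · simpa only [map_smul, hf] using J
  · obtain ⟨N, hN⟩ := exists_Y_eq_zero v₁ v₂ l
    exact ⟨N, fun i hi => by simp [hN i hi]⟩
  · obtain ⟨N, hN⟩ := exists_mode_eq_zero X v₁ w m
    exact ⟨N, fun i hi => by simp [hN i hi]⟩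
  · obtain ⟨N, hN⟩ := exists_mode_eq_zero X v₂ w n
    exact ⟨N, fun i hi => by simp [hN i hi]⟩

/-- The direct sum of two weak modules, on the product of the underlying vector spaces. -/
def prod (X Y : WeakModule V) : WeakModule V where
  carrier := X × Y
  mode :=
    { toFun := fun v n => (X.mode v n).prodMap (Y.mode v n)
      map_add' := fun _ _ => by ext <;> simp
      map_smul' := fun _ _ => by ext <;> simp }
  lower_truncation v w := by
    obtain ⟨N, hN⟩ := X.lower_truncation v w.1
    obtain ⟨M, hM⟩ := Y.lower_truncation v w.2
    exact ⟨max N M, fun n hn => Prod.ext (hN n (le_trans (le_max_left _ _) hn))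
      (hM n (le_trans (le_max_right _ _) hn))⟩
  vacuum n := by
    refine LinearMap.ext fun w => ?_
    have h1 := congrArg (fun A : Module.End ℂ X => A w.1) (X.vacuum n)
    have h2 := congrArg (fun A : Module.End ℂ Y => A w.2) (Y.vacuum n)
    by_cases h : n = -1 <;> simp_all [Prod.ext_iff]
  jacobi v₁ v₂ w l m n := by
    have key : ∀ (a : ℕ → X) (b : ℕ → Y), (∃ N : ℕ, ∀ i ≥ N, a i = 0) →
        (∃ N : ℕ, ∀ i ≥ N, b i = 0) → (∑ᶠ i, ((a i, b i) : X × Y)) = (∑ᶠ i, a i, ∑ᶠ i, b i) := by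
      intro a b ha hb
      have hab : ∃ N : ℕ, ∀ i ≥ N, ((a i, b i) : X × Y) = 0 := by
        obtain ⟨N, hN⟩ := ha
        obtain ⟨M, hM⟩ := hb
        exact ⟨max N M, fun n hn => Prod.ext (hN n (le_trans (le_max_left _ _) hn))
          (hM n (le_trans (le_max_right _ _) hn))⟩
      exact Prod.ext (map_finsum_of_eventually_zero (LinearMap.fst ℂ X Y) hab)
        (map_finsum_of_eventually_zero (LinearMap.snd ℂ X Y) hab)
    obtain ⟨x, y⟩ := w
    have e1 := X.jacobi v₁ v₂ x l m n
    have e2 := Y.jacobi v₁ v₂ y l m n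
    have s1 := fun (X : WeakModule V) (x : X) => exists_mode_eq_zero X v₁ x m
    have s2 := fun (X : WeakModule V) (x : X) => exists_mode_eq_zero X v₂ x n
    obtain ⟨N, s3⟩ := exists_Y_eq_zero v₁ v₂ l
    simp only [LinearMap.coe_mk, AddHom.coe_mk, LinearMap.prodMap_apply, Prod.smul_mk]
    rw [key, key, key, Prod.smul_mk, Prod.mk_sub_mk, e1, e2]
    · exact ⟨N, fun i hi => by simp [s3 i hi]⟩
    · exact ⟨N, fun i hi => by simp [s3 i hi]⟩
    · obtain ⟨N, hN⟩ := s1 X x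
      exact ⟨N, fun i hi => by simp [hN i hi]⟩
    · obtain ⟨N, hN⟩ := s1 Y y
      exact ⟨N, fun i hi => by simp [hN i hi]⟩
    · obtain ⟨N, hN⟩ := s2 X x
      exact ⟨N, fun i hi => by simp [hN i hi]⟩
    · obtain ⟨N, hN⟩ := s2 Y y
      exact ⟨N, fun i hi => by simp [hN i hi]⟩
  derivative v n := by
    refine LinearMap.ext fun w => ?_
    have h1 := congrArg (fun A : Module.End ℂ X => A w.1) (X.derivative v n)
    have h2 := congrArg (fun A : Module.End ℂ Y => A w.2) (Y.derivative v n)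
    simp_all

/-- The inclusion of the first summand of a direct sum. -/
def prodInl (X Y : WeakModule V) : X ⟶ prod X Y where
  lin := LinearMap.inl ℂ X Y
  map_mode v n _ := Prod.ext rfl (map_zero (Y.mode v n)).symm

/-- The inclusion of the second summand of a direct sum. -/
def prodInr (X Y : WeakModule V) : Y ⟶ prod X Y where
  lin := LinearMap.inr ℂ X Y
  map_mode v n _ := Prod.ext (map_zero (X.mode v n)).symm rfl

/-- The homomorphism out of a direct sum with given restrictions to the summands. -/
def prodDesc {X Y Z : WeakModule V} (f : X ⟶ Z) (g : Y ⟶ Z) : prod X Y ⟶ Z where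
  lin := LinearMap.coprod (lin f) (lin g)
  map_mode v n x := by
    change lin f (X.mode v n x.1) + lin g (Y.mode v n x.2)
      = Z.mode v n (lin f x.1 + lin g x.2)
    rw [lin_mode, lin_mode, map_add]

namespace Sub

variable {X Y Z : WeakModule V}

/-- The image of a homomorphism. -/
def range (f : X ⟶ Y) : Sub V Y where
  toSubmodule := LinearMap.range (lin f)
  mode_mem := by
    rintro v n _ ⟨x, rfl⟩
    exact ⟨X.mode v n x, lin_mode f v n x⟩

/-- The preimage of a submodule under a homomorphism. -/
def comap (f : X ⟶ Y) (S : Sub V Y) : Sub V X where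
  toSubmodule := S.toSubmodule.comap (lin f)
  mode_mem v n x hx := by
    rw [Submodule.mem_comap, lin_mode]
    exact S.mode_mem v n hx

/-- The kernel of a homomorphism. -/
def ker (f : X ⟶ Y) : Sub V X where
  toSubmodule := LinearMap.ker (lin f)
  mode_mem v n x hx := by
    rw [LinearMap.mem_ker] at hx ⊢
    rw [lin_mode, hx, map_zero]

/-- The submodule on which two homomorphisms agree. -/
def eqLocus (f g : X ⟶ Y) : Sub V X where
  toSubmodule := LinearMap.eqLocus (lin f) (lin g)
  mode_mem v n x hx := by
    rw [LinearMap.mem_eqLocus] at hx ⊢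
    rw [lin_mode, lin_mode, hx]

/-- The sum of two submodules. -/
def sup (S T : Sub V X) : Sub V X where
  toSubmodule := S.toSubmodule ⊔ T.toSubmodule
  mode_mem v n x hx := by
    obtain ⟨y, hy, z, hz, rfl⟩ := Submodule.mem_sup.1 hx
    rw [map_add]
    exact Submodule.add_mem_sup (S.mode_mem v n hy) (T.mode_mem v n hz)

/-- The corestriction of a homomorphism to a submodule containing its image. -/
def lift (f : X ⟶ Y) (S : Sub V Y) (h : ∀ x, lin f x ∈ S.toSubmodule) : X ⟶ S.toWeakModule where
  lin := (lin f).codRestrict S.toSubmodule h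
  map_mode v n x := Subtype.ext (lin_mode f v n x)

theorem incl_injective (S : Sub V X) : Function.Injective (lin S.incl) :=
  Subtype.val_injective

theorem incl_mem (S : Sub V X) (x : S.toWeakModule) : lin S.incl x ∈ S.toSubmodule := x.2

/-- An element of a submodule, as an element of the corresponding weak module. -/
def elt (S : Sub V X) (x : X) (hx : x ∈ S.toSubmodule) : S.toWeakModule := ⟨x, hx⟩

theorem incl_elt (S : Sub V X) (x : X) (hx : x ∈ S.toSubmodule) : lin S.incl (S.elt x hx) = x := rfl

theorem hom_ext_incl {S : Sub V Y} {f g : X ⟶ S.toWeakModule} (h : f ≫ S.incl = g ≫ S.incl) :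
    f = g :=
  hom_ext_apply fun x => S.incl_injective (congrArg (fun k => lin k x) h)

end Sub

/-- A homomorphism that vanishes on the kernel of a surjection factors through it. -/
theorem exists_factor {X Y Z : WeakModule V} (q : X ⟶ Y) (hq : Function.Surjective (lin q))
    (g : X ⟶ Z) (h : ∀ x, lin q x = 0 → lin g x = 0) : ∃ k : Y ⟶ Z, q ≫ k = g := by
  choose s hs using hq
  have key : ∀ x y, lin q x = y → lin g (s y) = lin g x := by
    intro x y hxy
    rw [← sub_eq_zero, ← map_sub]
    exact h _ (by rw [map_sub, hs, hxy, sub_self])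
  refine ⟨⟨⟨⟨fun y => lin g (s y), fun y z => ?_⟩, fun r y => ?_⟩, fun v n y => ?_⟩,
    hom_ext_apply fun x => key x _ rfl⟩
  · rw [← map_add]
    exact key _ _ (by rw [map_add, hs, hs])
  · rw [RingHom.id_apply, ← map_smul]
    exact key _ _ (by rw [map_smul, hs])
  · change lin g (s (Y.mode v n y)) = Z.mode v n (lin g (s y))
    rw [← lin_mode]
    exact key _ _ (by rw [lin_mode, hs])

end WeakModule

open WeakModule

/-- The closure and finiteness properties of the category `C` of modules: it consists of
finitely generated grading-restricted modules, and is closed under submodules, quotients and finite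
direct sums. -/
class IsFiniteAbelian (C : ObjectProperty (WeakModule.{u} V)) : Prop where
  gradingRestricted : ∀ X, C X → X.IsGradingRestricted
  zero_mem : ∀ X : WeakModule V, Subsingleton X → C X
  closed_sub : ∀ (X Y : WeakModule V) (f : X ⟶ Y), Function.Injective (lin f) → C Y → C X
  closed_quotient : ∀ (X Y : WeakModule V) (f : X ⟶ Y),
    Function.Surjective (lin f) → C X → C Y
  closed_directSum : ∀ (X Y Z : WeakModule V) (f : X ⟶ Z) (g : Y ⟶ Z),
    (Function.Bijective fun p : X × Y => lin f p.1 + lin g p.2) → C X → C Y → C Z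
  finitelyGenerated : ∀ X, C X → X.IsFinitelyGenerated

namespace IsFiniteAbelian

variable {C : ObjectProperty (WeakModule.{u} V)} (hC : IsFiniteAbelian C)
include hC

theorem range_mem {X Y : WeakModule V} (f : X ⟶ Y) (hX : C X) : C (Sub.range f).toWeakModule :=
  hC.closed_quotient X _ (Sub.lift f (Sub.range f) fun x => ⟨x, rfl⟩)
    (by rintro ⟨_, x, rfl⟩; exact ⟨x, rfl⟩) hX

theorem prod_mem {X Y : WeakModule V} (hX : C X) (hY : C Y) : C (prod X Y) := by
  refine hC.closed_directSum X Y _ (prodInl X Y) (prodInr X Y) ?_ hX hY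
  have : (fun p : X × Y => lin (prodInl X Y) p.1 + lin (prodInr X Y) p.2) = id := by
    funext p
    exact Prod.ext (add_zero p.1) (zero_add p.2)
  rw [this]
  exact Function.bijective_id

theorem le_mem {X : WeakModule V} {S T : Sub V X} (h : S ≤ T) (hT : C T.toWeakModule) :
    C S.toWeakModule :=
  hC.closed_sub _ _ (Sub.inclOfLE h) (Submodule.inclusion_injective h) hT

theorem sup_mem {X : WeakModule V} {S T : Sub V X} (hS : C S.toWeakModule)
    (hT : C T.toWeakModule) : C (Sub.sup S T).toWeakModule := by
  refine hC.le_mem (T := Sub.range (prodDesc S.incl T.incl)) ?_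
    (hC.range_mem _ (hC.prod_mem hS hT))
  intro x hx
  obtain ⟨y, hy, z, hz, rfl⟩ := Submodule.mem_sup.1 hx
  exact ⟨((⟨y, hy⟩, ⟨z, hz⟩) : S.toWeakModule × T.toWeakModule), rfl⟩

theorem isDirectedOrder (X : WeakModule V) : IsDirectedOrder (CSub C X) :=
  ⟨fun S T => ⟨⟨Sub.sup S.1 T.1, hC.sup_mem S.2 T.2⟩,
    (le_sup_left : S.1.toSubmodule ≤ S.1.toSubmodule ⊔ T.1.toSubmodule),
    (le_sup_right : T.1.toSubmodule ≤ S.1.toSubmodule ⊔ T.1.toSubmodule)⟩⟩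

theorem nonempty (X : WeakModule V) : Nonempty (CSub C X) := by
  refine ⟨⟨Sub.range (0 : X ⟶ X), hC.zero_mem _ ⟨?_⟩⟩⟩
  rintro ⟨_, a, rfl⟩ ⟨_, b, rfl⟩
  rfl

/-- The image of a homomorphism from an object of `C`. -/
def im {A : C.FullSubcategory} {X : WeakModule V} (a : A.obj ⟶ X) : CSub C X :=
  ⟨Sub.range a, hC.range_mem a A.2⟩

/-- Finitely many homomorphisms from objects of `C` into `X` have images in a common
`C`-submodule. -/
theorem exists_cSub {A B : C.FullSubcategory} {X : WeakModule V} (a : A.obj ⟶ X) (b : B.obj ⟶ X) :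
    ∃ W : CSub C X, (∃ a' : A ⟶ W.toC, a'.hom ≫ W.incl = a) ∧
      ∃ b' : B ⟶ W.toC, b'.hom ≫ W.incl = b := by
  obtain ⟨W, h1, h2⟩ := (hC.isDirectedOrder X).directed (hC.im a) (hC.im b)
  exact ⟨W, ⟨C.homMk (Sub.lift a W.1 fun x => h1 ⟨x, rfl⟩), rfl⟩,
    ⟨C.homMk (Sub.lift b W.1 fun x => h2 ⟨x, rfl⟩), rfl⟩⟩

end IsFiniteAbelian

/-! ### Directed colimits of weak modules -/

namespace WeakModule

section DirectedColimit

variable {I : Type u} [Preorder I] [IsDirectedOrder I] [Nonempty I] (F : I ⥤ WeakModule V)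

open Classical in
/-- The vector space underlying the colimit of a directed system of weak modules. -/
abbrev ColimCarrier : Type u :=
  Module.DirectLimit (fun i => (F.obj i : Type u)) fun _ _ h => lin (F.map (homOfLE h))

open Classical in
/-- The canonical linear maps to the underlying vector space of the colimit. -/
def colimOf (i : I) : F.obj i →ₗ[ℂ] ColimCarrier F :=
  Module.DirectLimit.of ℂ I (fun i => (F.obj i : Type u)) (fun _ _ h => lin (F.map (homOfLE h))) i

omit [IsDirectedOrder I] [Nonempty I] in
theorem colimOf_map {i j : I} (h : i ≤ j) (x : F.obj i) :
    colimOf F j (lin (F.map (homOfLE h)) x) = colimOf F i x := by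
  classical
  exact Module.DirectLimit.of_f

theorem exists_colimOf (z : ColimCarrier F) : ∃ i x, colimOf F i x = z := by
  classical
  exact Module.DirectLimit.exists_of z

omit [Nonempty I] in
theorem colimOf_eq_zero {i : I} {x : F.obj i} (h : colimOf F i x = 0) :
    ∃ j, ∃ h : i ≤ j, lin (F.map (homOfLE h)) x = 0 := by
  classical
  have : DirectedSystem (fun i => (F.obj i : Type u)) fun _ _ h => lin (F.map (homOfLE h)) :=
    { map_self := fun i x => by
        have : homOfLE (le_refl i) = 𝟙 i := rfl
        rw [this, F.map_id]
        rfl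
      map_map := fun i j k hij hjk x => by
        have : homOfLE (hij.trans hjk) = homOfLE hij ≫ homOfLE hjk := rfl
        rw [this, F.map_comp]
        rfl }
  exact Module.DirectLimit.of.zero_exact h

open Classical in
/-- The mode `vₙ` on the colimit. -/
def colimMode (v : V) (n : ℤ) : Module.End ℂ (ColimCarrier F) :=
  Module.DirectLimit.map (fun i => (F.obj i).mode v n) fun _ _ _ =>
    LinearMap.ext fun x => (lin_mode _ v n x).symm

omit [IsDirectedOrder I] [Nonempty I] in
theorem colimMode_of (v : V) (n : ℤ) (i : I) (x : F.obj i) :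
    colimMode F v n (colimOf F i x) = colimOf F i ((F.obj i).mode v n x) := by
  classical
  exact Module.DirectLimit.map_apply_of _ _ _

theorem colim_ext {N : Type*} [AddCommGroup N] [Module ℂ N] {f g : ColimCarrier F →ₗ[ℂ] N}
    (h : ∀ i x, f (colimOf F i x) = g (colimOf F i x)) : f = g :=
  LinearMap.ext fun z => by
    obtain ⟨i, x, rfl⟩ := exists_colimOf F z
    exact h i x

/-- The colimit of a directed system of weak modules. -/
def colim : WeakModule V where
  carrier := ColimCarrier F
  mode :=
    { toFun := fun v n => colimMode F v n
      map_add' := fun v w => funext fun n => colim_ext F fun i x => by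
        simp [colimMode_of]
      map_smul' := fun r v => funext fun n => colim_ext F fun i x => by
        simp [colimMode_of] }
  lower_truncation v w := by
    obtain ⟨i, x, rfl⟩ := exists_colimOf F w
    obtain ⟨N, hN⟩ := (F.obj i).lower_truncation v x
    exact ⟨N, fun n hn => by
      simp only [LinearMap.coe_mk, AddHom.coe_mk, colimMode_of, hN n hn, map_zero]⟩
  vacuum n := colim_ext F fun i x => by
    have h1 := congrArg (fun A : Module.End ℂ (F.obj i) => colimOf F i (A x)) ((F.obj i).vacuum n)
    refine (colimMode_of F _ _ _ _).trans (h1.trans ?_)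
    split_ifs <;> simp
  jacobi v₁ v₂ w l m n := by
    obtain ⟨i, x, rfl⟩ := exists_colimOf F w
    exact map_jacobi (F.obj i) (colimOf F i) (fun v n => colimMode F v n)
      (fun v n x => (colimMode_of F v n i x).symm) v₁ v₂ x l m n
  derivative v n := colim_ext F fun i x => by
    have h1 := congrArg (fun A : Module.End ℂ (F.obj i) => colimOf F i (A x))
      ((F.obj i).derivative v n)
    refine (colimMode_of F _ _ _ _).trans (h1.trans ?_)
    simp [colimMode_of]

/-- The canonical morphisms to the colimit. -/
def colimι (i : I) : F.obj i ⟶ colim F where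
  lin := colimOf F i
  map_mode v n x := (colimMode_of F v n i x).symm

theorem colimι_naturality {i j : I} (h : i ⟶ j) : F.map h ≫ colimι F j = colimι F i :=
  hom_ext_apply fun x => colimOf_map F (leOfHom h) x

theorem exists_colimι (z : colim F) : ∃ i x, lin (colimι F i) x = z := exists_colimOf F z

theorem colimι_eq_zero {i : I} {x : F.obj i} (h : lin (colimι F i) x = 0) :
    ∃ j, ∃ h : i ⟶ j, lin (F.map h) x = 0 := by
  obtain ⟨j, h, hx⟩ := colimOf_eq_zero F h
  exact ⟨j, homOfLE h, hx⟩

variable {F} in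
theorem colim_hom_ext {Y : WeakModule V} {f g : colim F ⟶ Y}
    (h : ∀ i, colimι F i ≫ f = colimι F i ≫ g) : f = g :=
  hom_ext_apply fun z => by
    obtain ⟨i, x, rfl⟩ := exists_colimι F z
    exact congrArg (fun k => lin k x) (h i)

open Classical in
/-- The linear map out of the colimit induced by a cocone of homomorphisms. -/
def colimLift {Y : WeakModule V} (g : ∀ i, F.obj i ⟶ Y)
    (hg : ∀ {i j : I} (h : i ⟶ j), F.map h ≫ g j = g i) : ColimCarrier F →ₗ[ℂ] Y :=
  Module.DirectLimit.lift ℂ I _ _ (fun i => lin (g i)) fun _ _ h x => congr_lin (hg (homOfLE h)) x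

omit [IsDirectedOrder I] [Nonempty I] in
theorem colimLift_of {Y : WeakModule V} (g : ∀ i, F.obj i ⟶ Y)
    (hg : ∀ {i j : I} (h : i ⟶ j), F.map h ≫ g j = g i) (i : I) (x : F.obj i) :
    colimLift F g hg (colimOf F i x) = lin (g i) x := by
  classical
  exact Module.DirectLimit.lift_of _ _ _

/-- The homomorphism out of the colimit induced by a cocone of homomorphisms. -/
def colimDesc {Y : WeakModule V} (g : ∀ i, F.obj i ⟶ Y)
    (hg : ∀ {i j : I} (h : i ⟶ j), F.map h ≫ g j = g i) : colim F ⟶ Y where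
  lin := colimLift F g hg
  map_mode v n z := by
    obtain ⟨i, x, rfl⟩ := exists_colimOf F z
    have h1 : (colim F).mode v n (colimOf F i x) = colimOf F i ((F.obj i).mode v n x) :=
      colimMode_of F v n i x
    exact (congrArg (colimLift F g hg) h1).trans ((colimLift_of F g hg i _).trans
      ((lin_mode (g i) v n x).trans (congrArg (Y.mode v n) (colimLift_of F g hg i x).symm)))

theorem colimι_desc {Y : WeakModule V} (g : ∀ i, F.obj i ⟶ Y)
    (hg : ∀ {i j : I} (h : i ⟶ j), F.map h ≫ g j = g i) (i : I) :
    colimι F i ≫ colimDesc F g hg = g i :=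
  hom_ext_apply fun x => colimLift_of F g hg i x

/-- The colimit cocone of a directed system of weak modules. -/
def colimCocone : Cocone F where
  pt := colim F
  ι := { app := colimι F
         naturality := fun _ _ h => (colimι_naturality F h).trans (Category.comp_id _).symm }

/-- The universal property of the colimit, in the category of weak modules. -/
def colimCoconeIsColimit : IsColimit (colimCocone F) where
  desc s := colimDesc F (fun i => s.ι.app i) fun h => s.w h
  fac _ i := colimι_desc F _ _ i
  uniq _ _ hm := colim_hom_ext fun i => (hm i).trans (colimι_desc F _ _ i).symm

/-- A finitely generated module is a compact object: two morphisms to a stage of a directed system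
that agree in the colimit agree at a later stage. -/
theorem exists_comp_map_eq {S : WeakModule V} (hS : S.IsFinitelyGenerated) {i : I}
    (f g : S ⟶ F.obj i) (h : f ≫ colimι F i = g ≫ colimι F i) :
    ∃ j, ∃ k : i ⟶ j, f ≫ F.map k = g ≫ F.map k := by
  obtain ⟨s, hs⟩ := hS
  have key : ∀ x : S, ∃ j, ∃ k : i ⟶ j, lin (F.map k) (lin f x) = lin (F.map k) (lin g x) := by
    intro x
    have hx : lin (colimι F i) (lin f x - lin g x) = 0 := by
      rw [map_sub, sub_eq_zero]
      exact congrArg (fun k => lin k x) h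
    obtain ⟨j, k, hk⟩ := colimι_eq_zero F hx
    exact ⟨j, k, by rwa [map_sub, sub_eq_zero] at hk⟩
  choose j k hk using key
  classical
  -- A stage beyond those at which the images of the generators agree.
  obtain ⟨M, hM⟩ := (insert i (s.image j)).exists_le
  refine ⟨M, homOfLE (hM i (Finset.mem_insert_self _ _)), ?_⟩
  set m : i ⟶ M := homOfLE (hM i (Finset.mem_insert_self _ _))
  refine hom_ext_apply (hs (Sub.eqLocus (f ≫ F.map m) (g ≫ F.map m)) fun x hx => ?_)
  have hjM : j x ≤ M := hM _ (Finset.mem_insert_of_mem (Finset.mem_image_of_mem j hx))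
  have hm : m = k x ≫ homOfLE hjM := rfl
  rw [hm, F.map_comp]
  exact congrArg (lin (F.map (homOfLE hjM))) (hk x)

end DirectedColimit

end WeakModule

namespace IsFiniteAbelian

variable {C : ObjectProperty (WeakModule.{u} V)} (hC : IsFiniteAbelian C)
include hC

theorem isFinitelyGenerated (A : C.FullSubcategory) : A.obj.IsFinitelyGenerated :=
  hC.finitelyGenerated _ A.2

/-- Objects of `C` are compact with respect to directed systems in `C`: a morphism to the colimit
factors through a stage. This uses that objects of `C` are Noetherian, so that the kernel of the
canonical map from a stage to the colimit dies at a later stage. -/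
theorem exists_comp_colimι {I : Type u} [Preorder I] [IsDirectedOrder I] [Nonempty I]
    (F : I ⥤ WeakModule V) (hF : ∀ i, C (F.obj i)) {S : WeakModule V} (hS : C S)
    (f : S ⟶ colim F) : ∃ i, ∃ g : S ⟶ F.obj i, g ≫ colimι F i = f := by
  obtain ⟨s, hs⟩ := hC.finitelyGenerated S hS
  choose i x hix using fun y : S => exists_colimι F (lin f y)
  classical
  -- At the stage `M` the image in the colimit contains the image of `f`.
  obtain ⟨M, hM⟩ := (s.image i).exists_le
  have hf : ∀ y : S, lin f y ∈ (Sub.range (colimι F M)).toSubmodule := by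
    refine hs (Sub.comap f (Sub.range (colimι F M))) fun y hy => ?_
    have hiM : i y ≤ M := hM _ (Finset.mem_image_of_mem i hy)
    refine ⟨lin (F.map (homOfLE hiM)) (x y), ?_⟩
    rw [← lin_comp_apply, colimι_naturality, hix]
  -- The kernel of `F.obj M ⟶ colim F` is in `C`, hence finitely generated, hence killed by some
  -- `F.map k`; so `F.map k` factors through the image of `F.obj M` in the colimit.
  have hK : (Sub.ker (colimι F M)).toWeakModule.IsFinitelyGenerated :=
    hC.finitelyGenerated _ (hC.closed_sub _ _ (Sub.incl _) (Sub.incl_injective _) (hF M))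
  obtain ⟨j, k, hjk⟩ := exists_comp_map_eq F hK (Sub.incl (Sub.ker (colimι F M))) 0
    (hom_ext_apply fun x => (Sub.incl_mem _ x).trans (map_zero (lin (colimι F M))).symm)
  obtain ⟨t, ht⟩ := exists_factor
    (Sub.lift (colimι F M) (Sub.range (colimι F M)) fun x => ⟨x, rfl⟩)
    (by rintro ⟨_, x, rfl⟩; exact ⟨x, rfl⟩) (F.map k) fun x hx =>
      (congr_lin hjk (Sub.elt _ x (congrArg Subtype.val hx))).trans (map_zero (lin (F.map k)))
  refine ⟨j, Sub.lift f _ hf ≫ t, hom_ext_apply fun y => ?_⟩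
  obtain ⟨z, hz⟩ := hf y
  have h1 : lin (Sub.lift f _ hf) y
      = lin (Sub.lift (colimι F M) (Sub.range (colimι F M)) fun x => ⟨x, rfl⟩) z :=
    Subtype.ext hz.symm
  rw [lin_comp_apply, lin_comp_apply, h1, ← lin_comp_apply _ t, ht, ← lin_comp_apply,
    colimι_naturality, hz]

/-! ### The objects of `Ind(C)` -/

/-- Every element of an object of `Ind(C)` lies in a `C`-submodule: it comes from some stage of a
directed system, whose image is a quotient of an object of `C`. -/
theorem exists_mem_cSub {X : WeakModule V} (hX : Ind C X) (x : X) :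
    ∃ W : CSub C X, x ∈ W.1.toSubmodule := by
  obtain ⟨I, _, _, _, α, c, ⟨hc⟩, ⟨e⟩⟩ := hX
  let e' : colim (α ⋙ C.ι) ≅ X :=
    (colimCoconeIsColimit (α ⋙ C.ι)).coconePointUniqueUpToIso hc ≪≫ e
  obtain ⟨i, y, hy⟩ := exists_colimι (α ⋙ C.ι) (lin e'.inv x)
  refine ⟨hC.im (A := α.obj i) (colimι (α ⋙ C.ι) i ≫ e'.hom), y, ?_⟩
  rw [lin_comp_apply, hy, ← lin_comp_apply, e'.inv_hom_id]
  rfl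

theorem ind_hom_ext {X Y : WeakModule V} (hX : Ind C X) {f g : X ⟶ Y}
    (h : ∀ W : CSub C X, W.incl ≫ f = W.incl ≫ g) : f = g :=
  hom_ext_apply fun x => by
    obtain ⟨W, hW⟩ := hC.exists_mem_cSub hX x
    exact congr_lin (h W) (W.1.elt x hW)

/-- Morphisms out of an object of `Ind(C)` can be glued from its `C`-submodules. -/
theorem exists_ind_desc {X Y : WeakModule V} (hX : Ind C X) (g : ∀ W : CSub C X, W.toC.obj ⟶ Y)
    (hg : ∀ {W W' : CSub C X} (h : W ≤ W'), Sub.inclOfLE h ≫ g W' = g W) :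
    ∃ f : X ⟶ Y, ∀ W, W.incl ≫ f = g W := by
  have := hC.isDirectedOrder X
  have := hC.nonempty X
  let F : CSub C X ⥤ WeakModule V := CSub.system C X ⋙ C.ι
  let i : ∀ W : CSub C X, F.obj W ⟶ X := fun W => W.incl
  let g' : ∀ W : CSub C X, F.obj W ⟶ Y := g
  have hi : ∀ {W W' : CSub C X} (h : W ⟶ W'), F.map h ≫ i W' = i W := fun _ => rfl
  have hg' : ∀ {W W' : CSub C X} (h : W ⟶ W'), F.map h ≫ g' W' = g' W := fun h => hg (leOfHom h)
  obtain ⟨k, hk⟩ := exists_factor (colimDesc F i hi) (fun x => by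
      obtain ⟨W, hW⟩ := hC.exists_mem_cSub hX x
      exact ⟨lin (colimι F W) (W.1.elt x hW), congr_lin (colimι_desc F i hi W) (W.1.elt x hW)⟩)
    (colimDesc F g' hg') (fun z hz => by
      obtain ⟨W, x, rfl⟩ := exists_colimι F z
      rw [← lin_comp_apply, colimι_desc] at hz
      have : x = 0 := Subtype.ext hz
      rw [this, map_zero, map_zero])
  refine ⟨k, fun W => ?_⟩
  have h1 : i W ≫ k = g' W := by
    rw [← colimι_desc F g' hg' W, ← colimι_desc F i hi W, ← hk, Category.assoc]
  exact h1

omit hC in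
theorem ind_of_mem {X : WeakModule V} (hX : C X) : Ind C X :=
  ⟨PUnit, inferInstance, inferInstance, inferInstance, (Functor.const _).obj ⟨X, hX⟩,
    { pt := X, ι := { app := fun _ => 𝟙 X } },
    ⟨{ desc := fun s => s.ι.app PUnit.unit
       fac := fun s _ => Category.id_comp _
       uniq := fun s m hm => (Category.id_comp m).symm.trans (hm PUnit.unit) }⟩, ⟨Iso.refl _⟩⟩

omit hC in
theorem ind_colim {I : Type u} [Preorder I] [IsDirectedOrder I] [Nonempty I]
    (α : I ⥤ C.FullSubcategory) : Ind C (colim (α ⋙ C.ι)) :=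
  ⟨I, inferInstance, inferInstance, inferInstance, α, colimCocone _,
    ⟨colimCoconeIsColimit _⟩, ⟨Iso.refl _⟩⟩

/-- Every element of an object of `Ind(C)` lies in a `C`-submodule, so it is a sum of generalized
`L(0)`-eigenvectors; eigenspaces to distinct eigenvalues are always independent. -/
theorem isGeneralized {X : WeakModule V} (hX : Ind C X) : X.IsGeneralized := by
  refine DirectSum.isInternal_submodule_of_iSupIndep_of_iSup_eq_top
    (Module.End.independent_maxGenEigenspace _) ?_
  rw [eq_top_iff]
  rintro x -
  obtain ⟨W, hW⟩ := hC.exists_mem_cSub hX x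
  have h1 := (hC.gradingRestricted _ W.2).generalized.submodule_iSup_eq_top
  have h2 : (⟨x, hW⟩ : W.toC.obj) ∈ ⨆ h, W.toC.obj.wt h := by
    rw [h1]
    trivial
  have h3 : (⨆ h, W.toC.obj.wt h).map (lin W.incl) ≤ ⨆ h, X.wt h := by
    rw [Submodule.map_iSup]
    refine iSup_mono fun h => ?_
    rintro _ ⟨y, hy, rfl⟩
    exact map_wt _ h y hy
  exact h3 ⟨_, h2, rfl⟩

end IsFiniteAbelian

/-! ### The tensor product as a directed colimit -/

namespace IndTensor

variable (C : ObjectProperty (WeakModule.{u} V)) [BraidedTensorCategoryWithTwist C]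
  [hC : IsFiniteAbelian C]

/-- Pairs of `C`-submodules, with the componentwise order. (As a separate type, so that the only
category structure on it is the one of a preorder.) -/
def Pairs (X₁ X₂ : WeakModule V) : Type u := CSub C X₁ × CSub C X₂

instance (X₁ X₂ : WeakModule V) : Preorder (Pairs C X₁ X₂) :=
  inferInstanceAs (Preorder (CSub C X₁ × CSub C X₂))

instance (X₁ X₂ : WeakModule V) : IsDirectedOrder (Pairs C X₁ X₂) :=
  ⟨fun p q => by
    obtain ⟨W₁, h₁, k₁⟩ := (hC.isDirectedOrder X₁).directed p.1 q.1
    obtain ⟨W₂, h₂, k₂⟩ := (hC.isDirectedOrder X₂).directed p.2 q.2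
    exact ⟨(W₁, W₂), ⟨h₁, h₂⟩, ⟨k₁, k₂⟩⟩⟩

instance (X₁ X₂ : WeakModule V) : Nonempty (Pairs C X₁ X₂) :=
  ⟨((hC.nonempty X₁).some, (hC.nonempty X₂).some)⟩

/-- The directed system of the `W₁ ⊗ W₂`. -/
def pairSystem (X₁ X₂ : WeakModule V) : Pairs C X₁ X₂ ⥤ C.FullSubcategory where
  obj p := p.1.toC ⊗ p.2.toC
  map h := (CSub.system C X₁).map (homOfLE (leOfHom h).1)
    ⊗ₘ (CSub.system C X₂).map (homOfLE (leOfHom h).2)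
  map_id p := by
    have h₁ : (CSub.system C X₁).map (𝟙 p.1) = 𝟙 _ := CategoryTheory.Functor.map_id _ _
    have h₂ : (CSub.system C X₂).map (𝟙 p.2) = 𝟙 _ := CategoryTheory.Functor.map_id _ _
    refine (congrArg₂ (· ⊗ₘ ·) h₁ h₂).trans (id_tensorHom_id _ _)
  map_comp f g := by
    have h₁ := (CSub.system C X₁).map_comp (homOfLE (leOfHom f).1) (homOfLE (leOfHom g).1)
    have h₂ := (CSub.system C X₂).map_comp (homOfLE (leOfHom f).2) (homOfLE (leOfHom g).2)
    exact (congrArg₂ (· ⊗ₘ ·) h₁ h₂).trans (tensorHom_comp_tensorHom _ _ _ _).symm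

/-- The tensor product of two weak modules: the colimit of the `W₁ ⊗ W₂` over all pairs of
`C`-submodules. -/
def T (X₁ X₂ : WeakModule V) : WeakModule V := colim (pairSystem C X₁ X₂ ⋙ C.ι)

theorem ind_T (X₁ X₂ : WeakModule V) : Ind C (T C X₁ X₂) :=
  IsFiniteAbelian.ind_colim (pairSystem C X₁ X₂)

variable {C}

/-- The canonical morphisms `W₁ ⊗ W₂ ⟶ T X₁ X₂`. -/
def tensorι {X₁ X₂ : WeakModule V} (W₁ : CSub C X₁) (W₂ : CSub C X₂) :
    (W₁.toC ⊗ W₂.toC).obj ⟶ T C X₁ X₂ :=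
  colimι (pairSystem C X₁ X₂ ⋙ C.ι) (W₁, W₂)

theorem tensorι_naturality {X₁ X₂ : WeakModule V} {W₁ U₁ : CSub C X₁} {W₂ U₂ : CSub C X₂}
    (f : W₁.toC ⟶ U₁.toC) (g : W₂.toC ⟶ U₂.toC) (hf : f.hom ≫ U₁.incl = W₁.incl)
    (hg : g.hom ≫ U₂.incl = W₂.incl) :
    (f ⊗ₘ g).hom ≫ tensorι U₁ U₂ = tensorι W₁ W₂ := by
  have h₁ : W₁ ≤ U₁ := fun x hx => by
    have h := congr_lin hf (W₁.1.elt x hx)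
    rw [CSub.incl, Sub.incl_elt] at h
    rw [← h]
    exact Sub.incl_mem _ _
  have h₂ : W₂ ≤ U₂ := fun x hx => by
    have h := congr_lin hg (W₂.1.elt x hx)
    rw [CSub.incl, Sub.incl_elt] at h
    rw [← h]
    exact Sub.incl_mem _ _
  have e₁ : f = (CSub.system C X₁).map (homOfLE h₁) :=
    ObjectProperty.hom_ext _ (Sub.hom_ext_incl hf)
  have e₂ : g = (CSub.system C X₂).map (homOfLE h₂) :=
    ObjectProperty.hom_ext _ (Sub.hom_ext_incl hg)
  rw [e₁, e₂]
  exact colimι_naturality (pairSystem C X₁ X₂ ⋙ C.ι)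
    (homOfLE (⟨h₁, h₂⟩ : ((W₁, W₂) : Pairs C X₁ X₂) ≤ (U₁, U₂)))

/-- A homomorphism from an object of `C`, corestricted to its image. -/
def toIm {A : C.FullSubcategory} {X : WeakModule V} (a : A.obj ⟶ X) : A ⟶ (hC.im a).toC :=
  C.homMk (Sub.lift a (Sub.range a) fun x => ⟨x, rfl⟩)

/-- The morphism `a₁ ⊗ a₂ : A₁ ⊗ A₂ ⟶ T X₁ X₂` induced by two morphisms from objects of `C`. All
structure morphisms on `Ind(C)` are defined and compared through these. -/
def pair {A₁ A₂ : C.FullSubcategory} {X₁ X₂ : WeakModule V} (a₁ : A₁.obj ⟶ X₁)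
    (a₂ : A₂.obj ⟶ X₂) : (A₁ ⊗ A₂).obj ⟶ T C X₁ X₂ :=
  (toIm a₁ ⊗ₘ toIm a₂).hom ≫ tensorι (hC.im a₁) (hC.im a₂)

section

variable {A₁ A₂ B₁ B₂ S : C.FullSubcategory} {X₁ X₂ X₃ X₄ Y Z₁ Z₂ Z₃ : WeakModule V}

/-- The morphism `a₁ ⊗ a₂` can be computed with any pair of `C`-submodules through which `a₁` and
`a₂` factor. -/
theorem pair_eq {a₁ : A₁.obj ⟶ X₁} {a₂ : A₂.obj ⟶ X₂} {W₁ : CSub C X₁} {W₂ : CSub C X₂}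
    (f : A₁ ⟶ W₁.toC) (g : A₂ ⟶ W₂.toC) (hf : f.hom ≫ W₁.incl = a₁)
    (hg : g.hom ≫ W₂.incl = a₂) : pair a₁ a₂ = (f ⊗ₘ g).hom ≫ tensorι W₁ W₂ := by
  subst hf hg
  let i₁ : (hC.im (f.hom ≫ W₁.incl)).toC ⟶ W₁.toC :=
    C.homMk (Sub.lift (CSub.incl _) W₁.1 (by
      rintro ⟨_, x, rfl⟩; exact Sub.incl_mem _ (lin f.hom x)))
  let i₂ : (hC.im (g.hom ≫ W₂.incl)).toC ⟶ W₂.toC :=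
    C.homMk (Sub.lift (CSub.incl _) W₂.1 (by
      rintro ⟨_, x, rfl⟩; exact Sub.incl_mem _ (lin g.hom x)))
  have e₁ : f = toIm (f.hom ≫ W₁.incl) ≫ i₁ := rfl
  have e₂ : g = toIm (g.hom ≫ W₂.incl) ≫ i₂ := rfl
  have h := tensorι_naturality i₁ i₂ rfl rfl
  conv_rhs => rw [e₁, e₂]
  rw [← tensorHom_comp_tensorHom, ObjectProperty.FullSubcategory.comp_hom, Category.assoc, h]
  rfl

theorem tensorι_eq_pair (W₁ : CSub C X₁) (W₂ : CSub C X₂) :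
    tensorι W₁ W₂ = pair W₁.incl W₂.incl := by
  rw [pair_eq (𝟙 _) (𝟙 _) (Category.id_comp _) (Category.id_comp _), id_tensorHom_id]
  exact (Category.id_comp _).symm

theorem pair_comp (f : A₁ ⟶ B₁) (g : A₂ ⟶ B₂) (b₁ : B₁.obj ⟶ X₁) (b₂ : B₂.obj ⟶ X₂) :
    pair (f.hom ≫ b₁) (g.hom ≫ b₂) = (f ⊗ₘ g).hom ≫ pair b₁ b₂ := by
  have h : pair (f.hom ≫ b₁) (g.hom ≫ b₂) = _ := pair_eq (f ≫ toIm b₁) (g ≫ toIm b₂) rfl rfl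
  rw [h, ← tensorHom_comp_tensorHom, ObjectProperty.FullSubcategory.comp_hom, Category.assoc]
  rfl

theorem pair_comp_left (f : A₁ ⟶ B₁) (b₁ : B₁.obj ⟶ X₁) (a₂ : A₂.obj ⟶ X₂) :
    pair (f.hom ≫ b₁) a₂ = (f ▷ A₂).hom ≫ pair b₁ a₂ := by
  rw [← tensorHom_id, ← pair_comp]
  congr 1

theorem pair_comp_right (a₁ : A₁.obj ⟶ X₁) (g : A₂ ⟶ B₂) (b₂ : B₂.obj ⟶ X₂) :
    pair a₁ (g.hom ≫ b₂) = (A₁ ◁ g).hom ≫ pair a₁ b₂ := by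
  rw [← id_tensorHom, ← pair_comp]
  congr 1

theorem T_ext {f g : T C X₁ X₂ ⟶ Y}
    (h : ∀ (A₁ A₂ : C.FullSubcategory) (a₁ : A₁.obj ⟶ X₁) (a₂ : A₂.obj ⟶ X₂),
      pair a₁ a₂ ≫ f = pair a₁ a₂ ≫ g) : f = g :=
  colim_hom_ext fun p => by
    have := h _ _ p.1.incl p.2.incl
    rw [← tensorι_eq_pair] at this
    exact this

/-- A natural family of morphisms `A₁ ⊗ A₂ ⟶ Y`, indexed by morphisms `A₁ ⟶ X₁` and `A₂ ⟶ X₂`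
from objects of `C`, induces a morphism `T X₁ X₂ ⟶ Y`. -/
theorem exists_desc (ψ : ∀ {A₁ A₂ : C.FullSubcategory} (_ : A₁.obj ⟶ X₁) (_ : A₂.obj ⟶ X₂),
      (A₁ ⊗ A₂).obj ⟶ Y)
    (hψ : ∀ {A₁ A₂ B₁ B₂ : C.FullSubcategory} (f : A₁ ⟶ B₁) (g : A₂ ⟶ B₂) (b₁ : B₁.obj ⟶ X₁)
      (b₂ : B₂.obj ⟶ X₂), ψ (f.hom ≫ b₁) (g.hom ≫ b₂) = (f ⊗ₘ g).hom ≫ ψ b₁ b₂) :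
    ∃ F : T C X₁ X₂ ⟶ Y, ∀ {A₁ A₂ : C.FullSubcategory} (a₁ : A₁.obj ⟶ X₁) (a₂ : A₂.obj ⟶ X₂),
      pair a₁ a₂ ≫ F = ψ a₁ a₂ := by
  let F : T C X₁ X₂ ⟶ Y := colimDesc (pairSystem C X₁ X₂ ⋙ C.ι)
    (fun p => ψ p.1.incl p.2.incl) fun h => (hψ _ _ _ _).symm
  have hF : ∀ (W₁ : CSub C X₁) (W₂ : CSub C X₂), tensorι W₁ W₂ ≫ F = ψ W₁.incl W₂.incl :=
    fun W₁ W₂ => colimι_desc (pairSystem C X₁ X₂ ⋙ C.ι) _ _ (W₁, W₂)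
  refine ⟨F, fun a₁ a₂ => ?_⟩
  rw [pair, Category.assoc, hF, ← hψ]
  rfl

/-- Every morphism from an object of `C` to `T X₁ X₂` factors through some `a₁ ⊗ a₂`. -/
theorem exists_factor_pair (s : S.obj ⟶ T C X₁ X₂) :
    ∃ (A₁ A₂ : C.FullSubcategory) (a₁ : A₁.obj ⟶ X₁) (a₂ : A₂.obj ⟶ X₂) (t : S ⟶ A₁ ⊗ A₂),
      t.hom ≫ pair a₁ a₂ = s := by
  obtain ⟨p, t, ht⟩ := hC.exists_comp_colimι (pairSystem C X₁ X₂ ⋙ C.ι)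
    (fun p => ((pairSystem C X₁ X₂).obj p).2) S.2 s
  refine ⟨_, _, p.1.incl, p.2.incl, C.homMk t, ?_⟩
  rw [← tensorι_eq_pair]
  exact ht

/-- Two factorizations of the same morphism through some `a₁ ⊗ a₂` have a common
refinement. Stated as an invariance principle: a function of factorizations that is compatible with
refinement depends only on the composite. -/
theorem factor_pair_invariant {Q : Sort*}
    (Φ : ∀ {A₁ A₂ : C.FullSubcategory} (_ : S ⟶ A₁ ⊗ A₂) (_ : A₁.obj ⟶ X₁) (_ : A₂.obj ⟶ X₂), Q)
    (hΦ : ∀ {A₁ A₂ B₁ B₂ : C.FullSubcategory} (t : S ⟶ A₁ ⊗ A₂) (f : A₁ ⟶ B₁) (g : A₂ ⟶ B₂)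
      (b₁ : B₁.obj ⟶ X₁) (b₂ : B₂.obj ⟶ X₂),
      Φ t (f.hom ≫ b₁) (g.hom ≫ b₂) = Φ (t ≫ (f ⊗ₘ g)) b₁ b₂)
    (t : S ⟶ A₁ ⊗ A₂) (a₁ : A₁.obj ⟶ X₁) (a₂ : A₂.obj ⟶ X₂)
    (t' : S ⟶ B₁ ⊗ B₂) (b₁ : B₁.obj ⟶ X₁) (b₂ : B₂.obj ⟶ X₂)
    (h : t.hom ≫ pair a₁ a₂ = t'.hom ≫ pair b₁ b₂) : Φ t a₁ a₂ = Φ t' b₁ b₂ := by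
  obtain ⟨W₁, ⟨f₁, rfl⟩, ⟨g₁, rfl⟩⟩ := hC.exists_cSub a₁ b₁
  obtain ⟨W₂, ⟨f₂, rfl⟩, ⟨g₂, rfl⟩⟩ := hC.exists_cSub a₂ b₂
  rw [pair_comp, pair_comp, ← tensorι_eq_pair, ← Category.assoc, ← Category.assoc] at h
  obtain ⟨j, k, hk⟩ := exists_comp_map_eq (pairSystem C X₁ X₂ ⋙ C.ι) (i := (W₁, W₂))
    (hC.isFinitelyGenerated S) (t ≫ (f₁ ⊗ₘ f₂)).hom (t' ≫ (g₁ ⊗ₘ g₂)).hom h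
  have hk' : (t ≫ (f₁ ⊗ₘ f₂)) ≫ (pairSystem C X₁ X₂).map k
      = (t' ≫ (g₁ ⊗ₘ g₂)) ≫ (pairSystem C X₁ X₂).map k := ObjectProperty.hom_ext _ hk
  rw [hΦ, hΦ]
  have e := fun u : S ⟶ W₁.toC ⊗ W₂.toC =>
    hΦ u ((CSub.system C X₁).map (homOfLE (leOfHom k).1))
      ((CSub.system C X₂).map (homOfLE (leOfHom k).2)) j.1.incl j.2.incl
  exact (e _).trans ((congrArg (fun u => Φ u j.1.incl j.2.incl) hk').trans (e _).symm)

/-! ### The structure morphisms -/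

/-- `F₁ ⊗ F₂` for morphisms between weak modules. -/
def map (F₁ : X₁ ⟶ Z₁) (F₂ : X₂ ⟶ Z₂) : T C X₁ X₂ ⟶ T C Z₁ Z₂ :=
  (exists_desc (fun a₁ a₂ => pair (a₁ ≫ F₁) (a₂ ≫ F₂)) fun f g b₁ b₂ => by
    rw [Category.assoc, Category.assoc, pair_comp]).choose

theorem pair_map (a₁ : A₁.obj ⟶ X₁) (a₂ : A₂.obj ⟶ X₂) (F₁ : X₁ ⟶ Z₁) (F₂ : X₂ ⟶ Z₂) :
    pair a₁ a₂ ≫ map F₁ F₂ = pair (a₁ ≫ F₁) (a₂ ≫ F₂) :=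
  (exists_desc (fun a₁ a₂ => pair (a₁ ≫ F₁) (a₂ ≫ F₂)) fun f g b₁ b₂ => by
    rw [Category.assoc, Category.assoc, pair_comp]).choose_spec a₁ a₂

/-- The inverse associator sends `a₁ ⊗ s`, with `s` factored as `t ≫ (a₂ ⊗ a₃)`, to the composite of
`id ⊗ t`, the inverse associator of `C`, and `(a₁ ⊗ a₂) ⊗ a₃`. -/
theorem exists_assocInv : ∃ F : T C X₁ (T C X₂ X₃) ⟶ T C (T C X₁ X₂) X₃,
    ∀ {A₁ A₂ A₃ : C.FullSubcategory} (a₁ : A₁.obj ⟶ X₁) (a₂ : A₂.obj ⟶ X₂) (a₃ : A₃.obj ⟶ X₃),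
      pair a₁ (pair a₂ a₃) ≫ F = (α_ A₁ A₂ A₃).inv.hom ≫ pair (pair a₁ a₂) a₃ := by
  -- The composite does not depend on the factorization of `s`.
  have wd : ∀ {A S A₂ A₃ B₂ B₃ : C.FullSubcategory} (a : A.obj ⟶ X₁) (t : S ⟶ A₂ ⊗ A₃)
      (a₂ : A₂.obj ⟶ X₂) (a₃ : A₃.obj ⟶ X₃) (t' : S ⟶ B₂ ⊗ B₃) (b₂ : B₂.obj ⟶ X₂)
      (b₃ : B₃.obj ⟶ X₃), t.hom ≫ pair a₂ a₃ = t'.hom ≫ pair b₂ b₃ →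
      (A ◁ t ≫ (α_ A A₂ A₃).inv).hom ≫ pair (pair a a₂) a₃
        = (A ◁ t' ≫ (α_ A B₂ B₃).inv).hom ≫ pair (pair a b₂) b₃ := by
    intro A S A₂ A₃ B₂ B₃ a t a₂ a₃ t' b₂ b₃
    refine factor_pair_invariant
      (fun {A₂ A₃} t a₂ a₃ => (A ◁ t ≫ (α_ A A₂ A₃).inv).hom ≫ pair (pair a a₂) a₃)
      ?_ t a₂ a₃ t' b₂ b₃
    intro A₁ A₂ B₁ B₂ t f g b₁ b₂
    rw [pair_comp_right a f, pair_comp, ← Category.assoc,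
      ← ObjectProperty.FullSubcategory.comp_hom]
    congr 2
    simp [MonoidalCategory.tensorHom_def]
  choose L R l r t ht using fun (S : C.FullSubcategory) (s : S.obj ⟶ T C X₂ X₃) =>
    exists_factor_pair s
  obtain ⟨F, hF⟩ := exists_desc (X₁ := X₁) (X₂ := T C X₂ X₃) (Y := T C (T C X₁ X₂) X₃)
    (fun {A S} a s => (A ◁ t S s ≫ (α_ _ _ _).inv).hom ≫ pair (pair a (l S s)) (r S s)) (by
      intro A₁ A₂ B₁ B₂ f g b₁ b₂
      rw [wd (f.hom ≫ b₁) (t _ (g.hom ≫ b₂)) _ _ (g ≫ t _ b₂) (l _ b₂) (r _ b₂)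
        (by rw [ht, ObjectProperty.FullSubcategory.comp_hom, Category.assoc, ht]),
        pair_comp_left f, pair_comp_left, ← Category.assoc, ← Category.assoc,
        ← ObjectProperty.FullSubcategory.comp_hom, ← ObjectProperty.FullSubcategory.comp_hom]
      congr 2
      simp only [Category.assoc]
      rw [MonoidalCategory.tensorHom_def', Category.assoc, ← whisker_exchange_assoc]
      simp)
  refine ⟨F, fun {A₁ A₂ A₃} a₁ a₂ a₃ => ?_⟩
  rw [hF, wd a₁ (t _ (pair a₂ a₃)) _ _ (𝟙 _) a₂ a₃ ((ht _ _).trans (Category.id_comp _).symm)]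
  simp

/-- The associator is obtained like its inverse, by factoring through some `a₁ ⊗ a₂` in the first
argument. -/
theorem exists_assocHom : ∃ F : T C (T C X₁ X₂) X₃ ⟶ T C X₁ (T C X₂ X₃),
    ∀ {A₁ A₂ A₃ : C.FullSubcategory} (a₁ : A₁.obj ⟶ X₁) (a₂ : A₂.obj ⟶ X₂) (a₃ : A₃.obj ⟶ X₃),
      pair (pair a₁ a₂) a₃ ≫ F = (α_ A₁ A₂ A₃).hom.hom ≫ pair a₁ (pair a₂ a₃) := by
  have wd : ∀ {A S A₁ A₂ B₁ B₂ : C.FullSubcategory} (a : A.obj ⟶ X₃) (t : S ⟶ A₁ ⊗ A₂)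
      (a₁ : A₁.obj ⟶ X₁) (a₂ : A₂.obj ⟶ X₂) (t' : S ⟶ B₁ ⊗ B₂) (b₁ : B₁.obj ⟶ X₁)
      (b₂ : B₂.obj ⟶ X₂), t.hom ≫ pair a₁ a₂ = t'.hom ≫ pair b₁ b₂ →
      (t ▷ A ≫ (α_ A₁ A₂ A).hom).hom ≫ pair a₁ (pair a₂ a)
        = (t' ▷ A ≫ (α_ B₁ B₂ A).hom).hom ≫ pair b₁ (pair b₂ a) := by
    intro A S A₁ A₂ B₁ B₂ a t a₁ a₂ t' b₁ b₂
    refine factor_pair_invariant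
      (fun {A₁ A₂} t a₁ a₂ => (t ▷ A ≫ (α_ A₁ A₂ A).hom).hom ≫ pair a₁ (pair a₂ a))
      ?_ t a₁ a₂ t' b₁ b₂
    intro A₁ A₂ B₁ B₂ t f g b₁ b₂
    rw [pair_comp_left g, pair_comp, ← Category.assoc,
      ← ObjectProperty.FullSubcategory.comp_hom]
    congr 2
    simp [MonoidalCategory.tensorHom_def]
  choose L R l r t ht using fun (S : C.FullSubcategory) (s : S.obj ⟶ T C X₁ X₂) =>
    exists_factor_pair s
  obtain ⟨F, hF⟩ := exists_desc (X₁ := T C X₁ X₂) (X₂ := X₃) (Y := T C X₁ (T C X₂ X₃))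
    (fun {S A} s a => (t S s ▷ A ≫ (α_ _ _ _).hom).hom ≫ pair (l S s) (pair (r S s) a)) (by
      intro A₁ A₂ B₁ B₂ f g b₁ b₂
      rw [wd (g.hom ≫ b₂) (t _ (f.hom ≫ b₁)) _ _ (f ≫ t _ b₁) (l _ b₁) (r _ b₁)
        (by rw [ht, ObjectProperty.FullSubcategory.comp_hom, Category.assoc, ht]),
        pair_comp_right _ g, pair_comp_right, ← Category.assoc, ← Category.assoc,
        ← ObjectProperty.FullSubcategory.comp_hom, ← ObjectProperty.FullSubcategory.comp_hom]
      congr 2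
      simp only [Category.assoc]
      rw [MonoidalCategory.tensorHom_def, Category.assoc, whisker_exchange_assoc]
      simp)
  refine ⟨F, fun {A₁ A₂ A₃} a₁ a₂ a₃ => ?_⟩
  rw [hF, wd a₃ (t _ (pair a₁ a₂)) _ _ (𝟙 _) a₁ a₂ ((ht _ _).trans (Category.id_comp _).symm)]
  simp

variable (C) in
/-- The associator of `T`, characterized by `pair_assocHom`. -/
def assocHom (X₁ X₂ X₃ : WeakModule V) : T C (T C X₁ X₂) X₃ ⟶ T C X₁ (T C X₂ X₃) :=
  exists_assocHom.choose

variable (C) in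
/-- The inverse associator of `T`, characterized by `pair_assocInv`. -/
def assocInv (X₁ X₂ X₃ : WeakModule V) : T C X₁ (T C X₂ X₃) ⟶ T C (T C X₁ X₂) X₃ :=
  exists_assocInv.choose

theorem pair_assocHom {A₁ A₂ A₃ : C.FullSubcategory} (a₁ : A₁.obj ⟶ X₁) (a₂ : A₂.obj ⟶ X₂)
    (a₃ : A₃.obj ⟶ X₃) : pair (pair a₁ a₂) a₃ ≫ assocHom C X₁ X₂ X₃
      = (α_ A₁ A₂ A₃).hom.hom ≫ pair a₁ (pair a₂ a₃) :=
  exists_assocHom.choose_spec a₁ a₂ a₃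

theorem pair_assocInv {A₁ A₂ A₃ : C.FullSubcategory} (a₁ : A₁.obj ⟶ X₁) (a₂ : A₂.obj ⟶ X₂)
    (a₃ : A₃.obj ⟶ X₃) : pair a₁ (pair a₂ a₃) ≫ assocInv C X₁ X₂ X₃
      = (α_ A₁ A₂ A₃).inv.hom ≫ pair (pair a₁ a₂) a₃ :=
  exists_assocInv.choose_spec a₁ a₂ a₃

theorem T_ext_left {f g : T C (T C X₁ X₂) X₃ ⟶ Y}
    (h : ∀ (A₁ A₂ A₃ : C.FullSubcategory) (a₁ : A₁.obj ⟶ X₁) (a₂ : A₂.obj ⟶ X₂)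
      (a₃ : A₃.obj ⟶ X₃), pair (pair a₁ a₂) a₃ ≫ f = pair (pair a₁ a₂) a₃ ≫ g) : f = g := by
  refine T_ext fun S A₃ s a₃ => ?_
  obtain ⟨A₁, A₂, a₁, a₂, t, rfl⟩ := exists_factor_pair s
  rw [pair_comp_left, Category.assoc, Category.assoc, h]

theorem T_ext_right {f g : T C X₁ (T C X₂ X₃) ⟶ Y}
    (h : ∀ (A₁ A₂ A₃ : C.FullSubcategory) (a₁ : A₁.obj ⟶ X₁) (a₂ : A₂.obj ⟶ X₂)
      (a₃ : A₃.obj ⟶ X₃), pair a₁ (pair a₂ a₃) ≫ f = pair a₁ (pair a₂ a₃) ≫ g) : f = g := by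
  refine T_ext fun A₁ S a₁ s => ?_
  obtain ⟨A₂, A₃, a₂, a₃, t, rfl⟩ := exists_factor_pair s
  rw [pair_comp_right, Category.assoc, Category.assoc, h]

theorem T_ext_left_left {f g : T C (T C (T C X₁ X₂) X₃) X₄ ⟶ Y}
    (h : ∀ (A₁ A₂ A₃ A₄ : C.FullSubcategory) (a₁ : A₁.obj ⟶ X₁) (a₂ : A₂.obj ⟶ X₂)
      (a₃ : A₃.obj ⟶ X₃) (a₄ : A₄.obj ⟶ X₄),
      pair (pair (pair a₁ a₂) a₃) a₄ ≫ f = pair (pair (pair a₁ a₂) a₃) a₄ ≫ g) : f = g := by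
  refine T_ext_left fun S A₃ A₄ s a₃ a₄ => ?_
  obtain ⟨A₁, A₂, a₁, a₂, t, rfl⟩ := exists_factor_pair s
  rw [pair_comp_left, pair_comp_left, Category.assoc, Category.assoc, h]

/-! ### Morphisms out of an object of `Ind(C)` -/

omit [BraidedTensorCategoryWithTwist C] in
theorem ind_ext (hX : Ind C Y) {f g : Y ⟶ Z₁}
    (h : ∀ (A : C.FullSubcategory) (a : A.obj ⟶ Y), a ≫ f = a ≫ g) : f = g :=
  hC.ind_hom_ext hX fun W => h _ W.incl

omit [BraidedTensorCategoryWithTwist C] in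
/-- A natural family of morphisms `A ⟶ Z₁`, indexed by morphisms `A ⟶ Y` from objects of `C`,
induces a morphism `Y ⟶ Z₁`. -/
theorem exists_indDesc (hX : Ind C Y) (ψ : ∀ {A : C.FullSubcategory} (_ : A.obj ⟶ Y), A.obj ⟶ Z₁)
    (hψ : ∀ {A B : C.FullSubcategory} (f : A ⟶ B) (b : B.obj ⟶ Y), ψ (f.hom ≫ b) = f.hom ≫ ψ b) :
    ∃ F : Y ⟶ Z₁, ∀ {A : C.FullSubcategory} (a : A.obj ⟶ Y), a ≫ F = ψ a := by
  obtain ⟨F, hF⟩ := hC.exists_ind_desc hX (fun W => ψ W.incl)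
    fun {W W'} h => (hψ ((CSub.system C Y).map (homOfLE h)) W'.incl).symm
  exact ⟨F, fun a => (congrArg ((toIm a).hom ≫ ·) (hF (hC.im a))).trans (hψ _ _).symm⟩

end

end IndTensor

namespace IndTensor

/-! ### Unitors, braiding and twist on `Ind(C)` -/

variable {C : ObjectProperty (WeakModule.{u} V)} [BraidedTensorCategoryWithTwist C]
  [hC : IsFiniteAbelian C]

section

variable {A A₁ A₂ A₃ : C.FullSubcategory} {X X₁ X₂ X₃ Y Z₁ Z₂ Z₃ : WeakModule V}

theorem pair_map_assoc (a₁ : A₁.obj ⟶ X₁) (a₂ : A₂.obj ⟶ X₂) (F₁ : X₁ ⟶ Z₁) (F₂ : X₂ ⟶ Z₂)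
    (k : T C Z₁ Z₂ ⟶ Y) : pair a₁ a₂ ≫ map F₁ F₂ ≫ k = pair (a₁ ≫ F₁) (a₂ ≫ F₂) ≫ k := by
  rw [← Category.assoc, pair_map]

theorem pair_assocHom_assoc (a₁ : A₁.obj ⟶ X₁) (a₂ : A₂.obj ⟶ X₂) (a₃ : A₃.obj ⟶ X₃)
    (k : T C X₁ (T C X₂ X₃) ⟶ Y) : pair (pair a₁ a₂) a₃ ≫ assocHom C X₁ X₂ X₃ ≫ k
      = (α_ A₁ A₂ A₃).hom.hom ≫ pair a₁ (pair a₂ a₃) ≫ k := by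
  rw [← Category.assoc, pair_assocHom, Category.assoc]

theorem pair_assocInv_assoc (a₁ : A₁.obj ⟶ X₁) (a₂ : A₂.obj ⟶ X₂) (a₃ : A₃.obj ⟶ X₃)
    (k : T C (T C X₁ X₂) X₃ ⟶ Y) : pair a₁ (pair a₂ a₃) ≫ assocInv C X₁ X₂ X₃ ≫ k
      = (α_ A₁ A₂ A₃).inv.hom ≫ pair (pair a₁ a₂) a₃ ≫ k := by
  rw [← Category.assoc, pair_assocInv, Category.assoc]

theorem exists_leftHom (X : WeakModule V) : ∃ F : T C (𝟙_ C.FullSubcategory).obj X ⟶ X,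
    ∀ {U A : C.FullSubcategory} (u : U.obj ⟶ (𝟙_ C.FullSubcategory).obj) (a : A.obj ⟶ X),
      pair u a ≫ F = (C.homMk u ▷ A ≫ (λ_ A).hom).hom ≫ a :=
  exists_desc _ fun {A₁ A₂ B₁ B₂} f g b₁ b₂ => by
    have h : (C.homMk (f.hom ≫ b₁) : A₁ ⟶ 𝟙_ C.FullSubcategory) = f ≫ C.homMk b₁ := rfl
    rw [h, ← Category.assoc, ← Category.assoc, ← ObjectProperty.FullSubcategory.comp_hom,
      ← ObjectProperty.FullSubcategory.comp_hom]
    congr 2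
    simp [MonoidalCategory.tensorHom_def', whisker_exchange_assoc]

theorem exists_rightHom (X : WeakModule V) : ∃ F : T C X (𝟙_ C.FullSubcategory).obj ⟶ X,
    ∀ {A U : C.FullSubcategory} (a : A.obj ⟶ X) (u : U.obj ⟶ (𝟙_ C.FullSubcategory).obj),
      pair a u ≫ F = (A ◁ C.homMk u ≫ (ρ_ A).hom).hom ≫ a :=
  exists_desc (fun {A U} a u => (A ◁ C.homMk u ≫ (ρ_ A).hom).hom ≫ a)
      fun {A₁ A₂ B₁ B₂} f g b₁ b₂ => by
    have h : (C.homMk (g.hom ≫ b₂) : A₂ ⟶ 𝟙_ C.FullSubcategory) = g ≫ C.homMk b₂ := rfl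
    rw [h, ← Category.assoc, ← Category.assoc, ← ObjectProperty.FullSubcategory.comp_hom,
      ← ObjectProperty.FullSubcategory.comp_hom]
    congr 2
    simp [MonoidalCategory.tensorHom_def, ← whisker_exchange_assoc]

theorem exists_leftInv (hX : Ind C X) : ∃ F : X ⟶ T C (𝟙_ C.FullSubcategory).obj X,
    ∀ {A : C.FullSubcategory} (a : A.obj ⟶ X),
      a ≫ F = (λ_ A).inv.hom ≫ pair (𝟙 (𝟙_ C.FullSubcategory).obj) a :=
  exists_indDesc hX (fun {A} a => (λ_ A).inv.hom ≫ pair (𝟙 (𝟙_ C.FullSubcategory).obj) a)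
    fun {A B} f b => by
    rw [pair_comp_right, ← Category.assoc, ← Category.assoc,
      ← ObjectProperty.FullSubcategory.comp_hom, ← ObjectProperty.FullSubcategory.comp_hom]
    congr 2
    simp

theorem exists_rightInv (hX : Ind C X) : ∃ F : X ⟶ T C X (𝟙_ C.FullSubcategory).obj,
    ∀ {A : C.FullSubcategory} (a : A.obj ⟶ X),
      a ≫ F = (ρ_ A).inv.hom ≫ pair a (𝟙 (𝟙_ C.FullSubcategory).obj) :=
  exists_indDesc hX (fun {A} a => (ρ_ A).inv.hom ≫ pair a (𝟙 (𝟙_ C.FullSubcategory).obj))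
    fun {A B} f b => by
    rw [pair_comp_left, ← Category.assoc, ← Category.assoc,
      ← ObjectProperty.FullSubcategory.comp_hom, ← ObjectProperty.FullSubcategory.comp_hom]
    congr 2
    simp

theorem exists_braid (X₁ X₂ : WeakModule V) : ∃ F : T C X₁ X₂ ⟶ T C X₂ X₁,
    ∀ {A₁ A₂ : C.FullSubcategory} (a₁ : A₁.obj ⟶ X₁) (a₂ : A₂.obj ⟶ X₂),
      pair a₁ a₂ ≫ F = (β_ A₁ A₂).hom.hom ≫ pair a₂ a₁ :=
  exists_desc (fun {A₁ A₂} a₁ a₂ => (β_ A₁ A₂).hom.hom ≫ pair a₂ a₁)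
      fun {A₁ A₂ B₁ B₂} f g b₁ b₂ => by
    rw [pair_comp, ← Category.assoc, ← Category.assoc, ← ObjectProperty.FullSubcategory.comp_hom,
      ← ObjectProperty.FullSubcategory.comp_hom]
    congr 2
    simp

theorem exists_braidInv (X₁ X₂ : WeakModule V) : ∃ F : T C X₂ X₁ ⟶ T C X₁ X₂,
    ∀ {A₁ A₂ : C.FullSubcategory} (a₁ : A₁.obj ⟶ X₁) (a₂ : A₂.obj ⟶ X₂),
      pair a₂ a₁ ≫ F = (β_ A₁ A₂).inv.hom ≫ pair a₁ a₂ := by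
  obtain ⟨F, hF⟩ := exists_desc (X₁ := X₂) (X₂ := X₁) (Y := T C X₁ X₂)
    (fun {A₂ A₁} a₂ a₁ => (β_ A₁ A₂).inv.hom ≫ pair a₁ a₂) fun {A₁ A₂ B₁ B₂} f g b₁ b₂ => by
    rw [pair_comp, ← Category.assoc, ← Category.assoc, ← ObjectProperty.FullSubcategory.comp_hom,
      ← ObjectProperty.FullSubcategory.comp_hom]
    congr 2
    simp
  exact ⟨F, fun a₁ a₂ => hF a₂ a₁⟩

/-- The twist of `C`, at an object. -/
abbrev θ (A : C.FullSubcategory) : A ⟶ A :=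
  (BraidedTensorCategoryWithTwist.twist (P := C)).hom.app A

/-- The inverse of the twist of `C`, at an object. -/
abbrev θInv (A : C.FullSubcategory) : A ⟶ A :=
  (BraidedTensorCategoryWithTwist.twist (P := C)).inv.app A

theorem exists_twist (hX : Ind C X) : ∃ F : X ⟶ X, ∀ {A : C.FullSubcategory} (a : A.obj ⟶ X),
    a ≫ F = (θ A).hom ≫ a :=
  exists_indDesc hX _ fun {A B} f b => by
    have h : f ≫ θ B = θ A ≫ f :=
      (BraidedTensorCategoryWithTwist.twist (P := C)).hom.naturality f
    rw [← Category.assoc, ← ObjectProperty.FullSubcategory.comp_hom, ← h]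
    simp

theorem exists_twistInv (hX : Ind C X) : ∃ F : X ⟶ X, ∀ {A : C.FullSubcategory} (a : A.obj ⟶ X),
    a ≫ F = (θInv A).hom ≫ a :=
  exists_indDesc hX _ fun {A B} f b => by
    have h : f ≫ θInv B = θInv A ≫ f :=
      (BraidedTensorCategoryWithTwist.twist (P := C)).inv.naturality f
    rw [← Category.assoc, ← ObjectProperty.FullSubcategory.comp_hom, ← h]
    simp

/-! ### Linearity -/

/-- The images of `a` and `b` lie in a common `C`-submodule, which reduces additivity to that of the
tensor product of `C`. -/
theorem pair_add_left (a b : A₁.obj ⟶ X₁) (c : A₂.obj ⟶ X₂) :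
    pair (a + b) c = pair a c + pair b c := by
  obtain ⟨W, ⟨f, rfl⟩, ⟨g, rfl⟩⟩ := hC.exists_cSub a b
  have h : f.hom ≫ W.incl + g.hom ≫ W.incl = (f + g).hom ≫ W.incl :=
    (Preadditive.add_comp _ _ _ _ _ _).symm
  rw [h, pair_comp_left, pair_comp_left, pair_comp_left, MonoidalPreadditive.add_whiskerRight]
  exact Preadditive.add_comp _ _ _ _ _ _

theorem pair_add_right (c : A₁.obj ⟶ X₁) (a b : A₂.obj ⟶ X₂) :
    pair c (a + b) = pair c a + pair c b := by
  obtain ⟨W, ⟨f, rfl⟩, ⟨g, rfl⟩⟩ := hC.exists_cSub a b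
  have h : f.hom ≫ W.incl + g.hom ≫ W.incl = (f + g).hom ≫ W.incl :=
    (Preadditive.add_comp _ _ _ _ _ _).symm
  rw [h, pair_comp_right, pair_comp_right, pair_comp_right, MonoidalPreadditive.whiskerLeft_add]
  exact Preadditive.add_comp _ _ _ _ _ _

theorem pair_smul_left (r : ℂ) (a : A₁.obj ⟶ X₁) (c : A₂.obj ⟶ X₂) :
    pair (r • a) c = r • pair a c := by
  have h : r • a = (r • 𝟙 A₁ : A₁ ⟶ A₁).hom ≫ a :=
    (congrArg (r • ·) (Category.id_comp a)).symm.trans (Linear.smul_comp _ _ _ _ _ _).symm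
  rw [h, pair_comp_left, MonoidalLinear.smul_whiskerRight, id_whiskerRight]
  exact (Linear.smul_comp _ _ _ _ _ _).trans (congrArg (r • ·) (Category.id_comp _))

theorem pair_smul_right (r : ℂ) (c : A₁.obj ⟶ X₁) (a : A₂.obj ⟶ X₂) :
    pair c (r • a) = r • pair c a := by
  have h : r • a = (r • 𝟙 A₂ : A₂ ⟶ A₂).hom ≫ a :=
    (congrArg (r • ·) (Category.id_comp a)).symm.trans (Linear.smul_comp _ _ _ _ _ _).symm
  rw [h, pair_comp_right, MonoidalLinear.whiskerLeft_smul, whiskerLeft_id]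
  exact (Linear.smul_comp _ _ _ _ _ _).trans (congrArg (r • ·) (Category.id_comp _))

end

/-! ### The braided tensor category structure -/

variable (C)

/-- The left unitor of `T`, characterized by `pair_leftHom`. -/
def leftHom (X : WeakModule V) : T C (𝟙_ C.FullSubcategory).obj X ⟶ X := (exists_leftHom X).choose

/-- The right unitor of `T`, characterized by `pair_rightHom`. -/
def rightHom (X : WeakModule V) : T C X (𝟙_ C.FullSubcategory).obj ⟶ X :=
  (exists_rightHom X).choose

/-- The braiding of `T`, characterized by `pair_braid`. -/
def braid (X₁ X₂ : WeakModule V) : T C X₁ X₂ ⟶ T C X₂ X₁ := (exists_braid X₁ X₂).choose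

variable {C}

variable {A A₁ A₂ A₃ U : C.FullSubcategory} {X X₁ X₂ X₃ Y Z₁ Z₂ Z₃ : WeakModule V}

theorem pair_leftHom (u : U.obj ⟶ (𝟙_ C.FullSubcategory).obj) (a : A.obj ⟶ X) :
    pair u a ≫ leftHom C X = (C.homMk u ▷ A).hom ≫ (λ_ A).hom.hom ≫ a :=
  ((exists_leftHom X).choose_spec u a).trans (Category.assoc _ _ _)

theorem pair_rightHom (a : A.obj ⟶ X) (u : U.obj ⟶ (𝟙_ C.FullSubcategory).obj) :
    pair a u ≫ rightHom C X = (A ◁ C.homMk u).hom ≫ (ρ_ A).hom.hom ≫ a :=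
  ((exists_rightHom X).choose_spec a u).trans (Category.assoc _ _ _)

theorem pair_braid (a₁ : A₁.obj ⟶ X₁) (a₂ : A₂.obj ⟶ X₂) :
    pair a₁ a₂ ≫ braid C X₁ X₂ = (β_ A₁ A₂).hom.hom ≫ pair a₂ a₁ :=
  (exists_braid X₁ X₂).choose_spec a₁ a₂

theorem pair_braid_assoc (a₁ : A₁.obj ⟶ X₁) (a₂ : A₂.obj ⟶ X₂) (k : T C X₂ X₁ ⟶ Y) :
    pair a₁ a₂ ≫ braid C X₁ X₂ ≫ k = (β_ A₁ A₂).hom.hom ≫ pair a₂ a₁ ≫ k := by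
  rw [← Category.assoc, pair_braid, Category.assoc]

theorem map_id_id (X₁ X₂ : WeakModule V) : map (𝟙 X₁) (𝟙 X₂) = 𝟙 (T C X₁ X₂) :=
  T_ext fun A₁ A₂ a₁ a₂ => by
    rw [pair_map, Category.comp_id, Category.comp_id, Category.comp_id]

theorem map_comp_map {Z₁ Z₂ Y₁ Y₂ : WeakModule V} (f₁ : X₁ ⟶ Y₁) (f₂ : X₂ ⟶ Y₂) (g₁ : Y₁ ⟶ Z₁)
    (g₂ : Y₂ ⟶ Z₂) : map (C := C) f₁ f₂ ≫ map g₁ g₂ = map (f₁ ≫ g₁) (f₂ ≫ g₂) :=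
  T_ext fun A₁ A₂ a₁ a₂ => by
    rw [pair_map_assoc, pair_map, pair_map, Category.assoc, Category.assoc]

variable (C)

/-- The associator of `T` as an isomorphism. -/
def assocIso (X₁ X₂ X₃ : WeakModule V) : T C (T C X₁ X₂) X₃ ≅ T C X₁ (T C X₂ X₃) where
  hom := assocHom C X₁ X₂ X₃
  inv := assocInv C X₁ X₂ X₃
  hom_inv_id := T_ext_left fun A₁ A₂ A₃ a₁ a₂ a₃ => by
    rw [pair_assocHom_assoc, pair_assocInv, ← Category.assoc,
      ObjectProperty.isoHom_inv_id_hom, Category.id_comp, Category.comp_id]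
  inv_hom_id := T_ext_right fun A₁ A₂ A₃ a₁ a₂ a₃ => by
    rw [pair_assocInv_assoc, pair_assocHom, ← Category.assoc,
      ObjectProperty.isoInv_hom_id_hom, Category.id_comp, Category.comp_id]

/-- The left unitor as an isomorphism. Its inverse is glued over the `C`-submodules of `X`, so it
needs `X` to be in `Ind(C)`. -/
def leftIso (hX : Ind C X) : T C (𝟙_ C.FullSubcategory).obj X ≅ X where
  hom := leftHom C X
  inv := (exists_leftInv hX).choose
  hom_inv_id := T_ext fun U A u a => by
    have hu : u = (C.homMk u : U ⟶ 𝟙_ C.FullSubcategory).hom ≫ 𝟙 _ := (Category.comp_id _).symm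
    rw [← Category.assoc, pair_leftHom, Category.assoc, Category.assoc,
      (exists_leftInv hX).choose_spec a]
    conv_rhs => rw [hu, pair_comp_left, Category.comp_id]
    simp
  inv_hom_id := ind_ext hX fun A a => by
    rw [← Category.assoc, (exists_leftInv hX).choose_spec a, Category.assoc, pair_leftHom]
    have h : (C.homMk (𝟙 _) : 𝟙_ C.FullSubcategory ⟶ 𝟙_ C.FullSubcategory) = 𝟙 _ := rfl
    rw [h, id_whiskerRight]
    simp

/-- The right unitor as an isomorphism, for `X` in `Ind(C)`. -/
def rightIso (hX : Ind C X) : T C X (𝟙_ C.FullSubcategory).obj ≅ X where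
  hom := rightHom C X
  inv := (exists_rightInv hX).choose
  hom_inv_id := T_ext fun A U a u => by
    have hu : u = (C.homMk u : U ⟶ 𝟙_ C.FullSubcategory).hom ≫ 𝟙 _ := (Category.comp_id _).symm
    rw [← Category.assoc, pair_rightHom, Category.assoc, Category.assoc,
      (exists_rightInv hX).choose_spec a]
    conv_rhs => rw [hu, pair_comp_right, Category.comp_id]
    simp
  inv_hom_id := ind_ext hX fun A a => by
    rw [← Category.assoc, (exists_rightInv hX).choose_spec a, Category.assoc, pair_rightHom]
    have h : (C.homMk (𝟙 _) : 𝟙_ C.FullSubcategory ⟶ 𝟙_ C.FullSubcategory) = 𝟙 _ := rfl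
    rw [h, whiskerLeft_id]
    simp

/-- The braiding of `T` as an isomorphism. -/
def braidIso (X₁ X₂ : WeakModule V) : T C X₁ X₂ ≅ T C X₂ X₁ where
  hom := braid C X₁ X₂
  inv := (exists_braidInv X₁ X₂).choose
  hom_inv_id := T_ext fun A₁ A₂ a₁ a₂ => by
    rw [pair_braid_assoc, (exists_braidInv X₁ X₂).choose_spec a₁ a₂]
    simp
  inv_hom_id := T_ext fun A₂ A₁ a₂ a₁ => by
    rw [← Category.assoc, (exists_braidInv X₁ X₂).choose_spec a₁ a₂, Category.assoc, pair_braid]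
    simp

/-- The twist on an object of `Ind(C)`. -/
def twistIso (hX : Ind C X) : X ≅ X where
  hom := (exists_twist hX).choose
  inv := (exists_twistInv hX).choose
  hom_inv_id := ind_ext hX fun A a => by
    rw [← Category.assoc, (exists_twist hX).choose_spec a, Category.assoc,
      (exists_twistInv hX).choose_spec a, ← Category.assoc,
      ← ObjectProperty.FullSubcategory.comp_hom]
    simp
  inv_hom_id := ind_ext hX fun A a => by
    rw [← Category.assoc, (exists_twistInv hX).choose_spec a, Category.assoc,
      (exists_twist hX).choose_spec a, ← Category.assoc,
      ← ObjectProperty.FullSubcategory.comp_hom]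
    simp

variable {C} in
theorem comp_twist (hX : Ind C X) (a : A.obj ⟶ X) :
    a ≫ (twistIso C hX).hom = (θ A).hom ≫ a := (exists_twist hX).choose_spec a

/-- The tensor product, unit, associators and unitors of `Ind(C)`. It is a reducible definition and
not an instance, since the second half of the theorem concerns arbitrary structures on `Ind(C)`. -/
@[reducible]
def indMonoidalStruct : MonoidalCategoryStruct (Ind C).FullSubcategory where
  tensorObj X Y := ⟨T C X.obj Y.obj, ind_T C _ _⟩
  whiskerLeft X _ _ f := ObjectProperty.homMk (map (𝟙 X.obj) f.hom)
  whiskerRight f X := ObjectProperty.homMk (map f.hom (𝟙 X.obj))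
  tensorHom f g := ObjectProperty.homMk (map f.hom g.hom)
  tensorUnit := ⟨(𝟙_ C.FullSubcategory).obj, IsFiniteAbelian.ind_of_mem (𝟙_ C.FullSubcategory).2⟩
  associator X Y Z := (Ind C).isoMk (assocIso C X.obj Y.obj Z.obj)
  leftUnitor X := (Ind C).isoMk (leftIso C X.2)
  rightUnitor X := (Ind C).isoMk (rightIso C X.2)

end IndTensor

namespace IndTensor

/-! ### Coherence and the direct limit extension -/

variable {C : ObjectProperty (WeakModule.{u} V)} [BraidedTensorCategoryWithTwist C]
  [hC : IsFiniteAbelian C]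

section

variable {A A₁ A₂ A₃ U : C.FullSubcategory} {X X₁ X₂ X₃ X₄ Y Z₁ Z₂ Z₃ : WeakModule V}

theorem map_assoc_naturality (f₁ : X₁ ⟶ Z₁) (f₂ : X₂ ⟶ Z₂) (f₃ : X₃ ⟶ Z₃) :
    map (map f₁ f₂) f₃ ≫ assocHom C Z₁ Z₂ Z₃ = assocHom C X₁ X₂ X₃ ≫ map f₁ (map f₂ f₃) :=
  T_ext_left fun A₁ A₂ A₃ a₁ a₂ a₃ => by
    rw [pair_map_assoc, pair_map, pair_assocHom, pair_assocHom_assoc, pair_map, pair_map]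

theorem leftHom_naturality (f : X₁ ⟶ X₂) : map (𝟙 _) f ≫ leftHom C X₂ = leftHom C X₁ ≫ f :=
  T_ext fun U A u a => by
    rw [pair_map_assoc, Category.comp_id, pair_leftHom, ← Category.assoc (pair u a), pair_leftHom]
    simp only [Category.assoc]

theorem rightHom_naturality (f : X₁ ⟶ X₂) : map f (𝟙 _) ≫ rightHom C X₂ = rightHom C X₁ ≫ f :=
  T_ext fun A U a u => by
    rw [pair_map_assoc, Category.comp_id, pair_rightHom, ← Category.assoc (pair a u), pair_rightHom]
    simp only [Category.assoc]

theorem pentagon (X₁ X₂ X₃ X₄ : WeakModule V) :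
    map (assocHom C X₁ X₂ X₃) (𝟙 X₄) ≫ assocHom C X₁ (T C X₂ X₃) X₄
        ≫ map (𝟙 X₁) (assocHom C X₂ X₃ X₄)
      = assocHom C (T C X₁ X₂) X₃ X₄ ≫ assocHom C X₁ X₂ (T C X₃ X₄) :=
  T_ext_left_left fun A₁ A₂ A₃ A₄ a₁ a₂ a₃ a₄ => by
    rw [pair_map_assoc, pair_assocHom, pair_comp_left, Category.assoc, pair_assocHom_assoc,
      pair_map, Category.comp_id, Category.comp_id, pair_assocHom, pair_comp_right,
      pair_assocHom_assoc, pair_assocHom]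
    have h := congrArg (fun k => k.hom ≫ pair a₁ (pair a₂ (pair a₃ a₄)))
      (MonoidalCategory.pentagon A₁ A₂ A₃ A₄)
    simpa only [ObjectProperty.FullSubcategory.comp_hom, Category.assoc] using h

theorem triangle (X₁ X₂ : WeakModule V) :
    assocHom C X₁ (𝟙_ C.FullSubcategory).obj X₂ ≫ map (𝟙 X₁) (leftHom C X₂)
      = map (rightHom C X₁) (𝟙 X₂) :=
  T_ext_left fun A₁ U A₂ a₁ u a₂ => by
    rw [pair_assocHom_assoc, pair_map, pair_map, pair_leftHom, pair_rightHom, Category.comp_id,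
      Category.comp_id, pair_comp_right, pair_comp_right, pair_comp_left, pair_comp_left]
    have h : (α_ A₁ U A₂).hom ≫ A₁ ◁ C.homMk (Y := 𝟙_ _) u ▷ A₂ ≫ A₁ ◁ (λ_ A₂).hom
        = (A₁ ◁ C.homMk u) ▷ A₂ ≫ (ρ_ A₁).hom ▷ A₂ := by simp
    simpa only [ObjectProperty.FullSubcategory.comp_hom, Category.assoc] using
      congrArg (fun k => k.hom ≫ pair a₁ a₂) h

theorem braid_naturality (f : X₁ ⟶ Z₁) (g : X₂ ⟶ Z₂) :
    map f g ≫ braid C Z₁ Z₂ = braid C X₁ X₂ ≫ map g f :=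
  T_ext fun A₁ A₂ a₁ a₂ => by
    rw [pair_map_assoc, pair_braid, pair_braid_assoc, pair_map]

theorem hexagon_forward (X₁ X₂ X₃ : WeakModule V) :
    assocHom C X₁ X₂ X₃ ≫ braid C X₁ (T C X₂ X₃) ≫ assocHom C X₂ X₃ X₁
      = map (braid C X₁ X₂) (𝟙 X₃) ≫ assocHom C X₂ X₁ X₃ ≫ map (𝟙 X₂) (braid C X₁ X₃) :=
  T_ext_left fun A₁ A₂ A₃ a₁ a₂ a₃ => by
    rw [pair_assocHom_assoc, pair_braid_assoc, pair_assocHom, pair_map_assoc, pair_braid,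
      Category.comp_id, pair_comp_left, Category.assoc, pair_assocHom_assoc, pair_map, pair_braid,
      Category.comp_id, pair_comp_right]
    simpa only [ObjectProperty.FullSubcategory.comp_hom, Category.assoc] using
      congrArg (fun k => k.hom ≫ pair a₂ (pair a₃ a₁)) (BraidedCategory.hexagon_forward A₁ A₂ A₃)

theorem hexagon_reverse (X₁ X₂ X₃ : WeakModule V) :
    assocInv C X₁ X₂ X₃ ≫ braid C (T C X₁ X₂) X₃ ≫ assocInv C X₃ X₁ X₂
      = map (𝟙 X₁) (braid C X₂ X₃) ≫ assocInv C X₁ X₃ X₂ ≫ map (braid C X₁ X₃) (𝟙 X₂) :=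
  T_ext_right fun A₁ A₂ A₃ a₁ a₂ a₃ => by
    rw [pair_assocInv_assoc, pair_braid_assoc, pair_assocInv, pair_map_assoc, pair_braid,
      Category.comp_id, pair_comp_right, Category.assoc, pair_assocInv_assoc, pair_map, pair_braid,
      Category.comp_id, pair_comp_left]
    simpa only [ObjectProperty.FullSubcategory.comp_hom, Category.assoc] using
      congrArg (fun k => k.hom ≫ pair (pair a₃ a₁) a₂) (BraidedCategory.hexagon_reverse A₁ A₂ A₃)

theorem map_add_left (f g : X₁ ⟶ Z₁) (h : X₂ ⟶ Z₂) :
    map (C := C) (f + g) h = map f h + map g h :=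
  T_ext fun A₁ A₂ a₁ a₂ => by
    rw [pair_map, Preadditive.comp_add, Preadditive.comp_add, pair_map, pair_map, pair_add_left]

theorem map_add_right (h : X₁ ⟶ Z₁) (f g : X₂ ⟶ Z₂) :
    map (C := C) h (f + g) = map h f + map h g :=
  T_ext fun A₁ A₂ a₁ a₂ => by
    rw [pair_map, Preadditive.comp_add, Preadditive.comp_add, pair_map, pair_map, pair_add_right]

theorem map_smul_left (r : ℂ) (f : X₁ ⟶ Z₁) (h : X₂ ⟶ Z₂) :
    map (C := C) (r • f) h = r • map f h :=
  T_ext fun A₁ A₂ a₁ a₂ => by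
    rw [pair_map, Linear.comp_smul, Linear.comp_smul, pair_map, pair_smul_left]

theorem map_smul_right (r : ℂ) (h : X₁ ⟶ Z₁) (f : X₂ ⟶ Z₂) :
    map (C := C) h (r • f) = r • map h f :=
  T_ext fun A₁ A₂ a₁ a₂ => by
    rw [pair_map, Linear.comp_smul, Linear.comp_smul, pair_map, pair_smul_right]

theorem map_zero_left (h : X₂ ⟶ Z₂) : map (C := C) (0 : X₁ ⟶ Z₁) h = 0 := by
  rw [← zero_smul ℂ (0 : X₁ ⟶ Z₁), map_smul_left, zero_smul]

theorem map_zero_right (h : X₁ ⟶ Z₁) : map (C := C) h (0 : X₂ ⟶ Z₂) = 0 := by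
  rw [← zero_smul ℂ (0 : X₂ ⟶ Z₂), map_smul_right, zero_smul]

theorem twist_naturality (hX : Ind C X) (hY : Ind C Y) (f : X ⟶ Y) :
    f ≫ (twistIso C hY).hom = (twistIso C hX).hom ≫ f :=
  ind_ext hX fun A a => by
    rw [← Category.assoc, comp_twist hY (a ≫ f), ← Category.assoc, ← Category.assoc, comp_twist]

theorem twist_T (h₁ : Ind C X₁) (h₂ : Ind C X₂) :
    (twistIso C (ind_T C X₁ X₂)).hom
      = map (twistIso C h₁).hom (twistIso C h₂).hom ≫ braid C X₁ X₂ ≫ braid C X₂ X₁ :=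
  T_ext fun A₁ A₂ a₁ a₂ => by
    rw [comp_twist, pair_map_assoc, comp_twist, comp_twist, pair_comp, Category.assoc,
      pair_braid_assoc, pair_braid]
    simpa only [ObjectProperty.FullSubcategory.comp_hom, Category.assoc] using
      congrArg (fun k => k.hom ≫ pair a₁ a₂) (BraidedTensorCategoryWithTwist.balancing A₁ A₂)

theorem twist_unit (h : Ind C (𝟙_ C.FullSubcategory).obj) :
    (twistIso C h).hom = 𝟙 _ := by
  have := comp_twist h (𝟙 (𝟙_ C.FullSubcategory).obj)
  rw [θ, BraidedTensorCategoryWithTwist.twist_unit] at this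
  simpa using this

end

variable (C) in
/-- The monoidal category structure on `Ind(C)`. -/
@[reducible]
def indMonoidal : MonoidalCategory (Ind C).FullSubcategory where
  toMonoidalCategoryStruct := indMonoidalStruct C
  tensorHom_def f g := ObjectProperty.hom_ext _ <| by
    change map f.hom g.hom = map f.hom (𝟙 _) ≫ map (𝟙 _) g.hom
    rw [map_comp_map, Category.id_comp, Category.comp_id]
  id_tensorHom_id X Y := ObjectProperty.hom_ext _ (map_id_id _ _)
  tensorHom_comp_tensorHom f₁ f₂ g₁ g₂ :=
    ObjectProperty.hom_ext _ (map_comp_map f₁.hom f₂.hom g₁.hom g₂.hom)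
  whiskerLeft_id X Y := ObjectProperty.hom_ext _ (map_id_id _ _)
  id_whiskerRight X Y := ObjectProperty.hom_ext _ (map_id_id _ _)
  associator_naturality f₁ f₂ f₃ :=
    ObjectProperty.hom_ext _ (map_assoc_naturality f₁.hom f₂.hom f₃.hom)
  leftUnitor_naturality f := ObjectProperty.hom_ext _ (leftHom_naturality f.hom)
  rightUnitor_naturality f := ObjectProperty.hom_ext _ (rightHom_naturality f.hom)
  pentagon W X Y Z := ObjectProperty.hom_ext _ (pentagon W.obj X.obj Y.obj Z.obj)
  triangle X Y := ObjectProperty.hom_ext _ (triangle X.obj Y.obj)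

variable (C) in
/-- The braiding on `Ind(C)`. -/
@[reducible]
def indBraided : @BraidedCategory (Ind C).FullSubcategory _ (indMonoidal C) :=
  letI := indMonoidal C
  { braiding := fun X Y => (Ind C).isoMk (braidIso C X.obj Y.obj)
    braiding_naturality_right := fun X _ _ f =>
      ObjectProperty.hom_ext _ (braid_naturality (𝟙 X.obj) f.hom)
    braiding_naturality_left := fun f Z =>
      ObjectProperty.hom_ext _ (braid_naturality f.hom (𝟙 Z.obj))
    hexagon_forward := fun X Y Z => ObjectProperty.hom_ext _ (hexagon_forward X.obj Y.obj Z.obj)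
    hexagon_reverse := fun X Y Z => ObjectProperty.hom_ext _ (hexagon_reverse X.obj Y.obj Z.obj) }

variable (C) in
/-- The braided tensor category structure with twist on `Ind(C)`, with `T` as tensor product. -/
@[reducible]
def indBraidedTensor : BraidedTensorCategoryWithTwist (Ind C) :=
  letI := indMonoidal C
  letI := indBraided C
  have hp : MonoidalPreadditive (Ind C).FullSubcategory :=
    { whiskerLeft_zero := ObjectProperty.hom_ext _ (map_zero_right _)
      zero_whiskerRight := ObjectProperty.hom_ext _ (map_zero_left _)
      whiskerLeft_add := fun f g => ObjectProperty.hom_ext _ (map_add_right _ f.hom g.hom)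
      add_whiskerRight := fun f g => ObjectProperty.hom_ext _ (map_add_left f.hom g.hom _) }
  have hl : MonoidalLinear ℂ (Ind C).FullSubcategory :=
    { whiskerLeft_smul := fun _ _ _ r f => ObjectProperty.hom_ext _ (map_smul_right r _ f.hom)
      smul_whiskerRight := fun r _ _ f _ => ObjectProperty.hom_ext _ (map_smul_left r f.hom _) }
  { toMonoidalPreadditive := hp
    toMonoidalLinear := hl
    self_mem := IsFiniteAbelian.ind_of_mem (BraidedTensorCategoryWithTwist.self_mem (P := C))
    unit_eq := by
      have h := congrArg ObjectProperty.FullSubcategory.obj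
        (BraidedTensorCategoryWithTwist.unit_eq (P := C))
      exact ObjectProperty.FullSubcategory.ext h
    twist := NatIso.ofComponents (fun X => (Ind C).isoMk (twistIso C X.2))
      fun {X Y} f => ObjectProperty.hom_ext _ (twist_naturality X.2 Y.2 f.hom)
    twist_unit := ObjectProperty.hom_ext _
      (twist_unit (IsFiniteAbelian.ind_of_mem (𝟙_ C.FullSubcategory).2))
    balancing := fun X Y => ObjectProperty.hom_ext _ (twist_T X.2 Y.2) }

variable (C) in
/-- The structure on `Ind(C)` with `T` as tensor product is a direct limit extension. -/
def indExtension : @DirectLimitExtension V _ _ _ C _ (indBraidedTensor C) :=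
  letI := indBraidedTensor C
  { φ := fun X₁ X₂ =>
      { app := fun W => tensorι W.1 W.2
        naturality := fun W U f =>
          (tensorι_naturality _ _ rfl rfl).trans (Category.comp_id _).symm }
    isColimit := fun X₁ X₂ => ⟨
      { desc := fun s => colimDesc (pairSystem C X₁.obj X₂.obj ⋙ C.ι) (fun p => s.ι.app (p.1, p.2))
          fun {p q} h => s.w (j := (q.1, q.2)) (j' := (p.1, p.2))
            (Prod.mkHom (homOfLE (leOfHom h).1) (homOfLE (leOfHom h).2))
        fac := fun s W => colimι_desc (pairSystem C X₁.obj X₂.obj ⋙ C.ι) _ _ (W.1, W.2)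
        uniq := fun s m hm => colim_hom_ext fun p => (hm (p.1, p.2)).trans
          (colimι_desc (pairSystem C X₁.obj X₂.obj ⋙ C.ι) _ _ p).symm }⟩
    tensorHom := fun F₁ F₂ W₁ W₂ U₁ U₂ g₁ g₂ h₁ h₂ => by
      change tensorι W₁ W₂ ≫ map F₁.hom F₂.hom = (g₁ ⊗ₘ g₂).hom ≫ tensorι U₁ U₂
      rw [tensorι_eq_pair, pair_map, tensorι_eq_pair, ← pair_comp, h₁, h₂]
    leftUnitor := fun X U W => by
      change tensorι U W ≫ leftHom C X.obj = _
      rw [tensorι_eq_pair, pair_leftHom]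
      have h : U.incl ≫ ofUnit (Ind C) ≫ toUnit C = U.incl := by
        simp [ofUnit, toUnit]
      rw [h]
    rightUnitor := fun X U W => by
      change tensorι W U ≫ rightHom C X.obj = _
      rw [tensorι_eq_pair, pair_rightHom]
      have h : U.incl ≫ ofUnit (Ind C) ≫ toUnit C = U.incl := by
        simp [ofUnit, toUnit]
      rw [h]
    associator := fun X₁ X₂ X₃ W₁ W₂ W₃ W₁₂ W₂₃ g₁₂ g₂₃ h₁₂ h₂₃ => by
      change (W₁.toC ◁ g₂₃).hom ≫ tensorι W₁ W₂₃ ≫ assocInv C X₁.obj X₂.obj X₃.obj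
        = (α_ W₁.toC W₂.toC W₃.toC).inv.hom ≫ (g₁₂ ▷ W₃.toC).hom ≫ tensorι W₁₂ W₃
      rw [tensorι_eq_pair W₁₂ W₃, ← pair_comp_left, h₁₂, tensorι_eq_pair, ← Category.assoc,
        ← pair_comp_right, h₂₃]
      change pair _ (tensorι _ _) ≫ _ = _ ≫ pair (tensorι _ _) _
      rw [tensorι_eq_pair, tensorι_eq_pair, pair_assocInv]
    braiding := fun X₁ X₂ W₁ W₂ => by
      change tensorι W₁ W₂ ≫ braid C X₁.obj X₂.obj = _ ≫ tensorι W₂ W₁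
      rw [tensorι_eq_pair, tensorι_eq_pair, pair_braid]
    twist := fun X W => comp_twist X.2 W.incl }

end IndTensor

/-! ### Restriction and corestriction of intertwining operators -/

namespace IntertwiningOperator

variable {W₁ W₂ W₃ A₁ A₂ Y : WeakModule V}

/-- The three sums of the Jacobi identity are finite, so they are preserved by linear maps. -/
theorem map_jacobi (I : IntertwiningOperator W₁ W₂ W₃) {M : Type*} [AddCommGroup M] [Module ℂ M]
    (f : W₃ →ₗ[ℂ] M) (v : V) (w₁ : W₁) (w₂ : W₂) (l m : ℤ) (h : ℂ) (k : ℕ) :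
    (∑ᶠ i : ℕ, ((-1 : ℂ) ^ i * bin l i) •
        f (W₃.mode v (l + m - i) (I.coeff w₁ w₂ (h + i) k)))
      - (-1 : ℂ) ^ l •
        ∑ᶠ i : ℕ, ((-1 : ℂ) ^ i * bin l i) • f (I.coeff w₁ (W₂.mode v (m + i) w₂) (h + l - i) k)
      = ∑ᶠ i : ℕ, bin m i • f (I.coeff (W₁.mode v (l + i) w₁) w₂ (h + m - i) k) := by
  have J := congrArg f (I.jacobi v w₁ w₂ l m h k)
  rw [map_sub, map_smul, map_finsum_of_eventually_zero, map_finsum_of_eventually_zero,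
    map_finsum_of_eventually_zero] at J
  · simpa only [map_smul] using J
  · obtain ⟨N, hN⟩ := exists_mode_eq_zero W₁ v w₁ l
    exact ⟨N, fun i hi => by simp [hN i hi]⟩
  · obtain ⟨N, hN⟩ := exists_mode_eq_zero W₂ v w₂ m
    exact ⟨N, fun i hi => by simp [hN i hi]⟩
  · obtain ⟨N, hN⟩ := I.lower_truncation w₁ w₂ h
    exact ⟨N, fun i hi => by simp [hN i hi k]⟩

/-- The composite `f ∘ 𝒴`. -/
def comp (I : IntertwiningOperator W₁ W₂ W₃) (f : W₃ ⟶ Y) : IntertwiningOperator W₁ W₂ Y where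
  coeff := LinearMap.mk₂ ℂ (fun w₁ w₂ h k => lin f (I.coeff w₁ w₂ h k))
    (fun _ _ _ => by funext h k; simp) (fun _ _ _ => by funext h k; simp)
    (fun _ _ _ => by funext h k; simp) (fun _ _ _ => by funext h k; simp)
  polynomial_in_log w₁ w₂ h := (I.polynomial_in_log w₁ w₂ h).subset fun k hk hk' =>
    hk (by simp [hk'])
  lower_truncation w₁ w₂ h := by
    obtain ⟨N, hN⟩ := I.lower_truncation w₁ w₂ h
    exact ⟨N, fun n hn k => by simp [hN n hn k]⟩
  jacobi v w₁ w₂ l m h k := by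
    simpa only [LinearMap.mk₂_apply, lin_mode] using I.map_jacobi (lin f) v w₁ w₂ l m h k
  derivative w₁ w₂ h k := by simp [I.derivative]

theorem comp_series (I : IntertwiningOperator W₁ W₂ W₃) (f : W₃ ⟶ Y) (w₁ : W₁) (w₂ : W₂) (h : ℂ)
    (k : ℕ) : (I.comp f).series w₁ w₂ h k = lin f (I.series w₁ w₂ h k) := rfl

/-- The restriction of an intertwining operator along homomorphisms to its arguments. -/
def precomp (I : IntertwiningOperator W₁ W₂ W₃) (f₁ : A₁ ⟶ W₁) (f₂ : A₂ ⟶ W₂) :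
    IntertwiningOperator A₁ A₂ W₃ where
  coeff := I.coeff.compl₁₂ (lin f₁) (lin f₂)
  polynomial_in_log _ _ := I.polynomial_in_log _ _
  lower_truncation _ _ := I.lower_truncation _ _
  jacobi v w₁ w₂ l m h k := by
    simpa only [LinearMap.compl₁₂_apply, lin_mode] using
      I.jacobi v (lin f₁ w₁) (lin f₂ w₂) l m h k
  derivative w₁ w₂ h k := by
    simpa only [LinearMap.compl₁₂_apply, lin_L] using I.derivative (lin f₁ w₁) (lin f₂ w₂) h k

theorem series_mem_im (I : IntertwiningOperator W₁ W₂ W₃) (w₁ : W₁) (w₂ : W₂) (h : ℂ) (k : ℕ) :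
    I.series w₁ w₂ h k ∈ I.im.toSubmodule :=
  Submodule.subset_span ⟨w₁, w₂, h, k, rfl⟩

/-- The corestriction of an intertwining operator to its image. -/
def toIm (I : IntertwiningOperator W₁ W₂ W₃) :
    IntertwiningOperator W₁ W₂ I.im.toWeakModule where
  coeff := LinearMap.mk₂ ℂ (fun w₁ w₂ h k => I.im.elt (I.coeff w₁ w₂ h k) (I.series_mem_im _ _ _ _))
    (fun _ _ _ => by funext h k; exact Subtype.ext (by simp [Sub.elt]; rfl))
    (fun _ _ _ => by funext h k; exact Subtype.ext (by simp [Sub.elt]; rfl))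
    (fun _ _ _ => by funext h k; exact Subtype.ext (by simp [Sub.elt]; rfl))
    (fun _ _ _ => by funext h k; exact Subtype.ext (by simp [Sub.elt]; rfl))
  polynomial_in_log w₁ w₂ h := (I.polynomial_in_log w₁ w₂ h).subset fun k hk hk' =>
    hk (Subtype.ext hk')
  lower_truncation w₁ w₂ h := by
    obtain ⟨N, hN⟩ := I.lower_truncation w₁ w₂ h
    exact ⟨N, fun n hn k => Subtype.ext (hN n hn k)⟩
  jacobi v w₁ w₂ l m h k := by
    apply I.im.incl_injective
    have key (f : ℕ → I.im.toWeakModule) : lin I.im.incl (∑ᶠ i, f i) = ∑ᶠ i, lin I.im.incl (f i) :=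
      Sub.coe_finsum I.im.toSubmodule f
    rw [map_sub, map_smul, key, key, key]
    simp only [map_smul, lin_mode]
    exact I.jacobi v w₁ w₂ l m h k
  derivative w₁ w₂ h k := by
    apply I.im.incl_injective
    rw [map_add, map_smul, map_smul]
    exact I.derivative w₁ w₂ h k

/-! ### Weights of the coefficients of an intertwining operator -/

/-- The commutator formula for `L(0)` and the derivative property give
`(L(0) - (h₁ + h₂ - h - 1)) (w₁)_{h,k} w₂ = ((L(0) - h₁) w₁)_{h,k} w₂ + (w₁)_{h,k} (L(0) - h₂) w₂
+ (k + 1) (w₁)_{h,k+1} w₂`. -/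
theorem L_zero_coeff (I : IntertwiningOperator W₁ W₂ W₃) (w₁ : W₁) (w₂ : W₂) (h₁ h₂ h : ℂ)
    (k : ℕ) : (W₃.L 0 - (h₁ + h₂ - h - 1) • (1 : Module.End ℂ W₃)) (I.coeff w₁ w₂ h k)
      = I.coeff ((W₁.L 0 - h₁ • (1 : Module.End ℂ W₁)) w₁) w₂ h k
        + I.coeff w₁ ((W₂.L 0 - h₂ • (1 : Module.End ℂ W₂)) w₂) h k
        + ((k : ℂ) + 1) • I.coeff w₁ w₂ h (k + 1) := by
  have J := I.jacobi (VertexOperatorAlgebra.ω : V) w₁ w₂ 0 1 h k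
  have b0 : ∀ i : ℕ, i ≠ 0 → bin 0 i = 0 := fun i hi => by
    simp [bin, Ring.choose_zero_pos _ (Nat.pos_of_ne_zero hi)]
  have b1 : ∀ i : ℕ, 2 ≤ i → bin 1 i = 0 := fun i hi => by
    have h := Ring.choose_natCast (R := ℤ) 1 i
    rw [Nat.choose_eq_zero_of_lt hi] at h
    simp only [Nat.cast_one, Nat.cast_zero] at h
    simp [bin, h]
  have e0 : bin 0 0 = 1 := by simp [bin]
  have e1 : bin 1 0 = 1 := by simp [bin]
  have e2 : bin 1 1 = 1 := by simp [bin]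
  rw [finsum_eq_single _ 0 (fun i hi => by simp [b0 i hi]),
    finsum_eq_single _ 0 (fun i hi => by simp [b0 i hi]),
    finsum_eq_sum_of_support_subset (s := Finset.range 2) _ (fun i hi => by
      by_contra hi'
      refine hi ?_
      have : 2 ≤ i := not_lt.1 fun hlt => hi' (Finset.mem_coe.2 (Finset.mem_range.2 hlt))
      simp [b1 i this]), Finset.sum_range_succ, Finset.sum_range_one, e0, e1, e2] at J
  have D := I.derivative w₁ w₂ (h + 1) k
  simp only [L] at D ⊢
  simp only [pow_zero, zpow_zero, Nat.cast_zero, Nat.cast_one, Int.cast_zero, Int.cast_one, mul_one,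
    one_smul, add_zero, zero_add, sub_zero, add_sub_cancel_right, neg_add_cancel] at J D ⊢
  rw [D, sub_eq_iff_eq_add] at J
  simp only [LinearMap.sub_apply, LinearMap.smul_apply, Module.End.one_apply, map_sub, map_smul,
    Pi.sub_apply, Pi.smul_apply, J]
  module

/-- The coefficients of an intertwining operator are homogeneous, as in the nonlogarithmic case:
by `L_zero_coeff`, the nilpotent part of `L(0)` on the target is controlled by those on the two
arguments and by the power of `log x`, which is bounded. -/
theorem coeff_mem_wt (I : IntertwiningOperator W₁ W₂ W₃) {h₁ h₂ : ℂ} {w₁ : W₁} {w₂ : W₂}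
    (hw₁ : w₁ ∈ W₁.wt h₁) (hw₂ : w₂ ∈ W₂.wt h₂) (h : ℂ) (k : ℕ) :
    I.coeff w₁ w₂ h k ∈ W₃.wt (h₁ + h₂ - h - 1) := by
  rw [wt, Module.End.mem_maxGenEigenspace] at hw₁ hw₂
  obtain ⟨a, ha⟩ := hw₁
  obtain ⟨b, hb⟩ := hw₂
  have step : ∀ x : W₃, (W₃.L 0 - (h₁ + h₂ - h - 1) • (1 : Module.End ℂ W₃)) x
      ∈ W₃.wt (h₁ + h₂ - h - 1) → x ∈ W₃.wt (h₁ + h₂ - h - 1) := by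
    intro x hx
    rw [wt, Module.End.mem_maxGenEigenspace] at hx ⊢
    obtain ⟨m, hm⟩ := hx
    exact ⟨m + 1, by rw [pow_succ, Module.End.mul_apply, hm]⟩
  -- Induction on the nilpotency orders of `w₁` and `w₂`, then downward induction on `k`: each of
  -- the three terms of `L_zero_coeff` is covered by one of the induction hypotheses.
  induction a generalizing w₁ w₂ b k with
  | zero =>
    have : w₁ = 0 := by simpa using ha
    simp [this]
  | succ a iha =>
    induction b generalizing w₂ k with
    | zero =>
      have : w₂ = 0 := by simpa using hb
      simp [this]
    | succ b ihb =>
      obtain ⟨M, hM⟩ := (I.polynomial_in_log w₁ w₂ h).bddAbove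
      have key : ∀ n k, M < k + n → I.coeff w₁ w₂ h k ∈ W₃.wt (h₁ + h₂ - h - 1) := by
        intro n
        induction n with
        | zero =>
          intro k hk
          by_cases h0 : I.coeff w₁ w₂ h k = 0
          · rw [h0]
            exact Submodule.zero_mem _
          · exact absurd (hM h0) (not_le.2 hk)
        | succ n ihn =>
          intro k hk
          refine step _ ?_
          rw [L_zero_coeff]
          refine Submodule.add_mem _ (Submodule.add_mem _ ?_ ?_) (Submodule.smul_mem _ _ ?_)
          · exact iha k (by rwa [pow_succ, Module.End.mul_apply] at ha) (b + 1) hb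
          · exact ihb k (by rwa [pow_succ, Module.End.mul_apply] at hb)
          · exact ihn (k + 1) (by omega)
      exact key (M + 1) k (by omega)

end IntertwiningOperator

/-! ### Evaluation of logarithmic series -/

namespace WeakModule

variable {X Y : WeakModule V}

theorem proj_of_mem (hX : X.IsGeneralized) {h : ℂ} {x : X} (hx : x ∈ X.wt h) (h' : ℂ) :
    (X.proj h' x : X) = if h = h' then x else 0 := by
  classical
  rw [proj, dif_pos hX]
  have e : (LinearEquiv.ofBijective (DirectSum.coeLinearMap X.wt) hX).symm x
      = DirectSum.lof ℂ ℂ (fun h => X.wt h) h ⟨x, hx⟩ := by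
    rw [LinearEquiv.symm_apply_eq]
    exact (DirectSum.coeLinearMap_lof X.wt h ⟨x, hx⟩).symm
  rw [LinearMap.comp_apply, LinearEquiv.coe_coe, e]
  by_cases hh : h = h'
  · subst hh
    rw [if_pos rfl, DirectSum.component.lof_self]
  · rw [if_neg hh, DirectSum.component.of, dif_neg hh]
    rfl

theorem wt_induction (hX : X.IsGeneralized) {p : X → Prop} (h0 : p 0)
    (hadd : ∀ x y, p x → p y → p (x + y)) (hwt : ∀ h, ∀ x ∈ X.wt h, p x) (x : X) : p x := by
  have hx : x ∈ ⨆ h, X.wt h := by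
    rw [hX.submodule_iSup_eq_top]
    trivial
  exact Submodule.iSup_induction X.wt (motive := p) hx hwt h0 hadd

theorem proj_naturality (hX : X.IsGeneralized) (hY : Y.IsGeneralized) (f : X ⟶ Y) (h : ℂ) (x : X) :
    lin f (X.proj h x) = Y.proj h (lin f x) := by
  induction x using wt_induction hX with
  | h0 => simp
  | hadd x y hx hy => simp only [map_add, Submodule.coe_add, hx, hy]
  | hwt h' x hx =>
    rw [proj_of_mem hX hx, proj_of_mem hY (map_wt f h' x hx)]
    split_ifs <;> simp

/-- The pairing with `y'`, composed with `f`, is the pairing with the transpose of `f` at `y'`. -/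
theorem exists_pairing_completionMap (f : X ⟶ Y) (y' : Y.GradedDual) :
    ∃ x' : X.GradedDual, ∀ x, pairing y' (completionMap f x) = pairing x' x := by
  classical
  induction y' using DirectSum.induction_on with
  | zero => exact ⟨0, fun x => by simp [pairing]⟩
  | add a b ha hb =>
    obtain ⟨a', ha⟩ := ha
    obtain ⟨b', hb⟩ := hb
    exact ⟨a' + b', fun x => by simp only [pairing, map_add] at ha hb ⊢; rw [ha, hb]⟩
  | of h g =>
    refine ⟨DirectSum.lof ℂ ℂ (fun h => Module.Dual ℂ (X.wt h)) h
      (g ∘ₗ (lin f).restrict (map_wt f h)), fun x => ?_⟩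
    rw [← DirectSum.lof_eq_of ℂ]
    simp only [pairing, DirectSum.toModule_lof]
    rfl

/-- Absolute convergence is preserved by the extensions of homomorphisms to completions. -/
theorem ConvergesAbsolutelyTo.map {f : X ⟶ Y} {u : ℂ → X.Completion} {s : X.Completion}
    (hu : ConvergesAbsolutelyTo u s) :
    ConvergesAbsolutelyTo (fun h => completionMap f (u h)) (completionMap f s) := by
  intro y'
  obtain ⟨x', hx'⟩ := exists_pairing_completionMap f y'
  simpa only [hx'] using hu x'

end WeakModule

namespace LogSeries

variable {X Y : WeakModule V}

/-- Substituting `x = e^ℓ` commutes with homomorphisms, provided that the sum over all terms is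
finite in every weight space; `finsum` would be a junk value otherwise. -/
theorem eval_map (hX : X.IsGeneralized) (hY : Y.IsGeneralized) (f : X ⟶ Y) {s : LogSeries X}
    (hs : ∀ n, {p : ℂ × ℕ | X.proj n (s p.1 p.2) ≠ 0}.Finite) {t : LogSeries Y}
    (ht : ∀ h k, lin f (s h k) = t h k) (ℓ : ℂ) :
    completionMap f (s.eval ℓ) = t.eval ℓ := by
  funext n
  let g : X.wt n →ₗ[ℂ] Y.wt n := (lin f).restrict (map_wt f n)
  change g _ = _
  rw [eval, eval]
  refine (g.toAddMonoidHom.map_finsum ((hs n).subset fun p hp hp' => hp ?_)).trans ?_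
  · simp [hp']
  · refine finsum_congr fun p => (g.map_smul _ _).trans ?_
    congr 1
    refine Subtype.ext ?_
    rw [← ht]
    exact proj_naturality hX hY f n _

end LogSeries

namespace IntertwiningOperator

variable {W₁ W₂ W₃ W₄ M A₁ A₂ A₃ A₄ B : WeakModule V}

/-- In each weight space, only finitely many coefficients of `𝒴(w₁, x) w₂` have a nonzero
component. -/
theorem finite_proj_ne_zero (g₁ : W₁.IsGeneralized) (g₂ : W₂.IsGeneralized) (g₃ : W₃.IsGeneralized)
    (I : IntertwiningOperator W₁ W₂ W₃) (w₁ : W₁) (w₂ : W₂) (n : ℂ) :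
    {p : ℂ × ℕ | W₃.proj n (I.series w₁ w₂ p.1 p.2) ≠ 0}.Finite := by
  have hadd : ∀ {s t : LogSeries W₃}, {p : ℂ × ℕ | W₃.proj n (s p.1 p.2) ≠ 0}.Finite →
      {p : ℂ × ℕ | W₃.proj n (t p.1 p.2) ≠ 0}.Finite →
      {p : ℂ × ℕ | W₃.proj n ((s + t) p.1 p.2) ≠ 0}.Finite := by
    intro s t hs ht
    refine (hs.union ht).subset fun p hp => ?_
    by_contra hp'
    simp only [Set.mem_union, Set.mem_ofPred_eq, not_or, not_not] at hp'
    exact hp (by simp [hp'.1, hp'.2])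
  simp only [series]
  induction w₁ using wt_induction g₁ with
  | h0 => simp
  | hadd x y hx hy =>
    rw [map_add, LinearMap.add_apply]
    exact hadd hx hy
  | hwt h₁ w₁ hw₁ =>
    induction w₂ using wt_induction g₂ with
    | h0 => simp
    | hadd x y hx hy =>
      rw [map_add]
      exact hadd hx hy
    | hwt h₂ w₂ hw₂ =>
      refine ((Set.finite_singleton (h₁ + h₂ - 1 - n)).prod
        (I.polynomial_in_log w₁ w₂ (h₁ + h₂ - 1 - n))).subset ?_
      rintro ⟨h, k⟩ hp
      have e := proj_of_mem g₃ (I.coeff_mem_wt hw₁ hw₂ h k) n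
      have hn : h₁ + h₂ - h - 1 = n := by
        by_contra hn
        rw [if_neg hn] at e
        exact hp (Subtype.ext e)
      have hh : h = h₁ + h₂ - 1 - n := by rw [← hn]; ring
      subst hh
      refine ⟨rfl, fun h0 => hp ?_⟩
      change W₃.proj n (I.coeff w₁ w₂ _ k) = 0
      rw [h0, map_zero]

theorem completionMap_eval (g₁ : A₁.IsGeneralized) (g₂ : A₂.IsGeneralized) (g₃ : B.IsGeneralized)
    (g₄ : M.IsGeneralized) (I : IntertwiningOperator A₁ A₂ B) (f : B ⟶ M) (x : A₁) (y : A₂)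
    {t : LogSeries M} (ht : ∀ h k, lin f (I.series x y h k) = t h k) (ℓ : ℂ) :
    completionMap f ((I.series x y).eval ℓ) = t.eval ℓ :=
  LogSeries.eval_map g₃ g₄ f (I.finite_proj_ne_zero g₁ g₂ g₃ x y) ht ℓ

/-- Products of intertwining operators are compatible with homomorphisms of all of the modules. -/
theorem completionMap_productTerm (gA₁ : A₁.IsGeneralized) (gA₂ : A₂.IsGeneralized)
    (gA₃ : A₃.IsGeneralized) (gA₄ : A₄.IsGeneralized) (gB : B.IsGeneralized)
    (gM : M.IsGeneralized) (gW₄ : W₄.IsGeneralized)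
    {I₁ : IntertwiningOperator W₁ M W₄} {I₂ : IntertwiningOperator W₂ W₃ M}
    {J₁ : IntertwiningOperator A₁ B A₄} {J₂ : IntertwiningOperator A₂ A₃ B}
    {f₁ : A₁ ⟶ W₁} {f₂ : A₂ ⟶ W₂} {f₃ : A₃ ⟶ W₃} {f₄ : A₄ ⟶ W₄} {b : B ⟶ M}
    (h₁ : ∀ x y h k, lin f₄ (J₁.series x y h k) = I₁.series (lin f₁ x) (lin b y) h k)
    (h₂ : ∀ x y h k, lin b (J₂.series x y h k) = I₂.series (lin f₂ x) (lin f₃ y) h k)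
    (x₁ : A₁) (x₂ : A₂) (x₃ : A₃) (ℓ₁ ℓ₂ h : ℂ) :
    completionMap f₄ (productTerm J₁ J₂ x₁ x₂ x₃ ℓ₁ ℓ₂ h)
      = productTerm I₁ I₂ (lin f₁ x₁) (lin f₂ x₂) (lin f₃ x₃) ℓ₁ ℓ₂ h := by
  have e := congrArg Subtype.val (congrFun
    (completionMap_eval gA₂ gA₃ gB gM J₂ b x₂ x₃ (h₂ x₂ x₃) ℓ₂) h)
  rw [productTerm, productTerm, ← e]
  exact completionMap_eval gA₁ gB gA₄ gW₄ J₁ f₄ _ _ (h₁ _ _) ℓ₁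

/-- Iterates of intertwining operators are compatible with homomorphisms of all of the modules. -/
theorem completionMap_iterateTerm (gA₁ : A₁.IsGeneralized) (gA₂ : A₂.IsGeneralized)
    (gA₃ : A₃.IsGeneralized) (gA₄ : A₄.IsGeneralized) (gB : B.IsGeneralized)
    (gM : M.IsGeneralized) (gW₄ : W₄.IsGeneralized)
    {I₁ : IntertwiningOperator M W₃ W₄} {I₂ : IntertwiningOperator W₁ W₂ M}
    {J₁ : IntertwiningOperator B A₃ A₄} {J₂ : IntertwiningOperator A₁ A₂ B}
    {f₁ : A₁ ⟶ W₁} {f₂ : A₂ ⟶ W₂} {f₃ : A₃ ⟶ W₃} {f₄ : A₄ ⟶ W₄} {b : B ⟶ M}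
    (h₁ : ∀ x y h k, lin f₄ (J₁.series x y h k) = I₁.series (lin b x) (lin f₃ y) h k)
    (h₂ : ∀ x y h k, lin b (J₂.series x y h k) = I₂.series (lin f₁ x) (lin f₂ y) h k)
    (x₁ : A₁) (x₂ : A₂) (x₃ : A₃) (ℓ₀ ℓ₂ h : ℂ) :
    completionMap f₄ (iterateTerm J₁ J₂ x₁ x₂ x₃ ℓ₀ ℓ₂ h)
      = iterateTerm I₁ I₂ (lin f₁ x₁) (lin f₂ x₂) (lin f₃ x₃) ℓ₀ ℓ₂ h := by
  have e := congrArg Subtype.val (congrFun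
    (completionMap_eval gA₁ gA₂ gB gM J₂ b x₁ x₂ (h₂ x₁ x₂) ℓ₀) h)
  rw [iterateTerm, iterateTerm, ← e]
  exact completionMap_eval gB gA₃ gA₄ gW₄ J₁ f₄ _ _ (h₁ _ _) ℓ₂

end IntertwiningOperator

/-! ### The operators `e ^ {x L(-1)}` and `x ↦ e ^ {π i} x` on series -/

namespace LogSeries

variable {X Y : WeakModule V}

theorem lin_pow_L (f : X ⟶ Y) (n : ℤ) (j : ℕ) (x : X) :
    lin f ((X.L n ^ j) x) = (Y.L n ^ j) (lin f x) := by
  induction j with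
  | zero => simp
  | succ j ih => rw [pow_succ', pow_succ', Module.End.mul_apply, Module.End.mul_apply, lin_L, ih]

theorem lin_expL (f : X ⟶ Y) {s : LogSeries X} (hs : ∀ h k, ∃ N : ℕ, ∀ n ≥ N, s (h + (n : ℕ)) k = 0)
    {t : LogSeries Y} (ht : ∀ h k, lin f (s h k) = t h k) (h : ℂ) (k : ℕ) :
    lin f (s.expL h k) = t.expL h k := by
  obtain ⟨N, hN⟩ := hs h k
  rw [expL, expL, map_finsum_of_eventually_zero]
  · exact finsum_congr fun j => by rw [map_smul, lin_pow_L, ht]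
  · exact ⟨N, fun n hn => by simp [hN n hn]⟩

theorem lin_rotate (f : X ⟶ Y) {s : LogSeries X} (hs : ∀ h, {k | s h k ≠ 0}.Finite)
    {t : LogSeries Y} (ht : ∀ h k, lin f (s h k) = t h k) (h : ℂ) (k : ℕ) :
    lin f (s.rotate h k) = t.rotate h k := by
  obtain ⟨M, hM⟩ := (hs h).bddAbove
  rw [rotate, rotate, map_smul, map_finsum_of_eventually_zero]
  · simp only [map_smul, ht]
  · refine ⟨M + 1, fun j hj => ?_⟩
    have : s h (k + j) = 0 := by
      by_contra h0
      have : k + j ≤ M := hM h0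
      omega
    rw [this, smul_zero]

theorem rotate_eq_zero {s : LogSeries X} {h : ℂ} (hs : ∀ k, s h k = 0) (k : ℕ) :
    s.rotate h k = 0 := by
  simp [rotate, hs]

theorem lin_ofModes (f : X ⟶ Y) {a : ℤ → X} {b : ℤ → Y} (hab : ∀ n, lin f (a n) = b n) (h : ℂ)
    (k : ℕ) : lin f (ofModes a h k) = ofModes b h k := by
  rw [ofModes, ofModes]
  split_ifs
  · exact hab _
  · exact map_zero _

end LogSeries

/-! ### Gluing intertwining operators -/

section Glue

variable {C : ObjectProperty (WeakModule.{u} V)} (hC : IsFiniteAbelian C) {X₁ X₂ Y : WeakModule V}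
include hC

/-- Compatible intertwining operators on the pairs of `C`-submodules of two objects of `Ind(C)`
glue to an intertwining operator. -/
theorem IsFiniteAbelian.exists_glue (hX₁ : Ind C X₁) (hX₂ : Ind C X₂)
    (F : ∀ (W₁ : CSub C X₁) (W₂ : CSub C X₂), IntertwiningOperator W₁.toC.obj W₂.toC.obj Y)
    (hF : ∀ {W₁ U₁ : CSub C X₁} {W₂ U₂ : CSub C X₂} (h₁ : W₁ ≤ U₁) (h₂ : W₂ ≤ U₂) (w₁ : W₁.toC.obj)
      (w₂ : W₂.toC.obj), (F U₁ U₂).series (lin (Sub.inclOfLE h₁) w₁) (lin (Sub.inclOfLE h₂) w₂)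
        = (F W₁ W₂).series w₁ w₂) :
    ∃ I : IntertwiningOperator X₁ X₂ Y, ∀ (W₁ : CSub C X₁) (W₂ : CSub C X₂) (w₁ : W₁.toC.obj)
      (w₂ : W₂.toC.obj), I.series (lin W₁.incl w₁) (lin W₂.incl w₂) = (F W₁ W₂).series w₁ w₂ := by
  choose A hA using fun x : X₁ => hC.exists_mem_cSub hX₁ x
  choose B hB using fun x : X₂ => hC.exists_mem_cSub hX₂ x
  have d₁ := (hC.isDirectedOrder X₁).directed
  have d₂ := (hC.isDirectedOrder X₂).directed
  -- Evaluate on arbitrary `C`-submodules containing the two vectors; by directedness the choice is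
  -- immaterial, and finitely many vectors can be moved to the same submodules.
  let c (x : X₁) (y : X₂) : LogSeries Y :=
    (F (A x) (B y)).series ((A x).1.elt x (hA x)) ((B y).1.elt y (hB y))
  have key : ∀ (W₁ : CSub C X₁) (W₂ : CSub C X₂) (w₁ : W₁.toC.obj) (w₂ : W₂.toC.obj),
      c (lin W₁.incl w₁) (lin W₂.incl w₂) = (F W₁ W₂).series w₁ w₂ := by
    intro W₁ W₂ w₁ w₂
    obtain ⟨U₁, h₁, k₁⟩ := d₁ (A (lin W₁.incl w₁)) W₁
    obtain ⟨U₂, h₂, k₂⟩ := d₂ (B (lin W₂.incl w₂)) W₂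
    exact (hF h₁ h₂ _ _).symm.trans (hF k₁ k₂ _ _)
  have lift₁ : ∀ x x' : X₁, ∃ (W : CSub C X₁) (w w' : W.toC.obj),
      lin W.incl w = x ∧ lin W.incl w' = x' := fun x x' => by
    obtain ⟨U, h, k⟩ := d₁ (A x) (A x')
    exact ⟨U, U.1.elt x (h (hA x)), U.1.elt x' (k (hA x')), rfl, rfl⟩
  have lift₂ : ∀ x x' : X₂, ∃ (W : CSub C X₂) (w w' : W.toC.obj),
      lin W.incl w = x ∧ lin W.incl w' = x' := fun x x' => by
    obtain ⟨U, h, k⟩ := d₂ (B x) (B x')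
    exact ⟨U, U.1.elt x (h (hB x)), U.1.elt x' (k (hB x')), rfl, rfl⟩
  have add₁ : ∀ x x' y, c (x + x') y = c x y + c x' y := by
    intro x x' y
    obtain ⟨W, w, w', rfl, rfl⟩ := lift₁ x x'
    obtain ⟨U, z, -, rfl, -⟩ := lift₂ y y
    rw [← map_add, key, key, key, IntertwiningOperator.series, map_add]
    rfl
  have smul₁ : ∀ (r : ℂ) x y, c (r • x) y = r • c x y := by
    intro r x y
    obtain ⟨W, w, -, rfl, -⟩ := lift₁ x x
    obtain ⟨U, z, -, rfl, -⟩ := lift₂ y y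
    rw [← map_smul, key, key, IntertwiningOperator.series, map_smul]
    rfl
  have add₂ : ∀ x y y', c x (y + y') = c x y + c x y' := by
    intro x y y'
    obtain ⟨W, w, -, rfl, -⟩ := lift₁ x x
    obtain ⟨U, z, z', rfl, rfl⟩ := lift₂ y y'
    rw [← map_add, key, key, key, IntertwiningOperator.series, map_add]
    rfl
  have smul₂ : ∀ (r : ℂ) x y, c x (r • y) = r • c x y := by
    intro r x y
    obtain ⟨W, w, -, rfl, -⟩ := lift₁ x x
    obtain ⟨U, z, -, rfl, -⟩ := lift₂ y y
    rw [← map_smul, key, key, IntertwiningOperator.series, map_smul]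
    rfl
  refine ⟨
    { coeff := LinearMap.mk₂ ℂ c add₁ smul₁ add₂ smul₂
      polynomial_in_log := fun x y h => (F (A x) (B y)).polynomial_in_log _ _ h
      lower_truncation := fun x y h => (F (A x) (B y)).lower_truncation _ _ h
      jacobi := fun v x y l m h k => ?_
      derivative := fun x y h k => ?_ }, key⟩
  · obtain ⟨W, w, -, rfl, -⟩ := lift₁ x x
    obtain ⟨U, z, -, rfl, -⟩ := lift₂ y y
    simp only [LinearMap.mk₂_apply, ← lin_mode, key]
    exact (F W U).jacobi v w z l m h k
  · obtain ⟨W, w, -, rfl, -⟩ := lift₁ x x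
    obtain ⟨U, z, -, rfl, -⟩ := lift₂ y y
    simp only [LinearMap.mk₂_apply, ← lin_L, key]
    exact (F W U).derivative w z h k

end Glue

theorem LogSeries.ofModes_truncated {X : WeakModule V} {a : ℤ → X} (ha : ∃ N : ℤ, ∀ n ≥ N, a n = 0)
    (h : ℂ) (k : ℕ) : ∃ N : ℕ, ∀ n ≥ N, LogSeries.ofModes a (h + (n : ℕ)) k = 0 := by
  obtain ⟨N, hN⟩ := ha
  by_cases hh : k = 0 ∧ ∃ m : ℤ, (m : ℂ) = h
  · obtain ⟨rfl, m, rfl⟩ := hh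
    refine ⟨(N - m).toNat, fun n hn => ?_⟩
    have e : (m : ℂ) + (n : ℕ) = ((m + n : ℤ) : ℂ) := by push_cast; rfl
    rw [e, LogSeries.ofModes_intCast]
    exact hN _ (by omega)
  · refine ⟨0, fun n _ => dif_neg ?_⟩
    rintro ⟨rfl, m, hm⟩
    exact hh ⟨rfl, m - n, by push_cast; rw [hm]; ring⟩

theorem toUnit_ofUnit (P : ObjectProperty (WeakModule V)) [BraidedTensorCategoryWithTwist P] :
    toUnit P ≫ ofUnit P = 𝟙 _ := by
  simp [toUnit, ofUnit]

namespace WeakModule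

theorem lin_pow_L_zero_sub {X Y : WeakModule V} (f : X ⟶ Y) (h : ℂ) (j : ℕ) (x : X) :
    lin f (((X.L 0 - h • (1 : Module.End ℂ X)) ^ j) x)
      = ((Y.L 0 - h • (1 : Module.End ℂ Y)) ^ j) (lin f x) := by
  induction j with
  | zero => simp
  | succ j ih =>
    rw [pow_succ', pow_succ', Module.End.mul_apply, Module.End.mul_apply, ← ih]
    simp [lin_L]

end WeakModule

namespace VertexTensorStructure

variable {C : ObjectProperty (WeakModule.{u} V)} [BraidedTensorCategoryWithTwist C]
  (hC : IsFiniteAbelian C) (T : VertexTensorStructure C)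

theorem tensorHom_series {X₁ X₂ Z₁ Z₂ : C.FullSubcategory} (F₁ : X₁ ⟶ Z₁) (F₂ : X₂ ⟶ Z₂)
    (b₁ : X₁.obj) (b₂ : X₂.obj) (h : ℂ) (k : ℕ) :
    lin (F₁ ⊗ₘ F₂).hom ((T.𝒴 X₁ X₂).series b₁ b₂ h k)
      = (T.𝒴 Z₁ Z₂).series (lin F₁.hom b₁) (lin F₂.hom b₂) h k :=
  (T.tensorHom_iff F₁ F₂ _).1 rfl b₁ b₂ h k

theorem whiskerLeft_series (X₁ : C.FullSubcategory) {X₂ Z₂ : C.FullSubcategory} (F₂ : X₂ ⟶ Z₂)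
    (b₁ : X₁.obj) (b₂ : X₂.obj) (h : ℂ) (k : ℕ) :
    lin (X₁ ◁ F₂).hom ((T.𝒴 X₁ X₂).series b₁ b₂ h k)
      = (T.𝒴 X₁ Z₂).series b₁ (lin F₂.hom b₂) h k := by
  rw [← id_tensorHom, tensorHom_series]
  rfl

theorem whiskerRight_series {X₁ Z₁ : C.FullSubcategory} (F₁ : X₁ ⟶ Z₁) (X₂ : C.FullSubcategory)
    (b₁ : X₁.obj) (b₂ : X₂.obj) (h : ℂ) (k : ℕ) :
    lin (F₁ ▷ X₂).hom ((T.𝒴 X₁ X₂).series b₁ b₂ h k)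
      = (T.𝒴 Z₁ X₂).series (lin F₁.hom b₁) b₂ h k := by
  rw [← tensorHom_id, tensorHom_series]
  rfl

include hC in
/-- The uniqueness in the universal property, for an arbitrary target. -/
theorem hom_eq {A₁ A₂ : C.FullSubcategory} {Y : WeakModule V} {f g : (A₁ ⊗ A₂).obj ⟶ Y}
    (h : ∀ b₁ b₂ h k, lin f ((T.𝒴 A₁ A₂).series b₁ b₂ h k)
      = lin g ((T.𝒴 A₁ A₂).series b₁ b₂ h k)) : f = g := by
  obtain ⟨W, ⟨f', rfl⟩, ⟨g', rfl⟩⟩ := hC.exists_cSub f g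
  have : f' = g' := (T.universal A₁ A₂ W.toC ((T.𝒴 A₁ A₂).comp f'.hom)).unique
    (fun _ _ _ _ => rfl) fun b₁ b₂ n k => W.1.incl_injective (h b₁ b₂ n k).symm
  rw [this]

end VertexTensorStructure

/-! ### Tensor product intertwining operators of a direct limit extension -/

namespace DirectLimitExtension

variable {C : ObjectProperty (WeakModule.{u} V)} [BraidedTensorCategoryWithTwist C]
  (hC : IsFiniteAbelian C) (T : VertexTensorStructure C) [BraidedTensorCategoryWithTwist (Ind C)]
  (E : DirectLimitExtension C)

/-- The canonical morphism `φ` from `W₁ ⊗ W₂` to the tensor product in `Ind(C)`. -/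
abbrev incl₂ (X₁ X₂ : (Ind C).FullSubcategory) (W₁ : CSub C X₁.obj) (W₂ : CSub C X₂.obj) :
    (W₁.toC ⊗ W₂.toC).obj ⟶ (X₁ ⊗ X₂).obj := (E.φ X₁ X₂).app (W₁, W₂)

theorem incl₂_naturality (X₁ X₂ : (Ind C).FullSubcategory) {W₁ U₁ : CSub C X₁.obj}
    {W₂ U₂ : CSub C X₂.obj} (h₁ : W₁ ≤ U₁) (h₂ : W₂ ≤ U₂) :
    ((C.homMk (Sub.inclOfLE h₁) : W₁.toC ⟶ U₁.toC) ⊗ₘ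
      (C.homMk (Sub.inclOfLE h₂) : W₂.toC ⟶ U₂.toC)).hom ≫ E.incl₂ X₁ X₂ U₁ U₂
      = E.incl₂ X₁ X₂ W₁ W₂ := by
  rw [incl₂, ← E.tensorHom (𝟙 X₁) (𝟙 X₂) W₁ W₂ U₁ U₂ _ _ rfl rfl, id_tensorHom_id]
  exact Category.comp_id _

include hC in
theorem exists_𝒴 (X₁ X₂ : (Ind C).FullSubcategory) :
    ∃ I : IntertwiningOperator X₁.obj X₂.obj (X₁ ⊗ X₂).obj,
      ∀ (W₁ : CSub C X₁.obj) (W₂ : CSub C X₂.obj) (w₁ : W₁.toC.obj) (w₂ : W₂.toC.obj),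
        I.series (lin W₁.incl w₁) (lin W₂.incl w₂)
          = ((T.𝒴 W₁.toC W₂.toC).comp (E.incl₂ X₁ X₂ W₁ W₂)).series w₁ w₂ := by
  refine hC.exists_glue X₁.2 X₂.2 (fun W₁ W₂ => (T.𝒴 W₁.toC W₂.toC).comp (E.incl₂ X₁ X₂ W₁ W₂)) ?_
  intro W₁ U₁ W₂ U₂ h₁ h₂ w₁ w₂
  funext h k
  rw [IntertwiningOperator.comp_series, IntertwiningOperator.comp_series,
    ← E.incl₂_naturality X₁ X₂ h₁ h₂, lin_comp_apply, T.tensorHom_series]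
  rfl

/-- The tensor product intertwining operators of a direct limit extension. -/
def 𝒴 (X₁ X₂ : (Ind C).FullSubcategory) : IntertwiningOperator X₁.obj X₂.obj (X₁ ⊗ X₂).obj :=
  (E.exists_𝒴 hC T X₁ X₂).choose

/-- The characterizing property `𝒴 ∘ (i_{W₁} ⊗ i_{W₂}) = φ_{W₁,W₂} ∘ 𝒴_{W₁,W₂}`. -/
theorem 𝒴_series (X₁ X₂ : (Ind C).FullSubcategory) {W₁ : CSub C X₁.obj} {W₂ : CSub C X₂.obj}
    (w₁ : W₁.toC.obj) (w₂ : W₂.toC.obj) (h : ℂ) (k : ℕ) :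
    (E.𝒴 hC T X₁ X₂).series (lin W₁.incl w₁) (lin W₂.incl w₂) h k
      = lin (E.incl₂ X₁ X₂ W₁ W₂) ((T.𝒴 W₁.toC W₂.toC).series w₁ w₂ h k) :=
  congrFun (congrFun ((E.exists_𝒴 hC T X₁ X₂).choose_spec W₁ W₂ w₁ w₂) h) k

include hC in
omit [BraidedTensorCategoryWithTwist C] [BraidedTensorCategoryWithTwist (Ind C)] in
theorem exists_lift (X : (Ind C).FullSubcategory) (b : X.obj) :
    ∃ (W : CSub C X.obj) (w : W.toC.obj), lin W.incl w = b := by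
  obtain ⟨W, hW⟩ := hC.exists_mem_cSub X.2 b
  exact ⟨W, W.1.elt b hW, rfl⟩

/-- A morphism out of the tensor product is determined by its composite with `𝒴`. -/
theorem 𝒴_hom_eq {X₁ X₂ : (Ind C).FullSubcategory} {Y : WeakModule V} {f g : (X₁ ⊗ X₂).obj ⟶ Y}
    (h : ∀ b₁ b₂ h k, lin f ((E.𝒴 hC T X₁ X₂).series b₁ b₂ h k)
      = lin g ((E.𝒴 hC T X₁ X₂).series b₁ b₂ h k)) : f = g := by
  refine (E.isColimit X₁ X₂).some.hom_ext fun W => T.hom_eq hC fun b₁ b₂ n k => ?_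
  have e := E.𝒴_series hC T X₁ X₂ (W₁ := W.1) (W₂ := W.2) b₁ b₂ n k
  exact (congrArg (lin f) e).symm.trans ((h _ _ n k).trans (congrArg (lin g) e))

/-- A morphism with a certain effect on the tensor product intertwining operator is characterized
by it. -/
theorem eq_iff {X₁ X₂ Y : (Ind C).FullSubcategory} {K : X₁ ⊗ X₂ ⟶ Y}
    {R : X₁.obj → X₂.obj → LogSeries Y.obj}
    (hK : ∀ b₁ b₂ h k, lin K.hom ((E.𝒴 hC T X₁ X₂).series b₁ b₂ h k) = R b₁ b₂ h k)
    (G : X₁ ⊗ X₂ ⟶ Y) : G = K ↔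
      ∀ b₁ b₂ h k, lin G.hom ((E.𝒴 hC T X₁ X₂).series b₁ b₂ h k) = R b₁ b₂ h k := by
  refine ⟨fun h => h ▸ hK, fun h => ObjectProperty.hom_ext _ (E.𝒴_hom_eq hC T ?_)⟩
  intro b₁ b₂ n k
  rw [h, hK]

theorem 𝒴_universal (im_mem : ∀ (W₁ W₂ X : WeakModule V) (I : IntertwiningOperator W₁ W₂ X),
      C W₁ → C W₂ → Ind C X → C I.im.toWeakModule) (X₁ X₂ X₃ : (Ind C).FullSubcategory)
    (I : IntertwiningOperator X₁.obj X₂.obj X₃.obj) :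
    ∃! f : X₁ ⊗ X₂ ⟶ X₃, ∀ b₁ b₂ h k,
      lin f.hom ((E.𝒴 hC T X₁ X₂).series b₁ b₂ h k) = I.series b₁ b₂ h k := by
  have ex : ∀ (W₁ : CSub C X₁.obj) (W₂ : CSub C X₂.obj),
      ∃ g : (W₁.toC ⊗ W₂.toC).obj ⟶ X₃.obj, ∀ b₁ b₂ h k,
        lin g ((T.𝒴 W₁.toC W₂.toC).series b₁ b₂ h k)
          = I.series (lin W₁.incl b₁) (lin W₂.incl b₂) h k := by
    intro W₁ W₂
    let J := I.precomp W₁.incl W₂.incl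
    obtain ⟨g, hg, -⟩ := T.universal W₁.toC W₂.toC
      ⟨J.im.toWeakModule, im_mem _ _ _ J W₁.2 W₂.2 X₃.2⟩ J.toIm
    exact ⟨g.hom ≫ J.im.incl, fun b₁ b₂ h k => congrArg (lin J.im.incl) (hg b₁ b₂ h k)⟩
  choose g hg using ex
  let s : Cocone (tensorSystem C X₁.obj X₂.obj) :=
    { pt := X₃.obj
      ι := { app := fun W => g W.1 W.2
             naturality := fun W U f => T.hom_eq hC fun b₁ b₂ h k => by
               have e := (hg U.1 U.2 (lin (Sub.inclOfLE (leOfHom f.1)) b₁)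
                 (lin (Sub.inclOfLE (leOfHom f.2)) b₂) h k).trans (hg W.1 W.2 b₁ b₂ h k).symm
               refine Eq.trans ?_ e
               exact congrArg (lin (g U.1 U.2)) (T.tensorHom_series
                 ((CSub.system C X₁.obj).map f.1) ((CSub.system C X₂.obj).map f.2) b₁ b₂ h k) } }
  have hs := fun W => (E.isColimit X₁ X₂).some.fac s W
  have hF : ∀ b₁ b₂ h k, lin ((E.isColimit X₁ X₂).some.desc s)
      ((E.𝒴 hC T X₁ X₂).series b₁ b₂ h k) = I.series b₁ b₂ h k := by
    intro b₁ b₂ h k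
    obtain ⟨W₁, b₁, rfl⟩ := exists_lift hC X₁ b₁
    obtain ⟨W₂, b₂, rfl⟩ := exists_lift hC X₂ b₂
    rw [𝒴_series]
    exact (congr_lin (hs (W₁, W₂)) _).trans (hg W₁ W₂ b₁ b₂ h k)
  exact ⟨(Ind C).homMk ((E.isColimit X₁ X₂).some.desc s), hF,
    fun f hf => (E.eq_iff hC T hF f).2 hf⟩

/-! ### The structure morphisms in terms of intertwining operators -/

theorem tensorHom_𝒴 {X₁ X₂ Z₁ Z₂ : (Ind C).FullSubcategory} (F₁ : X₁ ⟶ Z₁) (F₂ : X₂ ⟶ Z₂)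
    (b₁ : X₁.obj) (b₂ : X₂.obj) (h : ℂ) (k : ℕ) :
    lin (F₁ ⊗ₘ F₂).hom ((E.𝒴 hC T X₁ X₂).series b₁ b₂ h k)
      = (E.𝒴 hC T Z₁ Z₂).series (lin F₁.hom b₁) (lin F₂.hom b₂) h k := by
  obtain ⟨W₁, b₁, rfl⟩ := exists_lift hC X₁ b₁
  obtain ⟨W₂, b₂, rfl⟩ := exists_lift hC X₂ b₂
  have e : E.incl₂ X₁ X₂ W₁ W₂ ≫ _ = _ ≫ E.incl₂ Z₁ Z₂ _ _ :=
    E.tensorHom F₁ F₂ W₁ W₂ _ _ (IndTensor.toIm (W₁.incl ≫ F₁.hom))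
      (IndTensor.toIm (W₂.incl ≫ F₂.hom)) rfl rfl
  rw [𝒴_series, ← lin_comp_apply, e, lin_comp_apply, T.tensorHom_series]
  exact (E.𝒴_series hC T Z₁ Z₂ _ _ h k).symm

theorem leftUnitor_𝒴 (X : (Ind C).FullSubcategory) (v : V) (b : X.obj) (h : ℂ) (k : ℕ) :
    lin (λ_ X).hom.hom ((E.𝒴 hC T (𝟙_ _) X).series (lin (toUnit (Ind C)) v) b h k)
      = LogSeries.ofModes (fun n => X.obj.mode v n b) h k := by
  obtain ⟨W, b, rfl⟩ := exists_lift hC X b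
  obtain ⟨U, w, hw⟩ := exists_lift hC (𝟙_ (Ind C).FullSubcategory) (lin (toUnit (Ind C)) v)
  have hv : lin (U.incl ≫ ofUnit (Ind C) ≫ toUnit C) w = lin (toUnit C) v := by
    rw [lin_comp_apply, hw, lin_comp_apply]
    exact congrArg (lin (toUnit C)) (congr_lin (toUnit_ofUnit (Ind C)) v)
  have e : E.incl₂ (𝟙_ _) X U W ≫ (λ_ X).hom.hom = _ := E.leftUnitor X U W
  rw [← hw, 𝒴_series, ← lin_comp_apply, e, lin_comp_apply, T.whiskerRight_series,
    lin_comp_apply]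
  refine (congrArg (fun x => lin W.incl (lin (λ_ W.toC).hom.hom
    ((T.𝒴 (𝟙_ _) W.toC).series x b h k))) hv).trans ?_
  refine (congrArg (lin W.incl) ((T.leftUnitor_iff W.toC _).1 rfl v b h k)).trans ?_
  exact LogSeries.lin_ofModes W.incl (fun n => lin_mode W.incl v n b) h k

theorem rightUnitor_𝒴 (X : (Ind C).FullSubcategory) (v : V) (b : X.obj) (h : ℂ) (k : ℕ) :
    lin (ρ_ X).hom.hom ((E.𝒴 hC T X (𝟙_ _)).series b (lin (toUnit (Ind C)) v) h k)
      = (LogSeries.ofModes (fun n => (-1 : ℂ) ^ (-n - 1) • X.obj.mode v n b)).expL h k := by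
  obtain ⟨W, b, rfl⟩ := exists_lift hC X b
  obtain ⟨U, w, hw⟩ := exists_lift hC (𝟙_ (Ind C).FullSubcategory) (lin (toUnit (Ind C)) v)
  have hv : lin (U.incl ≫ ofUnit (Ind C) ≫ toUnit C) w = lin (toUnit C) v := by
    rw [lin_comp_apply, hw, lin_comp_apply]
    exact congrArg (lin (toUnit C)) (congr_lin (toUnit_ofUnit (Ind C)) v)
  have e : E.incl₂ X (𝟙_ _) W U ≫ (ρ_ X).hom.hom = _ := E.rightUnitor X U W
  rw [← hw, 𝒴_series, ← lin_comp_apply, e, lin_comp_apply, T.whiskerLeft_series,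
    lin_comp_apply]
  refine (congrArg (fun x => lin W.incl (lin (ρ_ W.toC).hom.hom
    ((T.𝒴 W.toC (𝟙_ _)).series b x h k))) hv).trans ?_
  refine (congrArg (lin W.incl) ((T.rightUnitor_iff W.toC _).1 rfl v b h k)).trans ?_
  refine LogSeries.lin_expL W.incl (LogSeries.ofModes_truncated ?_) (LogSeries.lin_ofModes W.incl
    fun n => ?_) h k
  · obtain ⟨N, hN⟩ := W.toC.obj.lower_truncation v b
    exact ⟨N, fun n hn => by rw [hN n hn, smul_zero]⟩
  · rw [map_smul, lin_mode]

theorem braiding_𝒴 (X₁ X₂ : (Ind C).FullSubcategory) (b₁ : X₁.obj) (b₂ : X₂.obj) (h : ℂ) (k : ℕ) :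
    lin (β_ X₁ X₂).hom.hom ((E.𝒴 hC T X₁ X₂).series b₁ b₂ h k)
      = ((E.𝒴 hC T X₂ X₁).series b₂ b₁).rotate.expL h k := by
  obtain ⟨W₁, b₁, rfl⟩ := exists_lift hC X₁ b₁
  obtain ⟨W₂, b₂, rfl⟩ := exists_lift hC X₂ b₂
  have e : E.incl₂ X₁ X₂ W₁ W₂ ≫ (β_ X₁ X₂).hom.hom = _ ≫ E.incl₂ X₂ X₁ W₂ W₁ :=
    E.braiding X₁ X₂ W₁ W₂
  rw [𝒴_series, ← lin_comp_apply, e, lin_comp_apply, (T.braiding_iff _ _ _).1 rfl]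
  refine LogSeries.lin_expL _ (fun h k => ?_) (LogSeries.lin_rotate _
    ((T.𝒴 W₂.toC W₁.toC).polynomial_in_log b₂ b₁) fun h k => ?_) h k
  · obtain ⟨N, hN⟩ := (T.𝒴 W₂.toC W₁.toC).lower_truncation b₂ b₁ h
    exact ⟨N, fun n hn => LogSeries.rotate_eq_zero (hN n hn) k⟩
  · exact (E.𝒴_series hC T X₂ X₁ b₂ b₁ h k).symm

include hC T E in
theorem twist_formula (X : (Ind C).FullSubcategory) (h : ℂ) (b : X.obj) (hb : b ∈ X.obj.wt h) :
    lin ((BraidedTensorCategoryWithTwist.twist (P := Ind C)).hom.app X).hom b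
      = Complex.exp (2 * Real.pi * Complex.I * h) •
        ∑ᶠ j : ℕ, ((2 * Real.pi * Complex.I) ^ j / (j.factorial : ℂ)) •
          ((X.obj.L 0 - h • (1 : Module.End ℂ X.obj)) ^ j) b := by
  obtain ⟨W, b, rfl⟩ := exists_lift hC X b
  rw [wt, Module.End.mem_maxGenEigenspace] at hb
  obtain ⟨m, hm⟩ := hb
  have hm' : ((W.toC.obj.L 0 - h • (1 : Module.End ℂ W.toC.obj)) ^ m) b = 0 :=
    W.1.incl_injective (by rw [map_zero]; exact (lin_pow_L_zero_sub W.incl h m b).trans hm)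
  rw [← lin_comp_apply, E.twist, lin_comp_apply, T.twist_eq W.toC h b
    ((Module.End.mem_maxGenEigenspace _ _ _).2 ⟨m, hm'⟩), map_smul, map_finsum_of_eventually_zero]
  · refine congrArg _ (finsum_congr fun j => ?_)
    rw [map_smul]
    exact congrArg _ (lin_pow_L_zero_sub W.incl h j b)
  · refine ⟨m, fun j hj => ?_⟩
    have : ((W.toC.obj.L 0 - h • (1 : Module.End ℂ W.toC.obj)) ^ j) b = 0 := by
      rw [← Nat.sub_add_cancel hj, pow_add, Module.End.mul_apply, hm', map_zero]
    rw [this, smul_zero]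

/-! ### Convergence and associativity -/

section Convergence

variable (im_mem : ∀ (W₁ W₂ X : WeakModule V) (I : IntertwiningOperator W₁ W₂ X),
  C W₁ → C W₂ → Ind C X → C I.im.toWeakModule)

omit [BraidedTensorCategoryWithTwist (Ind C)] in
include hC T im_mem in
/-- Restricted to `C`-submodules of `W₁`, `W₂`, `W₃` and corestricted to their images, the two
operators are operators between objects of `C`, by `im_mem`; there the product converges. -/
theorem product_converges (W₁ W₂ W₃ W₄ M : (Ind C).FullSubcategory)
    (I₁ : IntertwiningOperator W₁.obj M.obj W₄.obj)
    (I₂ : IntertwiningOperator W₂.obj W₃.obj M.obj) (w₁ : W₁.obj) (w₂ : W₂.obj) (w₃ : W₃.obj)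
    (ℓ₁ ℓ₂ : ℂ) (hℓ : ‖Complex.exp ℓ₂‖ < ‖Complex.exp ℓ₁‖) :
    ∃ s, ConvergesAbsolutelyTo (productTerm I₁ I₂ w₁ w₂ w₃ ℓ₁ ℓ₂) s := by
  obtain ⟨A₁, w₁, rfl⟩ := exists_lift hC W₁ w₁
  obtain ⟨A₂, w₂, rfl⟩ := exists_lift hC W₂ w₂
  obtain ⟨A₃, w₃, rfl⟩ := exists_lift hC W₃ w₃
  let K₂ := I₂.precomp A₂.incl A₃.incl
  let B : C.FullSubcategory := ⟨K₂.im.toWeakModule, im_mem _ _ _ K₂ A₂.2 A₃.2 M.2⟩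
  let K₁ := I₁.precomp A₁.incl K₂.im.incl
  let D : C.FullSubcategory := ⟨K₁.im.toWeakModule, im_mem _ _ _ K₁ A₁.2 B.2 W₄.2⟩
  obtain ⟨s, hs⟩ := T.product_converges A₁.toC A₂.toC A₃.toC D B K₁.toIm K₂.toIm w₁ w₂ w₃ ℓ₁ ℓ₂ hℓ
  refine ⟨completionMap K₁.im.incl s, ?_⟩
  have e : ∀ h, completionMap K₁.im.incl (productTerm K₁.toIm K₂.toIm w₁ w₂ w₃ ℓ₁ ℓ₂ h) = _ :=
    fun h => IntertwiningOperator.completionMap_productTerm (T.generalized _ A₁.2)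
      (T.generalized _ A₂.2) (T.generalized _ A₃.2) (T.generalized _ D.2) (T.generalized _ B.2)
      (hC.isGeneralized M.2) (hC.isGeneralized W₄.2) (I₁ := I₁) (I₂ := I₂) (f₁ := A₁.incl)
      (f₂ := A₂.incl) (f₃ := A₃.incl) (b := K₂.im.incl) (fun _ _ _ _ => rfl)
      (fun _ _ _ _ => rfl) w₁ w₂ w₃ ℓ₁ ℓ₂ h
  have := hs.map (f := K₁.im.incl)
  simpa only [e] using this

omit [BraidedTensorCategoryWithTwist (Ind C)] in
include hC T im_mem in
theorem iterate_converges (W₁ W₂ W₃ W₄ M : (Ind C).FullSubcategory)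
    (I₁ : IntertwiningOperator M.obj W₃.obj W₄.obj)
    (I₂ : IntertwiningOperator W₁.obj W₂.obj M.obj) (w₁ : W₁.obj) (w₂ : W₂.obj) (w₃ : W₃.obj)
    (ℓ₀ ℓ₂ : ℂ) (hℓ : ‖Complex.exp ℓ₀‖ < ‖Complex.exp ℓ₂‖) :
    ∃ s, ConvergesAbsolutelyTo (iterateTerm I₁ I₂ w₁ w₂ w₃ ℓ₀ ℓ₂) s := by
  obtain ⟨A₁, w₁, rfl⟩ := exists_lift hC W₁ w₁
  obtain ⟨A₂, w₂, rfl⟩ := exists_lift hC W₂ w₂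
  obtain ⟨A₃, w₃, rfl⟩ := exists_lift hC W₃ w₃
  let K₂ := I₂.precomp A₁.incl A₂.incl
  let B : C.FullSubcategory := ⟨K₂.im.toWeakModule, im_mem _ _ _ K₂ A₁.2 A₂.2 M.2⟩
  let K₁ := I₁.precomp K₂.im.incl A₃.incl
  let D : C.FullSubcategory := ⟨K₁.im.toWeakModule, im_mem _ _ _ K₁ B.2 A₃.2 W₄.2⟩
  obtain ⟨s, hs⟩ := T.iterate_converges A₁.toC A₂.toC A₃.toC D B K₁.toIm K₂.toIm w₁ w₂ w₃ ℓ₀ ℓ₂ hℓ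
  refine ⟨completionMap K₁.im.incl s, ?_⟩
  have e : ∀ h, completionMap K₁.im.incl (iterateTerm K₁.toIm K₂.toIm w₁ w₂ w₃ ℓ₀ ℓ₂ h) = _ :=
    fun h => IntertwiningOperator.completionMap_iterateTerm (T.generalized _ A₁.2)
      (T.generalized _ A₂.2) (T.generalized _ A₃.2) (T.generalized _ D.2) (T.generalized _ B.2)
      (hC.isGeneralized M.2) (hC.isGeneralized W₄.2) (I₁ := I₁) (I₂ := I₂) (f₁ := A₁.incl)
      (f₂ := A₂.incl) (f₃ := A₃.incl) (b := K₂.im.incl) (fun _ _ _ _ => rfl)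
      (fun _ _ _ _ => rfl) w₁ w₂ w₃ ℓ₀ ℓ₂ h
  have := hs.map (f := K₁.im.incl)
  simpa only [e] using this

end Convergence

/-- On vectors from `C`-submodules, product and iterate are the images of those in `C` under
`φ ∘ (id ⊗ φ')` and `φ ∘ (φ' ⊗ id)`, and the associators are intertwined by these morphisms. -/
theorem associativity_𝒴 (X₁ X₂ X₃ : (Ind C).FullSubcategory) (b₁ : X₁.obj) (b₂ : X₂.obj)
    (b₃ : X₃.obj) (r₁ r₂ : ℝ) (h₁ : r₁ > r₂) (h₂ : r₂ > r₁ - r₂) (h₃ : r₁ - r₂ > 0) :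
    ∃ (p : (X₁ ⊗ (X₂ ⊗ X₃)).obj.Completion) (q : ((X₁ ⊗ X₂) ⊗ X₃).obj.Completion),
      ConvergesAbsolutelyTo (productTerm (E.𝒴 hC T X₁ (X₂ ⊗ X₃)) (E.𝒴 hC T X₂ X₃) b₁ b₂ b₃
        (Real.log r₁) (Real.log r₂)) p ∧
      ConvergesAbsolutelyTo (iterateTerm (E.𝒴 hC T (X₁ ⊗ X₂) X₃) (E.𝒴 hC T X₁ X₂) b₁ b₂ b₃
        (Real.log (r₁ - r₂)) (Real.log r₂)) q ∧
      completionMap (α_ X₁ X₂ X₃).inv.hom p = q := by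
  obtain ⟨W₁, b₁, rfl⟩ := exists_lift hC X₁ b₁
  obtain ⟨W₂, b₂, rfl⟩ := exists_lift hC X₂ b₂
  obtain ⟨W₃, b₃, rfl⟩ := exists_lift hC X₃ b₃
  let W₁₂ := hC.im (E.incl₂ X₁ X₂ W₁ W₂)
  let W₂₃ := hC.im (E.incl₂ X₂ X₃ W₂ W₃)
  let g₁₂ : W₁.toC ⊗ W₂.toC ⟶ W₁₂.toC := IndTensor.toIm (E.incl₂ X₁ X₂ W₁ W₂)
  let g₂₃ : W₂.toC ⊗ W₃.toC ⟶ W₂₃.toC := IndTensor.toIm (E.incl₂ X₂ X₃ W₂ W₃)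
  have hα := E.associator X₁ X₂ X₃ W₁ W₂ W₃ W₁₂ W₂₃ g₁₂ g₂₃ rfl rfl
  let f := (W₁.toC ◁ g₂₃).hom ≫ E.incl₂ X₁ (X₂ ⊗ X₃) W₁ W₂₃
  let g := (g₁₂ ▷ W₃.toC).hom ≫ E.incl₂ (X₁ ⊗ X₂) X₃ W₁₂ W₃
  obtain ⟨p, q, hp, hq, hpq⟩ := T.associativity W₁.toC W₂.toC W₃.toC b₁ b₂ b₃ r₁ r₂ h₁ h₂ h₃
  have gen : ∀ A : C.FullSubcategory, A.obj.IsGeneralized := fun A => T.generalized _ A.2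
  have genI : ∀ X : (Ind C).FullSubcategory, X.obj.IsGeneralized := fun X => hC.isGeneralized X.2
  have ep := IntertwiningOperator.completionMap_productTerm (gen W₁.toC) (gen W₂.toC) (gen W₃.toC)
    (gen (W₁.toC ⊗ W₂.toC ⊗ W₃.toC)) (gen (W₂.toC ⊗ W₃.toC)) (genI (X₂ ⊗ X₃))
    (genI (X₁ ⊗ X₂ ⊗ X₃)) (I₁ := E.𝒴 hC T X₁ (X₂ ⊗ X₃)) (I₂ := E.𝒴 hC T X₂ X₃)
    (J₁ := T.𝒴 W₁.toC (W₂.toC ⊗ W₃.toC)) (J₂ := T.𝒴 W₂.toC W₃.toC) (f₁ := W₁.incl)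
    (f₂ := W₂.incl) (f₃ := W₃.incl) (f₄ := f) (b := E.incl₂ X₂ X₃ W₂ W₃)
    (fun x y h k => by
      rw [lin_comp_apply, T.whiskerLeft_series]
      exact (E.𝒴_series hC T X₁ (X₂ ⊗ X₃) x (lin g₂₃.hom y) h k).symm)
    (fun x y h k => (E.𝒴_series hC T X₂ X₃ x y h k).symm) b₁ b₂ b₃ (Real.log r₁) (Real.log r₂)
  have eq := IntertwiningOperator.completionMap_iterateTerm (gen W₁.toC) (gen W₂.toC) (gen W₃.toC)
    (gen ((W₁.toC ⊗ W₂.toC) ⊗ W₃.toC)) (gen (W₁.toC ⊗ W₂.toC)) (genI (X₁ ⊗ X₂))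
    (genI ((X₁ ⊗ X₂) ⊗ X₃)) (I₁ := E.𝒴 hC T (X₁ ⊗ X₂) X₃) (I₂ := E.𝒴 hC T X₁ X₂)
    (J₁ := T.𝒴 (W₁.toC ⊗ W₂.toC) W₃.toC) (J₂ := T.𝒴 W₁.toC W₂.toC) (f₁ := W₁.incl)
    (f₂ := W₂.incl) (f₃ := W₃.incl) (f₄ := g) (b := E.incl₂ X₁ X₂ W₁ W₂)
    (fun x y h k => by
      rw [lin_comp_apply, T.whiskerRight_series]
      exact (E.𝒴_series hC T (X₁ ⊗ X₂) X₃ (lin g₁₂.hom x) y h k).symm)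
    (fun x y h k => (E.𝒴_series hC T X₁ X₂ x y h k).symm) b₁ b₂ b₃
    (Real.log (r₁ - r₂)) (Real.log r₂)
  refine ⟨completionMap f p, completionMap g q, ?_, ?_, ?_⟩
  · simpa only [ep] using hp.map (f := f)
  · simpa only [Complex.ofReal_sub, eq] using hq.map (f := g)
  · rw [← hpq]
    have h : f ≫ (α_ X₁ X₂ X₃).inv.hom = (α_ W₁.toC W₂.toC W₃.toC).inv.hom ≫ g := by
      rw [Category.assoc]
      exact hα
    funext n
    exact Subtype.ext (congr_lin h (p n))

/-- A direct limit extension is vertex algebraic. -/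
def vertexTensorStructure
    (im_mem : ∀ (W₁ W₂ X : WeakModule V) (I : IntertwiningOperator W₁ W₂ X),
      C W₁ → C W₂ → Ind C X → C I.im.toWeakModule) : VertexTensorStructure (Ind C) where
  generalized _ hX := hC.isGeneralized hX
  𝒴 := E.𝒴 hC T
  universal := E.𝒴_universal hC T im_mem
  tensorHom_iff F₁ F₂ G := E.eq_iff hC T (E.tensorHom_𝒴 hC T F₁ F₂) G
  leftUnitor_iff X G := by
    refine ⟨fun h => h ▸ E.leftUnitor_𝒴 hC T X, fun h => ObjectProperty.hom_ext _
      (E.𝒴_hom_eq hC T fun u b n k => ?_)⟩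
    obtain ⟨v, rfl⟩ : ∃ v, lin (toUnit (Ind C)) v = u := ⟨lin (ofUnit (Ind C)) u, by
      rw [← lin_comp_apply]
      simp [ofUnit, toUnit]⟩
    exact (h v b n k).trans (E.leftUnitor_𝒴 hC T X v b n k).symm
  rightUnitor_iff X G := by
    refine ⟨fun h v b n k => h ▸ E.rightUnitor_𝒴 hC T X v b n k, fun h => ObjectProperty.hom_ext _
      (E.𝒴_hom_eq hC T fun b u n k => ?_)⟩
    obtain ⟨v, rfl⟩ : ∃ v, lin (toUnit (Ind C)) v = u := ⟨lin (ofUnit (Ind C)) u, by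
      rw [← lin_comp_apply]
      simp [ofUnit, toUnit]⟩
    exact (h v b n k).trans (E.rightUnitor_𝒴 hC T X v b n k).symm
  braiding_iff X₁ X₂ G := E.eq_iff hC T (E.braiding_𝒴 hC T X₁ X₂) G
  twist_eq := E.twist_formula hC T
  product_converges := product_converges hC T im_mem
  iterate_converges := iterate_converges hC T im_mem
  associativity := E.associativity_𝒴 hC T

end DirectLimitExtension

end VTC

end

theorem theorem6p2 {V : Type u} [AddCommGroup V] [Module ℂ V] [VTC.VertexOperatorAlgebra V]
    (C : CategoryTheory.ObjectProperty (VTC.WeakModule.{u} V))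
    (gradingRestricted : ∀ X, C X → X.IsGradingRestricted)
    (zero_mem : ∀ X : VTC.WeakModule V, Subsingleton X → C X)
    (closed_sub : ∀ (X Y : VTC.WeakModule V) (f : X ⟶ Y),
      Function.Injective (VTC.WeakModule.lin f) → C Y → C X)
    (closed_quotient : ∀ (X Y : VTC.WeakModule V) (f : X ⟶ Y),
      Function.Surjective (VTC.WeakModule.lin f) → C X → C Y)
    (closed_directSum : ∀ (X Y Z : VTC.WeakModule V) (f : X ⟶ Z) (g : Y ⟶ Z),
      (Function.Bijective fun p : X × Y =>
        VTC.WeakModule.lin f p.1 + VTC.WeakModule.lin g p.2) → C X → C Y → C Z)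
    (finitelyGenerated : ∀ X, C X → X.IsFinitelyGenerated)
    [VTC.BraidedTensorCategoryWithTwist C]
    (T : VTC.VertexTensorStructure C)
    (im_mem : ∀ (W₁ W₂ X : VTC.WeakModule V) (I : VTC.IntertwiningOperator W₁ W₂ X),
      C W₁ → C W₂ → VTC.Ind C X → C I.im.toWeakModule) :
    (∃ _ : VTC.BraidedTensorCategoryWithTwist (VTC.Ind C),
      Nonempty (VTC.DirectLimitExtension C)) ∧
    ∀ [VTC.BraidedTensorCategoryWithTwist (VTC.Ind C)] (E : VTC.DirectLimitExtension C),
      ∃ T' : VTC.VertexTensorStructure (VTC.Ind C),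
        ∀ (X₁ X₂ : (VTC.Ind C).FullSubcategory) (W₁ : VTC.CSub C X₁.obj)
          (W₂ : VTC.CSub C X₂.obj) (w₁ : W₁.toC.obj) (w₂ : W₂.toC.obj) (h : ℂ) (k : ℕ),
          (T'.𝒴 X₁ X₂).series (VTC.WeakModule.lin W₁.incl w₁) (VTC.WeakModule.lin W₂.incl w₂) h k
            = VTC.WeakModule.lin ((E.φ X₁ X₂).app (W₁, W₂))
                ((T.𝒴 W₁.toC W₂.toC).series w₁ w₂ h k) := by
  have hC : VTC.IsFiniteAbelian C :=
    ⟨gradingRestricted, zero_mem, closed_sub, closed_quotient, closed_directSum, finitelyGenerated⟩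
  refine ⟨⟨VTC.IndTensor.indBraidedTensor C, ⟨VTC.IndTensor.indExtension C⟩⟩, ?_⟩
  intro _ E
  exact ⟨E.vertexTensorStructure hC T im_mem, fun X₁ X₂ _ _ w₁ w₂ h k =>
    E.𝒴_series hC T X₁ X₂ w₁ w₂ h k⟩
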